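/- \textbf{Conventions.} A map on a compact connected oriented surface (a $2$-cell embedding of a finite connected graph, loops and multiple edges allowed) is described by its finite non-empty set $D$ of darts (directed edges), the permutation $R$ of $D$ sending a dart to the next dart around its initial vertex in the positive sense, and the fixed-point-free involution $L$ of $D$ reversing the direction of darts, where $\langle R,L\rangle$ is transitive on $D$. Vertices, edges and faces are the cycles of $R$, $L$ and $R^{-1}L$, and the Euler characteristic is $|V|-|E|+|F|$. The group of orientation-preserving automorphisms consists of the permutations of $D$ commuting with $R$ and $L$, and the map is orientably-regular if this group acts regularly on $D$. An isomorphism of maps is a bijection of the sets of darts commuting with the respective permutations $R$ and $L$. The mirror image of $\mathscr{M}=(D,R,L)$ is $\overline{\mathscr{M}}=(D,R^{-1},L)$ and its dual is $(D,R^{-1}L,L)$; $\mathscr{M}$ is reflexive if $\mathscr{M}\cong\overline{\mathscr{M}}$, and otherwise it is chiral and $\{\mathscr{M},\overline{\mathscr{M}}\}$ is a chiral pair. Maps (and chiral pairs) are counted up to isomorphism and duality. \textbf{Theorem.} Let $p\ge 11$ be a prime number, and consider the orientably-regular maps of Euler characteristic $-2p^2$ whose group of orientation-preserving automorphisms has order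 $10p^2$. 1. If $p\equiv -1 \bmod 5$, then up to isomorphism and duality there are exactly two such maps, and all such maps are reflexive. The equation $y^2+y-1=0$ has exactly two solutions in $\mathbb{Z}/p$, and if $t_1,t_2$ are these solutions (in either order), then the orientation-preserving automorphism group of each such map is isomorphic to $$\langle a,b,c,d : a^p=b^p=c^5=d^2=[a,b]=(da)^2=(db)^2=1,\ cac^{-1}=b^{t_2},\ cbc^{-1}=(ab)^{t_1},\ dcd=a^{t_1^2}b^2c\rangle .$$ 2. If $p\equiv 1 \bmod 5$, then up to isomorphism and duality there are exactly ten such maps: two reflexive ones and eight chiral ones, the latter forming four chiral pairs. There are primitive fifth roots of unity $k$ in $\mathbb{Z}/p^2$ and $s$ in $\mathbb{Z}/p$, and for every choice of $k$ and $s$ the following hold. Exactly two of the chiral pairs have orientation-preserving automorphism group isomorphic to $$\hat G_1=\langle a,b,c : a^{p^2}=b^5=c^2=(ca)^2=[c,b]=1,\ bab^{-1}=a^k\rangle ,$$ and exactly two have orientation-preserving automorphism group isomorphic to $\hat G_{s,s^2}$; every chiral map is of one of these two kinds; and the orientation-preserving automorphism group of every reflexive one is isomorphic to $\hat G_{s,s^4}$.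 Here, for $u,v\in\mathbb{Z}/p$, $$\hat G_{u,v}=\langle a,b,c,d : a^p=b^p=c^5=d^2=[a,b]=(da)^2=(db)^2=1,\ cac^{-1}=a^u,\ cbc^{-1}=b^v,\ dcd=a^{1-u}b^{1-v}c\rangle .$$ -/

import Mathlib

/-- A map on a compact connected oriented surface, given by its darts (directed edges):
`rot` sends a dart to the next dart, in the positive sense, around its initial vertex, and
`rev` sends a dart to the same edge with the opposite direction. The underlying graph may have
loops and multiple edges; it is finite and connected. -/
structure OrientedMap where
  Dart : Type
  finite_dart : Finite Dart
  nonempty_dart : Nonempty Dart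
  rot : Equiv.Perm Dart
  rev : Equiv.Perm Dart
  rev_mul_rev : rev * rev = 1
  rev_ne : ∀ x, rev x ≠ x
  connected : ∀ x y, ∃ g ∈ Subgroup.closure ({rot, rev} : Set (Equiv.Perm Dart)), g x = y

namespace OrientedMap

/-- The permutation sending a dart to the next dart along the boundary of the face on its left. -/
def faceRot (M : OrientedMap) : Equiv.Perm M.Dart := M.rot⁻¹ * M.rev

/-- The vertices are the cycles of `rot`. -/
def Vertex (M : OrientedMap) : Type := Quotient (Equiv.Perm.SameCycle.setoid M.rot)

/-- The edges are the cycles of `rev`, that is, the pairs of opposite darts. -/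
def Edge (M : OrientedMap) : Type := Quotient (Equiv.Perm.SameCycle.setoid M.rev)

/-- The faces are the cycles of `faceRot`. -/
def Face (M : OrientedMap) : Type := Quotient (Equiv.Perm.SameCycle.setoid M.faceRot)

/-- The Euler characteristic of the supporting surface. -/
noncomputable def eulerChar (M : OrientedMap) : ℤ :=
  (Nat.card M.Vertex : ℤ) - Nat.card M.Edge + Nat.card M.Face

/-- The group of orientation-preserving automorphisms, acting on the darts. -/
def autPlus (M : OrientedMap) : Subgroup (Equiv.Perm M.Dart) :=
  Subgroup.centralizer {M.rot, M.rev}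

/-- The orientation-preserving automorphisms act regularly on the darts. -/
def IsOrientablyRegular (M : OrientedMap) : Prop :=
  ∀ x y : M.Dart, ∃! f : M.autPlus, (f : Equiv.Perm M.Dart) x = y

/-- There is an orientation-preserving isomorphism from `M` to `N`. -/
def Isomorphic (M N : OrientedMap) : Prop :=
  ∃ e : M.Dart ≃ N.Dart, (∀ x, e (M.rot x) = N.rot (e x)) ∧ (∀ x, e (M.rev x) = N.rev (e x))

/-- The mirror image: the same map on the surface with the opposite orientation. -/
def mirror (M : OrientedMap) : OrientedMap where
  Dart := M.Dart
  finite_dart := M.finite_dart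
  nonempty_dart := M.nonempty_dart
  rot := M.rot⁻¹
  rev := M.rev
  rev_mul_rev := M.rev_mul_rev
  rev_ne := M.rev_ne
  connected x y := by
    obtain ⟨g, hg, h⟩ := M.connected x y
    refine ⟨g, (Subgroup.closure_le _).2 ?_ hg, h⟩
    rintro z (rfl | rfl)
    · exact inv_mem_iff.1 (Subgroup.subset_closure (by simp))
    · exact Subgroup.subset_closure (by simp)

/-- The dual map, on the same oriented surface: its vertices are the faces of `M`, and the dart of
the dual that corresponds to the dart `x` of `M` leaves the face on the left of `x` by crossing
`x`. -/
def dual (M : OrientedMap) : OrientedMap where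
  Dart := M.Dart
  finite_dart := M.finite_dart
  nonempty_dart := M.nonempty_dart
  rot := M.faceRot
  rev := M.rev
  rev_mul_rev := M.rev_mul_rev
  rev_ne := M.rev_ne
  connected x y := by
    obtain ⟨g, hg, h⟩ := M.connected x y
    refine ⟨g, (Subgroup.closure_le _).2 ?_ hg, h⟩
    have h1 : M.faceRot ∈ Subgroup.closure ({M.faceRot, M.rev} : Set (Equiv.Perm M.Dart)) :=
      Subgroup.subset_closure (by simp)
    have h2 : M.rev ∈ Subgroup.closure ({M.faceRot, M.rev} : Set (Equiv.Perm M.Dart)) :=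
      Subgroup.subset_closure (by simp)
    rintro z (rfl | rfl)
    · have h3 := mul_mem h2 (inv_mem h1)
      simpa [faceRot] using h3
    · exact h2

/-- A map is reflexive if it has an orientation-reversing automorphism. -/
def IsReflexive (M : OrientedMap) : Prop := M.Isomorphic M.mirror

/-- A map is chiral if it is not reflexive. -/
def IsChiral (M : OrientedMap) : Prop := ¬ M.IsReflexive

theorem Isomorphic.refl (M : OrientedMap) : M.Isomorphic M :=
  ⟨Equiv.refl _, fun _ => rfl, fun _ => rfl⟩

theorem Isomorphic.symm {M N : OrientedMap} (h : M.Isomorphic N) : N.Isomorphic M := by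
  obtain ⟨e, h1, h2⟩ := h
  refine ⟨e.symm, fun x => ?_, fun x => ?_⟩
  · rw [Equiv.symm_apply_eq, h1, Equiv.apply_symm_apply]
  · rw [Equiv.symm_apply_eq, h2, Equiv.apply_symm_apply]

theorem Isomorphic.trans {M N P : OrientedMap} (h : M.Isomorphic N) (h' : N.Isomorphic P) :
    M.Isomorphic P := by
  obtain ⟨e, h1, h2⟩ := h
  obtain ⟨f, h3, h4⟩ := h'
  exact ⟨e.trans f, fun x => by simp [h1, h3], fun x => by simp [h2, h4]⟩

theorem Isomorphic.dual {M N : OrientedMap} (h : M.Isomorphic N) :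
    M.dual.Isomorphic N.dual := by
  obtain ⟨e, h1, h2⟩ := h
  have h3 (x : M.Dart) : e (M.rot⁻¹ (M.rev x)) = N.rot⁻¹ (N.rev (e x)) := by
    rw [← h2, Equiv.Perm.eq_inv_iff_eq, ← h1]
    simp
  exact ⟨e, h3, h2⟩

theorem dual_dual_isomorphic (M : OrientedMap) : M.dual.dual.Isomorphic M := by
  refine ⟨M.rev, fun x => ?_, fun x => rfl⟩
  have h : M.rev * (M.rot⁻¹ * M.rev)⁻¹ * M.rev = M.rot * M.rev := by
    rw [mul_inv_rev, inv_inv, ← mul_assoc, mul_inv_cancel, one_mul]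
  exact congrArg (fun f : Equiv.Perm M.Dart => f x) h

/-- `M` and `N` are the same map up to isomorphism and duality. -/
def EquivUpToDuality (M N : OrientedMap) : Prop := M.Isomorphic N ∨ M.Isomorphic N.dual

def dualitySetoid : Setoid OrientedMap where
  r := EquivUpToDuality
  iseqv :=
    { refl := fun M => Or.inl (Isomorphic.refl M)
      symm := by
        rintro M N (h | h)
        · exact Or.inl h.symm
        · exact Or.inr (h.dual.trans N.dual_dual_isomorphic).symm
      trans := by
        rintro M N P (h | h) (h' | h')
        · exact Or.inl (h.trans h')
        · exact Or.inr (h.trans h')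
        · exact Or.inr (h.trans h'.dual)
        · exact Or.inl ((h.trans h'.dual).trans P.dual_dual_isomorphic) }

/-- The class of `M` up to isomorphism and duality. -/
def toClass (M : OrientedMap) : Quotient dualitySetoid := Quotient.mk dualitySetoid M

/-- The classes, up to isomorphism and duality, of the members of a family of maps. -/
def classes (S : Set OrientedMap) : Set (Quotient dualitySetoid) := toClass '' S

/-- The chiral pairs formed by the chiral members of `S` and their mirror images, up to isomorphism
and duality. -/
def chiralPairs (S : Set OrientedMap) : Set (Sym2 (Quotient dualitySetoid)) :=
  (fun M => s(toClass M, toClass M.mirror)) '' {M | M ∈ S ∧ M.IsChiral}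

/-- The orientably-regular maps of Euler characteristic `-2p²` whose orientation-preserving
automorphism group has order `10p²`. -/
def regularMaps (p : ℕ) : Set OrientedMap :=
  {M | M.IsOrientablyRegular ∧ M.eulerChar = -2 * (p : ℤ) ^ 2 ∧ Nat.card M.autPlus = 10 * p ^ 2}

end OrientedMap

/-- The relators of `⟨a, b, c : a^{p²} = b⁵ = c² = (ca)² = [c,b] = 1, bab⁻¹ = a^k⟩`. -/
def gOneHatRels (p : ℕ) (k : ZMod (p ^ 2)) : Set (FreeGroup (Fin 3)) :=
  let a : FreeGroup (Fin 3) := FreeGroup.of 0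
  let b : FreeGroup (Fin 3) := FreeGroup.of 1
  let c : FreeGroup (Fin 3) := FreeGroup.of 2
  {a ^ p ^ 2, b ^ 5, c ^ 2, (c * a) ^ 2, c * b * c⁻¹ * b⁻¹, (b * a * b⁻¹) * (a ^ k.val)⁻¹}

abbrev GOneHat (p : ℕ) (k : ZMod (p ^ 2)) : Type := PresentedGroup (gOneHatRels p k)

/-- The relators of `⟨a, b, c, d : a^p = b^p = c⁵ = d² = [a,b] = (da)² = (db)² = 1, cac⁻¹ = a^u,
cbc⁻¹ = b^v, dcd = a^{1-u} b^{1-v} c⟩`. -/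
def gHatRels (p : ℕ) (u v : ZMod p) : Set (FreeGroup (Fin 4)) :=
  let a : FreeGroup (Fin 4) := FreeGroup.of 0
  let b : FreeGroup (Fin 4) := FreeGroup.of 1
  let c : FreeGroup (Fin 4) := FreeGroup.of 2
  let d : FreeGroup (Fin 4) := FreeGroup.of 3
  {a ^ p, b ^ p, c ^ 5, d ^ 2, a * b * a⁻¹ * b⁻¹, (d * a) ^ 2, (d * b) ^ 2,
    (c * a * c⁻¹) * (a ^ u.val)⁻¹, (c * b * c⁻¹) * (b ^ v.val)⁻¹,
    (d * c * d) * (a ^ (1 - u).val * b ^ (1 - v).val * c)⁻¹}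

abbrev GHat (p : ℕ) (u v : ZMod p) : Type := PresentedGroup (gHatRels p u v)

/-- The relators of `⟨a, b, c, d : a^p = b^p = c⁵ = d² = [a,b] = (da)² = (db)² = 1,
cac⁻¹ = b^{t₂}, cbc⁻¹ = (ab)^{t₁}, dcd = a^{t₁²} b² c⟩`. -/
def gZeroHatRels (p : ℕ) (t₁ t₂ : ZMod p) : Set (FreeGroup (Fin 4)) :=
  let a : FreeGroup (Fin 4) := FreeGroup.of 0
  let b : FreeGroup (Fin 4) := FreeGroup.of 1
  let c : FreeGroup (Fin 4) := FreeGroup.of 2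
  let d : FreeGroup (Fin 4) := FreeGroup.of 3
  {a ^ p, b ^ p, c ^ 5, d ^ 2, a * b * a⁻¹ * b⁻¹, (d * a) ^ 2, (d * b) ^ 2,
    (c * a * c⁻¹) * (b ^ t₂.val)⁻¹, (c * b * c⁻¹) * ((a * b) ^ t₁.val)⁻¹,
    (d * c * d) * (a ^ (t₁ ^ 2).val * b ^ 2 * c)⁻¹}

abbrev GZeroHat (p : ℕ) (t₁ t₂ : ZMod p) : Type := PresentedGroup (gZeroHatRels p t₁ t₂)

/-!
Let `M` be an orientably-regular map of Euler characteristic `-2p²` with `|Aut⁺ M| = 10p²`. Its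
monodromy group `W = ⟨r, l⟩` acts regularly on the darts, so `W ≅ Aut⁺ M`, all vertices have the
degree `m = ord r` and all faces the degree `n = ord (r⁻¹ l)`. The Euler characteristic gives
`1/m + 1/n = 3/10`, hence `{m, n} = {5, 10}` because `W` has no element of order `4`; up to duality
`m = 10` (`orderOf_rot_faceRot_of_mem_regularMaps`).

By Sylow's theorem `W` has a normal subgroup `P` of order `p²`, and `P` is abelian. The quotient
`W / P` is cyclic of order `10`, generated by `r`, and `v = l r⁵` lies in `P`. Conjugation by `r`,
composed with inversion, makes `P` a cyclic `ℤ[X]`-module generated by `v`, and the relation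
`(r⁻¹ l)⁵ = 1` says that `1 + X + X² + X³ + X⁴` annihilates `v`. So `P` is the additive group of a
quotient `A` of `ℤ[ζ₅]` of order `p²`, and `W = A ⋊ ℤ/10`, where a generator of `ℤ/10` acts as
multiplication by `-ζ₅`, with `r = (0, 1)` and `l = (1, 5)` (`exists_cyclotomicQuotient`).
Conversely every such `A` gives a map (`toMap_mem`). Two of these maps are isomorphic exactly when
the quotients have the same kernel (`toMap_isomorphic`, `ker_eq_of_isomorphic`); none is
isomorphic to the dual of another, because the vertex degrees differ. The mirror image belongs to
the complex conjugate quotient (`toMap_mirror`). The classification of the maps is therefore that of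
the quotients of `ℤ[ζ₅]` of order `p²`, with complex conjugation acting on them.

* If `p ≡ -1 mod 5`, the quotients are the fields `𝔽_p[X]/(X² - tX + 1)` with `t² + t - 1 = 0`
  (`exists_inert`). There are two of them, both fixed by complex conjugation.
* If `p ≡ 1 mod 5`, there are four prime ideals over `p`. The square of such an ideal gives a
  quotient `ℤ/p²` and the product of two of them gives `𝔽_p × 𝔽_p`: altogether `4 + 6 = 10`
  quotients (`exists_ofIndex`). Complex conjugation permutes the four prime ideals without fixed
  points. It fixes two of the six products of pairs and none of the squares.

The presented groups of the statement have order at most `10p²` (`card_GHat_le`, `card_GOneHat_le`,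
`card_GZeroHat_le`), and `A ⋊ ℤ/10` is generated by elements satisfying their relations, so they are
isomorphic to it (`nonempty_GHat`, `nonempty_GOneHat`, `nonempty_GZeroHat`). The freedom to replace
`ζ₅` by another primitive fifth root of unity reduces the groups for `p ≡ 1 mod 5` to the three of
the statement. Those of the first kind are told apart from the others by their elements of order
`p²`.
-/

/-! ### Monodromy groups of orientably-regular maps -/

namespace OrientedMap

variable {M N : OrientedMap}

/-- The monodromy group of a map. -/
def mon (M : OrientedMap) : Subgroup (Equiv.Perm M.Dart) := Subgroup.closure {M.rot, M.rev}

theorem rot_mem_mon (M : OrientedMap) : M.rot ∈ M.mon := Subgroup.subset_closure (by simp)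

theorem rev_mem_mon (M : OrientedMap) : M.rev ∈ M.mon := Subgroup.subset_closure (by simp)

theorem faceRot_mem_mon (M : OrientedMap) : M.faceRot ∈ M.mon :=
  mul_mem (inv_mem M.rot_mem_mon) M.rev_mem_mon

theorem autPlus_apply_mon {f g : Equiv.Perm M.Dart} (hf : f ∈ M.autPlus) (hg : g ∈ M.mon)
    (x : M.Dart) : f (g x) = g (f x) := by
  have h := Subgroup.closure_le_centralizer_centralizer _ hg
  have h2 := Subgroup.mem_centralizer_iff.1 h f hf
  exact congrArg (fun e : Equiv.Perm M.Dart => e x) h2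

theorem IsOrientablyRegular.eq_one_of_apply_eq (h : M.IsOrientablyRegular)
    {g : Equiv.Perm M.Dart} (hg : g ∈ M.mon) {x : M.Dart} (hx : g x = x) : g = 1 := by
  ext y
  obtain ⟨f, rfl, -⟩ := h x y
  rw [← autPlus_apply_mon f.2 hg, hx, Equiv.Perm.one_apply]

/-- The monodromy group of an orientably-regular map acts regularly on the darts. -/
theorem IsOrientablyRegular.bijective_apply (h : M.IsOrientablyRegular) (x : M.Dart) :
    Function.Bijective (fun g : M.mon => (g : Equiv.Perm M.Dart) x) := by
  refine ⟨fun g g' hgg => ?_, fun y => ?_⟩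
  · have h1 : (g'⁻¹ * g : M.mon) = 1 := by
      refine Subtype.ext (h.eq_one_of_apply_eq (g'⁻¹ * g).2 (x := x) ?_)
      simp only at hgg
      simp [hgg]
    exact (inv_mul_eq_one.1 h1).symm
  · obtain ⟨g, hg, hgx⟩ := M.connected x y
    exact ⟨⟨g, hg⟩, hgx⟩

theorem IsOrientablyRegular.card_mon (h : M.IsOrientablyRegular) :
    Nat.card M.mon = Nat.card M.Dart :=
  have ⟨x⟩ := M.nonempty_dart
  Nat.card_eq_of_bijective _ (h.bijective_apply x)

theorem IsOrientablyRegular.card_autPlus (h : M.IsOrientablyRegular) :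
    Nat.card M.autPlus = Nat.card M.Dart :=
  have ⟨x⟩ := M.nonempty_dart
  Nat.card_eq_of_bijective (fun f : M.autPlus => (f : Equiv.Perm M.Dart) x)
    ⟨fun _ g hfg => (h x ((g : Equiv.Perm M.Dart) x)).unique hfg rfl,
      fun y => (h x y).exists⟩

/-- The two commuting regular actions on the darts are those of isomorphic groups: `f` corresponds
to the monodromy permutation that agrees with `f⁻¹` at a base dart. -/
theorem IsOrientablyRegular.nonempty_autPlus_mulEquiv_mon (h : M.IsOrientablyRegular) :
    Nonempty (M.autPlus ≃* M.mon) := by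
  have ⟨x⟩ := M.nonempty_dart
  let e := Equiv.ofBijective _ (h.bijective_apply x)
  have he (y : M.Dart) : (e.symm y : Equiv.Perm M.Dart) x = y := e.apply_symm_apply y
  refine ⟨MulEquiv.ofBijective
    (MonoidHom.mk' (fun f : M.autPlus => e.symm (((f⁻¹ : M.autPlus) : Equiv.Perm M.Dart) x))
      fun f g => ?_) ⟨fun f g hfg => ?_, fun w => ?_⟩⟩
  · apply e.injective
    change (e.symm _ : Equiv.Perm M.Dart) x =
      (e.symm _ : Equiv.Perm M.Dart) ((e.symm _ : Equiv.Perm M.Dart) x)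
    rw [he, he, ← autPlus_apply_mon (g⁻¹).2 (e.symm _).2, he]
    simp
  · have h2 := e.symm.injective hfg
    exact inv_injective ((h x _).unique h2 rfl)
  · obtain ⟨f, hf, -⟩ := h x ((w : Equiv.Perm M.Dart) x)
    refine ⟨f⁻¹, e.injective ?_⟩
    change (e.symm _ : Equiv.Perm M.Dart) x = _
    rw [he, inv_inv, hf]
    rfl

/-- All cycles of a monodromy permutation of an orientably-regular map have the same length. -/
theorem IsOrientablyRegular.card_cycles_mul_orderOf (h : M.IsOrientablyRegular)
    {g : Equiv.Perm M.Dart} (hg : g ∈ M.mon) :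
    Nat.card (Quotient (Equiv.Perm.SameCycle.setoid g)) * orderOf g = Nat.card M.Dart := by
  have hs : Equiv.Perm.SameCycle.setoid g = MulAction.orbitRel (Subgroup.zpowers g) M.Dart := by
    ext x y
    constructor
    · rintro ⟨i, hi⟩
      refine (MulAction.orbitRel _ _).symm ⟨⟨g ^ i, i, rfl⟩, hi⟩
    · rintro ⟨⟨_, i, rfl⟩, hi⟩
      exact Equiv.Perm.SameCycle.symm ⟨i, hi⟩
  have hfree (x : M.Dart) : MulAction.stabilizer (Subgroup.zpowers g) x = ⊥ := by
    rw [eq_bot_iff]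
    intro k hk
    refine Subgroup.mem_bot.2 (Subtype.ext (h.eq_one_of_apply_eq (x := x) ?_ hk))
    exact (Subgroup.zpowers_le.2 hg) k.2
  rw [Nat.card_congr (MulAction.selfEquivOrbitsQuotientProd hfree), Nat.card_prod,
    Nat.card_zpowers, hs]

theorem rev_ne_one (M : OrientedMap) : M.rev ≠ 1 := fun h => by
  have ⟨x⟩ := M.nonempty_dart
  exact M.rev_ne x (by rw [h]; rfl)

theorem orderOf_rev (M : OrientedMap) : orderOf M.rev = 2 :=
  orderOf_eq_prime (by rw [pow_two, M.rev_mul_rev]) M.rev_ne_one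

theorem IsOrientablyRegular.card_vertex_mul (h : M.IsOrientablyRegular) :
    Nat.card M.Vertex * orderOf M.rot = Nat.card M.Dart := h.card_cycles_mul_orderOf M.rot_mem_mon

theorem IsOrientablyRegular.card_edge_mul (h : M.IsOrientablyRegular) :
    Nat.card M.Edge * 2 = Nat.card M.Dart :=
  M.orderOf_rev ▸ h.card_cycles_mul_orderOf M.rev_mem_mon

theorem IsOrientablyRegular.card_face_mul (h : M.IsOrientablyRegular) :
    Nat.card M.Face * orderOf M.faceRot = Nat.card M.Dart :=
  h.card_cycles_mul_orderOf M.faceRot_mem_mon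

theorem autPlus_dual (M : OrientedMap) : M.dual.autPlus = M.autPlus := by
  change Subgroup.centralizer {M.faceRot, M.rev} = Subgroup.centralizer {M.rot, M.rev}
  ext f
  simp only [Subgroup.mem_centralizer_iff, Set.mem_insert_iff, Set.mem_singleton_iff,
    forall_eq_or_imp, forall_eq]
  refine and_congr_left fun h => ?_
  change Commute M.rev f at h
  change Commute (M.rot⁻¹ * M.rev) f ↔ Commute M.rot f
  refine ⟨fun h3 => ?_, fun h3 => h3.inv_left.mul_left h⟩
  have := (h3.mul_left h.inv_left).inv_left
  simpa using this

theorem nonempty_autPlus_dual (M : OrientedMap) : Nonempty (M.autPlus ≃* M.dual.autPlus) :=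
  ⟨{  toFun := fun f => ⟨f.1, by rw [autPlus_dual]; exact f.2⟩
      invFun := fun f => ⟨f.1, by rw [← autPlus_dual]; exact f.2⟩
      left_inv := fun _ => rfl
      right_inv := fun _ => rfl
      map_mul' := fun _ _ => rfl }⟩

theorem IsOrientablyRegular.dual (h : M.IsOrientablyRegular) : M.dual.IsOrientablyRegular := by
  unfold IsOrientablyRegular
  rw [autPlus_dual]
  exact h

theorem faceRot_dual (M : OrientedMap) : M.dual.faceRot = M.rev * M.rot * M.rev := by
  change (M.rot⁻¹ * M.rev)⁻¹ * M.rev = _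
  rw [mul_inv_rev, inv_inv, inv_eq_of_mul_eq_one_left M.rev_mul_rev]

theorem orderOf_faceRot_dual (M : OrientedMap) : orderOf M.dual.faceRot = orderOf M.rot := by
  rw [faceRot_dual]
  have := (MulAut.conj M.rev).orderOf_eq M.rot
  rwa [MulAut.conj_apply, inv_eq_of_mul_eq_one_left M.rev_mul_rev] at this

theorem IsOrientablyRegular.card_face_dual (h : M.IsOrientablyRegular) :
    Nat.card M.dual.Face = Nat.card M.Vertex := by
  have h1 := h.dual.card_face_mul
  rw [orderOf_faceRot_dual] at h1
  have := M.finite_dart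
  exact Nat.eq_of_mul_eq_mul_right (orderOf_pos M.rot) (h1.trans h.card_vertex_mul.symm)

theorem dual_mem_regularMaps {p : ℕ} (h : M ∈ regularMaps p) : M.dual ∈ regularMaps p := by
  obtain ⟨h1, h2, h3⟩ := h
  refine ⟨h1.dual, ?_, by rw [autPlus_dual]; exact h3⟩
  rw [← h2]
  unfold eulerChar
  rw [h1.card_face_dual]
  change (Nat.card M.Face : ℤ) - Nat.card M.Edge + Nat.card M.Vertex = _
  ring

theorem Isomorphic.mirror (h : M.Isomorphic N) : M.mirror.Isomorphic N.mirror := by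
  obtain ⟨e, h1, h2⟩ := h
  refine ⟨e, fun x => ?_, h2⟩
  change e (M.rot⁻¹ x) = N.rot⁻¹ (e x)
  rw [Equiv.Perm.eq_inv_iff_eq, ← h1]
  exact congrArg e (M.rot.apply_symm_apply x)

theorem mirror_dual_isomorphic (M : OrientedMap) : M.dual.mirror.Isomorphic M.mirror.dual := by
  refine ⟨M.rev, fun x => ?_, fun x => rfl⟩
  have h : M.rev * (M.rot⁻¹ * M.rev)⁻¹ = (M.rot⁻¹)⁻¹ * M.rev * M.rev := by
    rw [mul_inv_rev, inv_inv, ← mul_assoc, mul_inv_cancel, one_mul, mul_assoc, M.rev_mul_rev,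
      mul_one]
  exact congrArg (fun f : Equiv.Perm M.Dart => f x) h

theorem Isomorphic.isReflexive (h : M.Isomorphic N) (hM : M.IsReflexive) : N.IsReflexive :=
  (h.symm.trans hM).trans h.mirror

theorem IsReflexive.dual (h : M.IsReflexive) : M.dual.IsReflexive :=
  (Isomorphic.dual h).trans M.mirror_dual_isomorphic.symm

theorem isReflexive_dual_iff : M.dual.IsReflexive ↔ M.IsReflexive :=
  ⟨fun h => M.dual_dual_isomorphic.isReflexive h.dual, fun h => h.dual⟩

/-- An isomorphism conjugates permutations; this is the resulting isomorphism of automorphism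
groups. -/
theorem Isomorphic.nonempty_autPlus (h : M.Isomorphic N) : Nonempty (M.autPlus ≃* N.autPlus) := by
  obtain ⟨e, h1, h2⟩ := h
  have hr : e.permCongrHom M.rot = N.rot := by ext y; simp [h1]
  have hl : e.permCongrHom M.rev = N.rev := by ext y; simp [h2]
  have : M.autPlus.map e.permCongrHom.toMonoidHom = N.autPlus := by
    ext f
    rw [Subgroup.mem_map_equiv]
    simp only [autPlus, Subgroup.mem_centralizer_iff, Set.mem_insert_iff, Set.mem_singleton_iff,
      forall_eq_or_imp, forall_eq]
    rw [← hr, ← hl, ← e.permCongrHom.injective.eq_iff, ← e.permCongrHom.injective.eq_iff]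
    simp only [map_mul, MulEquiv.apply_symm_apply]
  exact ⟨(e.permCongrHom.subgroupMap M.autPlus).trans (MulEquiv.subgroupCongr this)⟩

theorem Isomorphic.orderOf_faceRot (h : M.Isomorphic N) :
    orderOf M.faceRot = orderOf N.faceRot := by
  obtain ⟨e, h1, -⟩ := h.dual
  let e' : M.Dart ≃ N.Dart := e
  have hr : e'.permCongrHom M.faceRot = N.faceRot := by
    ext y; exact (h1 _).trans (congrArg N.faceRot (e.apply_symm_apply y))
  rw [← hr, MulEquiv.orderOf_eq]

/-! ### Vertex and face degrees -/

/-- The Euler characteristic forces `1/m + 1/n = 3/10` for the vertex degree `m` and the face degree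
`n`, and an element of order `4` is excluded by the order of the group. -/
theorem orderOf_rot_faceRot_of_mem_regularMaps {p : ℕ} (hp : p.Prime) (hp2 : p ≠ 2)
    (h : M ∈ regularMaps p) :
    (orderOf M.rot = 10 ∧ orderOf M.faceRot = 5) ∨
      (orderOf M.rot = 5 ∧ orderOf M.faceRot = 10) := by
  obtain ⟨h1, h2, h3⟩ := h
  rw [h1.card_autPlus] at h3
  have hV := h1.card_vertex_mul
  have hE := h1.card_edge_mul
  have hF := h1.card_face_mul
  rw [h3] at hV hE hF
  have hpp : 0 < p ^ 2 := pow_pos hp.pos 2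
  have hdvd {g : Equiv.Perm M.Dart} (hg : g ∈ M.mon) : orderOf g ∣ 10 * p ^ 2 := by
    rw [← h3, ← h1.card_mon, ← Subgroup.orderOf_mk g hg]
    exact orderOf_dvd_natCard _
  have h4 {g : Equiv.Perm M.Dart} (hg : g ∈ M.mon) : orderOf g ≠ 4 := by
    intro h4
    have h5 : 2 * 2 ∣ 2 * (5 * p ^ 2) := by
      have := h4 ▸ hdvd hg
      convert this using 1; ring
    have h6 := Nat.dvd_of_mul_dvd_mul_left two_pos h5
    rcases (Nat.Prime.dvd_mul Nat.prime_two).1 h6 with h7 | h7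
    · omega
    · exact hp2 ((Nat.prime_dvd_prime_iff_eq Nat.prime_two hp).1
        (Nat.prime_two.dvd_of_dvd_pow h7)).symm
  have hm4 := h4 M.rot_mem_mon
  have hn4 := h4 M.faceRot_mem_mon
  unfold eulerChar at h2
  rw [← Nat.cast_pow] at h2
  generalize Nat.card M.Vertex = V at *
  generalize Nat.card M.Face = F at *
  generalize Nat.card M.Edge = E at *
  generalize orderOf M.rot = m at *
  generalize orderOf M.faceRot = n at *
  generalize p ^ 2 = q at *
  have hVF : V + F = 3 * q := by
    have : (E : ℤ) * 2 = 10 * q := by exact_mod_cast hE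
    omega
  have key : 10 * (m + n) = 3 * (m * n) := by
    have : q * (10 * (m + n)) = q * (3 * (m * n)) := by
      calc q * (10 * (m + n)) = (10 * q) * n + (10 * q) * m := by ring
        _ = (V * m) * n + (F * n) * m := by rw [hV, hF]
        _ = (V + F) * (m * n) := by ring
        _ = _ := by rw [hVF]; ring
    exact Nat.eq_of_mul_eq_mul_left hpp this
  have hm0 : 0 < m := Nat.pos_of_ne_zero (by rintro rfl; omega)
  have hn0 : 0 < n := Nat.pos_of_ne_zero (by rintro rfl; omega)
  -- the smaller degree is at most `20 / 3`
  have small {a b : ℕ} (ha : 0 < a) (hab : a ≤ b) (hab' : 10 * (a + b) = 3 * (a * b)) :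
      (a = 4 ∨ a = 5) ∧ (a = 5 → b = 10) := by
    have : a ≤ 6 := by
      by_contra! h7
      nlinarith
    interval_cases a <;> omega
  rcases le_total m n with hmn | hmn
  · have := small hm0 hmn key
    omega
  · have := small hn0 hmn (by linarith)
    omega

/-! ### The map of a group with two generators -/

/-- The map with dart set a finite group `G` on which its generators `r` and `l` act by left
multiplication. -/
def ofGroup (G : Type) [Group G] [Finite G] (r l : G) (hl : l * l = 1) (hl1 : l ≠ 1)
    (hgen : Subgroup.closure {r, l} = ⊤) : OrientedMap where
  Dart := G
  finite_dart := inferInstance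
  nonempty_dart := inferInstance
  rot := MulAction.toPermHom G G r
  rev := MulAction.toPermHom G G l
  rev_mul_rev := by rw [← map_mul, hl, map_one]
  rev_ne x h := hl1 (by simpa using h)
  connected x y := by
    have h : ({MulAction.toPermHom G G r, MulAction.toPermHom G G l} : Set (Equiv.Perm G)) =
      MulAction.toPermHom G G '' {r, l} := by simp [Set.image_pair]
    refine ⟨MulAction.toPermHom G G (y * x⁻¹), ?_, by simp⟩
    rw [h, ← MonoidHom.map_closure, hgen]
    exact ⟨_, trivial, rfl⟩

section ofGroup

variable {G : Type} [Group G] [Finite G] {r l : G} {hl : l * l = 1} {hl1 : l ≠ 1}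
  {hgen : Subgroup.closure {r, l} = ⊤}

theorem isOrientablyRegular_ofGroup : (ofGroup G r l hl hl1 hgen).IsOrientablyRegular := by
  intro (x : G) (y : G)
  let m : Equiv.Perm (ofGroup G r l hl hl1 hgen).Dart :=
    (Equiv.mulRight (x⁻¹ * y) : Equiv.Perm G)
  have hm : m ∈ (ofGroup G r l hl hl1 hgen).autPlus := by
    change Equiv.mulRight (x⁻¹ * y) ∈ Subgroup.centralizer
      {MulAction.toPermHom G G r, MulAction.toPermHom G G l}
    simp only [Subgroup.mem_centralizer_iff, Set.mem_insert_iff, Set.mem_singleton_iff,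
      forall_eq_or_imp, forall_eq]
    constructor <;> ext z <;> simp [mul_assoc]
  have hxy : m x = y := mul_inv_cancel_left x y
  refine ⟨⟨m, hm⟩, hxy, fun f hf => Subtype.ext (Equiv.ext fun z => ?_)⟩
  obtain ⟨g, hg, rfl⟩ := (ofGroup G r l hl hl1 hgen).connected x z
  exact (autPlus_apply_mon f.2 hg x).trans
    ((congrArg g (hf.trans hxy.symm)).trans (autPlus_apply_mon hm hg x).symm)

omit [Finite G] in
/-- A homomorphism sending the generators to `rot` and `rev` maps onto the monodromy group. -/
theorem range_eq_mon {ψ : G →* Equiv.Perm M.Dart} (hgen : Subgroup.closure {r, l} = ⊤)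
    (h1 : ψ r = M.rot) (h2 : ψ l = M.rev) : ψ.range = M.mon := by
  rw [MonoidHom.range_eq_map, ← hgen, MonoidHom.map_closure, Set.image_pair, h1, h2]
  rfl

theorem nonempty_autPlus_ofGroup : Nonempty ((ofGroup G r l hl hl1 hgen).autPlus ≃* G) := by
  obtain ⟨e⟩ := (isOrientablyRegular_ofGroup (hl := hl) (hl1 := hl1)
    (hgen := hgen)).nonempty_autPlus_mulEquiv_mon
  let ψ : G →* Equiv.Perm (ofGroup G r l hl hl1 hgen).Dart := MulAction.toPermHom G G
  have hψ : Function.Injective ψ := MulAction.toPerm_injective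
  exact ⟨e.trans ((MulEquiv.subgroupCongr (range_eq_mon (ψ := ψ) hgen rfl rfl).symm).trans
    (MonoidHom.ofInjective hψ).symm)⟩

omit [Finite G] in
theorem orderOf_toPermHom (g : G) : orderOf (MulAction.toPermHom G G g) = orderOf g :=
  orderOf_injective _ MulAction.toPerm_injective g

theorem ofGroup_mem_regularMaps {p : ℕ} (hc : Nat.card G = 10 * p ^ 2) (hr : orderOf r = 10)
    (hrl : orderOf (r⁻¹ * l) = 5) : ofGroup G r l hl hl1 hgen ∈ regularMaps p := by
  have h := isOrientablyRegular_ofGroup (hl := hl) (hl1 := hl1) (hgen := hgen)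
  have hD : Nat.card (ofGroup G r l hl hl1 hgen).Dart = 10 * p ^ 2 := hc
  refine ⟨h, ?_, by rw [h.card_autPlus, hD]⟩
  have hV := h.card_vertex_mul
  have hE := h.card_edge_mul
  have hF := h.card_face_mul
  have h1 : orderOf (ofGroup G r l hl hl1 hgen).rot = 10 := (orderOf_toPermHom r).trans hr
  have h2 : orderOf (ofGroup G r l hl hl1 hgen).faceRot = 5 := by
    rw [← hrl, ← orderOf_toPermHom (r⁻¹ * l), map_mul, map_inv]
    rfl
  rw [hD] at hV hE hF
  rw [h1] at hV
  rw [h2] at hF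
  unfold eulerChar
  generalize Nat.card (ofGroup G r l hl hl1 hgen).Vertex = V at *
  generalize Nat.card (ofGroup G r l hl hl1 hgen).Face = F at *
  generalize Nat.card (ofGroup G r l hl hl1 hgen).Edge = E at *
  zify at hV hE hF
  linarith

/-- An orientably-regular map is the map of its monodromy group. -/
theorem IsOrientablyRegular.ofGroup_isomorphic (h : M.IsOrientablyRegular)
    (ψ : G →* Equiv.Perm M.Dart) (hψ : Function.Injective ψ) (h1 : ψ r = M.rot)
    (h2 : ψ l = M.rev) : (ofGroup G r l hl hl1 hgen).Isomorphic M := by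
  obtain ⟨x⟩ := M.nonempty_dart
  have hr : ψ.range = M.mon := range_eq_mon hgen h1 h2
  refine ⟨Equiv.ofBijective (fun g : G => ψ g x) ⟨fun g g' hgg => hψ ?_, fun y => ?_⟩,
    fun (g : G) => ?_, fun (g : G) => ?_⟩
  · have hm (g : G) : ψ g ∈ M.mon := hr ▸ ⟨g, rfl⟩
    exact congrArg Subtype.val
      ((h.bijective_apply x).1 (a₁ := ⟨ψ g, hm g⟩) (a₂ := ⟨ψ g', hm g'⟩) hgg)
  · obtain ⟨g, hg, hgx⟩ := M.connected x y
    obtain ⟨g', rfl⟩ : g ∈ ψ.range := hr ▸ hg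
    exact ⟨g', hgx⟩
  · change ψ (r * g) x = M.rot (ψ g x)
    rw [map_mul, h1]; rfl
  · change ψ (l * g) x = M.rev (ψ g x)
    rw [map_mul, h2]; rfl

theorem ofGroup_isomorphic_ofGroup {G' : Type} [Group G'] [Finite G'] {r' l' : G'}
    {hl' : l' * l' = 1} {hl1' : l' ≠ 1} {hgen' : Subgroup.closure {r', l'} = ⊤}
    (ψ : G →* G') (hψ : Function.Injective ψ) (h1 : ψ r = r') (h2 : ψ l = l') :
    (ofGroup G r l hl hl1 hgen).Isomorphic (ofGroup G' r' l' hl' hl1' hgen') :=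
  isOrientablyRegular_ofGroup.ofGroup_isomorphic ((MulAction.toPermHom G' G').comp ψ)
    (MulAction.toPerm_injective.comp hψ) (by subst h1; rfl) (by subst h2; rfl)

/-- An isomorphism between the maps of two groups with generators becomes, after translating the
image of `1` to `1`, an isomorphism of the groups. -/
theorem exists_hom_of_ofGroup_isomorphic {G' : Type} [Group G'] [Finite G'] {r' l' : G'}
    {hl' : l' * l' = 1} {hl1' : l' ≠ 1} {hgen' : Subgroup.closure {r', l'} = ⊤}
    (h : (ofGroup G r l hl hl1 hgen).Isomorphic (ofGroup G' r' l' hl' hl1' hgen')) :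
    ∃ ψ : G →* G', Function.Injective ψ ∧ ψ r = r' ∧ ψ l = l' := by
  obtain ⟨(e : G ≃ G'), h1, h2⟩ := h
  replace h1 (x : G) : e (r * x) = r' * e x := h1 x
  replace h2 (x : G) : e (l * x) = l' * e x := h2 x
  have key (w : G) : ∀ x, e (w * x) = e w * (e 1)⁻¹ * e x := by
    suffices ∃ w' : G', ∀ x, e (w * x) = w' * e x by
      obtain ⟨w', hw⟩ := this
      have := hw 1
      rw [mul_one] at this
      intro x
      rw [hw, this]; group
    have hw : w ∈ Subgroup.closure {r, l} := hgen ▸ trivial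
    induction hw using Subgroup.closure_induction with
    | mem w hw =>
      rcases hw with rfl | rfl
      exacts [⟨r', h1⟩, ⟨l', h2⟩]
    | one => exact ⟨1, by simp⟩
    | mul a b _ _ ha hb =>
      obtain ⟨a', ha⟩ := ha
      obtain ⟨b', hb⟩ := hb
      exact ⟨a' * b', fun x => by rw [mul_assoc, ha, hb, mul_assoc]⟩
    | inv a _ ha =>
      obtain ⟨a', ha⟩ := ha
      exact ⟨a'⁻¹, fun x => by rw [eq_inv_mul_iff_mul_eq, ← ha, mul_inv_cancel_left]⟩
  refine ⟨MonoidHom.mk' (fun g => e g * (e 1)⁻¹) fun a b => ?_, fun a b hab => ?_, ?_, ?_⟩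
  · simp only [key a b, mul_assoc]
  · exact e.injective (mul_right_cancel hab)
  · have := h1 1
    rw [mul_one] at this
    simp [this]
  · have := h2 1
    rw [mul_one] at this
    simp [this]

end ofGroup

end OrientedMap

/-! ### Twisted groups -/

open Polynomial in
/-- A quotient of `ℤ[ζ₅]` of order `p²`, given as a ring `carrier` with the image `x` of `ζ₅`. -/
structure CyclotomicQuotient (p : ℕ) where
  carrier : Type
  [ring : CommRing carrier]
  x : carrier
  rel : 1 + x + x ^ 2 + x ^ 3 + x ^ 4 = 0
  gen : Function.Surjective (aeval x : ℤ[X] →ₐ[ℤ] carrier)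
  card : Nat.card carrier = p ^ 2

attribute [instance] CyclotomicQuotient.ring

/-- The homomorphism from the cyclic group of order `n` that sends a generator to `g`. -/
def zmodPowHom {G : Type*} [Group G] (n : ℕ) (g : G) (hg : g ^ n = 1) :
    Multiplicative (ZMod n) →* G :=
  AddMonoidHom.toMultiplicativeLeft
    (ZMod.lift n ⟨zmultiplesHom (Additive G) (Additive.ofMul g), by
      simp [← ofMul_pow, hg]⟩)

theorem zmodPowHom_natCast {G : Type*} [Group G] {n : ℕ} {g : G} (hg : g ^ n = 1) (k : ℕ) :
    zmodPowHom n g hg (Multiplicative.ofAdd (k : ZMod n)) = g ^ k := by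
  have := ZMod.lift_coe n (⟨zmultiplesHom (Additive G) (Additive.ofMul g), by
      simp [← ofMul_pow, hg]⟩ : { f : ℤ →+ Additive G // f n = 0 }) k
  have h2 := congrArg Additive.toMul this
  simpa [zmodPowHom] using h2

theorem pow_five_of_rel {A : Type*} [CommRing A] {x : A} (h : 1 + x + x ^ 2 + x ^ 3 + x ^ 4 = 0) :
    x ^ 5 = 1 := by linear_combination (x - 1) * h

/-- Multiplication by `-x`, where `x` is a root of the fifth cyclotomic polynomial. -/
def mulNeg {A : Type*} [CommRing A] {x : A} (h : 1 + x + x ^ 2 + x ^ 3 + x ^ 4 = 0) :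
    MulAut (Multiplicative A) where
  toFun a := Multiplicative.ofAdd (-x * a.toAdd)
  invFun a := Multiplicative.ofAdd (-x ^ 4 * a.toAdd)
  left_inv a := by
    apply Multiplicative.toAdd.injective
    simp only [toAdd_ofAdd]
    linear_combination a.toAdd * pow_five_of_rel h
  right_inv a := by
    apply Multiplicative.toAdd.injective
    simp only [toAdd_ofAdd]
    linear_combination a.toAdd * pow_five_of_rel h
  map_mul' a b := by
    apply Multiplicative.toAdd.injective
    simp [mul_add]

theorem mulNeg_pow_apply {A : Type*} [CommRing A] {x : A} (h : 1 + x + x ^ 2 + x ^ 3 + x ^ 4 = 0)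
    (n : ℕ) (a : A) :
    (mulNeg h ^ n) (Multiplicative.ofAdd a) = Multiplicative.ofAdd ((-x) ^ n * a) := by
  induction n with
  | zero => simp
  | succ n ih =>
    rw [pow_succ', MulAut.mul_apply, ih, pow_succ', mul_assoc]
    rfl

theorem neg_pow_five_of_rel {A : Type*} [CommRing A] {x : A}
    (h : 1 + x + x ^ 2 + x ^ 3 + x ^ 4 = 0) : (-x) ^ 5 = -1 := by
  linear_combination -pow_five_of_rel h

theorem neg_pow_ten_of_rel {A : Type*} [CommRing A] {x : A}
    (h : 1 + x + x ^ 2 + x ^ 3 + x ^ 4 = 0) : (-x) ^ 10 = 1 := by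
  linear_combination (x ^ 5 + 1) * pow_five_of_rel h

theorem mulNeg_pow_ten {A : Type*} [CommRing A] {x : A}
    (h : 1 + x + x ^ 2 + x ^ 3 + x ^ 4 = 0) : mulNeg h ^ 10 = 1 := by
  ext a
  have := mulNeg_pow_apply h 10 a.toAdd
  rw [neg_pow_ten_of_rel h, one_mul] at this
  exact this

/-- The semidirect product of the additive group of a ring with the cyclic group of order `10`,
a generator of which acts as multiplication by `-x`, for a root `x` of the fifth cyclotomic
polynomial. -/
abbrev TwistedGroup {A : Type*} [CommRing A] {x : A} (h : 1 + x + x ^ 2 + x ^ 3 + x ^ 4 = 0) :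
    Type _ :=
  Multiplicative A ⋊[zmodPowHom 10 (mulNeg h) (mulNeg_pow_ten h)] Multiplicative (ZMod 10)

namespace TwistedGroup

variable {A : Type*} [CommRing A] {x : A} (h : 1 + x + x ^ 2 + x ^ 3 + x ^ 4 = 0)

/-- The translation by a ring element. -/
def tr (a : A) : TwistedGroup h := SemidirectProduct.inl (Multiplicative.ofAdd a)

/-- The generator of the cyclic group of order `10`. -/
def rt : TwistedGroup h := SemidirectProduct.inr (Multiplicative.ofAdd 1)

theorem tr_zero : tr h 0 = 1 := rfl

theorem tr_add (a b : A) : tr h (a + b) = tr h a * tr h b := by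
  unfold tr; rw [ofAdd_add, map_mul]

theorem tr_neg (a : A) : tr h (-a) = (tr h a)⁻¹ := by
  unfold tr; rw [ofAdd_neg, map_inv]

theorem tr_pow (a : A) (n : ℕ) : tr h a ^ n = tr h (n * a) := by
  unfold tr; rw [← nsmul_eq_mul, ofAdd_nsmul, map_pow]

theorem tr_injective : Function.Injective (tr h) := fun _ _ hab =>
  Multiplicative.ofAdd.injective (SemidirectProduct.inl_injective hab)

theorem rt_pow (n : ℕ) : rt h ^ n = SemidirectProduct.inr (Multiplicative.ofAdd (n : ZMod 10)) := by
  unfold rt; rw [← map_pow, ← ofAdd_nsmul, nsmul_one]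

theorem rt_pow_ten : rt h ^ 10 = 1 := by
  rw [rt_pow]; rfl

theorem right_tr_mul_rt_pow (a : A) (n : ℕ) :
    (tr h a * rt h ^ n).right = Multiplicative.ofAdd (n : ZMod 10) := by
  rw [rt_pow]; simp [tr]

theorem eq_tr_mul_rt_pow (w : TwistedGroup h) : ∃ (a : A) (n : ℕ), w = tr h a * rt h ^ n := by
  refine ⟨w.left.toAdd, (w.right.toAdd : ZMod 10).val, ?_⟩
  rw [rt_pow, ZMod.natCast_rightInverse _]
  exact (SemidirectProduct.inl_left_mul_inr_right w).symm

theorem rt_pow_mul_tr (n : ℕ) (a : A) : rt h ^ n * tr h a = tr h ((-x) ^ n * a) * rt h ^ n := by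
  have := SemidirectProduct.inl_aut
    (φ := zmodPowHom 10 (mulNeg h) (mulNeg_pow_ten h)) (Multiplicative.ofAdd (n : ZMod 10))
    (Multiplicative.ofAdd a)
  rw [zmodPowHom_natCast, mulNeg_pow_apply, map_inv, ← rt_pow] at this
  exact (mul_inv_eq_iff_eq_mul.1 this.symm)

theorem mul_rt_pow_mul (a b : A) (m n : ℕ) :
    (tr h a * rt h ^ m) * (tr h b * rt h ^ n) = tr h (a + (-x) ^ m * b) * rt h ^ (m + n) := by
  rw [tr_add, pow_add]
  simp only [mul_assoc]
  rw [← mul_assoc (rt h ^ m), rt_pow_mul_tr, mul_assoc]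

theorem tr_mul_rt_pow_pow (a : A) (m n : ℕ) :
    (tr h a * rt h ^ m) ^ n =
      tr h ((∑ i ∈ Finset.range n, ((-x) ^ m) ^ i) * a) * rt h ^ (m * n) := by
  induction n with
  | zero => simp [tr_zero]
  | succ n ih =>
    rw [pow_succ', ih, mul_rt_pow_mul, Finset.sum_range_succ', ← mul_assoc, Finset.mul_sum]
    congr 2
    · simp only [← pow_succ', pow_zero]
      ring
    · ring

theorem tr_mul_rt_pow_eq_iff {a b : A} {m n : ℕ} :
    tr h a * rt h ^ m = tr h b * rt h ^ n ↔ a = b ∧ (m : ZMod 10) = n := by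
  refine ⟨fun hab => ?_, ?_⟩
  · have h1 := congrArg SemidirectProduct.right hab
    rw [right_tr_mul_rt_pow, right_tr_mul_rt_pow] at h1
    have h2 : (m : ZMod 10) = n := Multiplicative.ofAdd.injective h1
    rw [rt_pow, rt_pow, h2] at hab
    exact ⟨tr_injective h (mul_right_cancel hab), h2⟩
  · rintro ⟨rfl, hmn⟩
    rw [rt_pow, rt_pow, hmn]

theorem orderOf_rt : orderOf (rt h) = 10 := by
  refine (orderOf_eq_iff (by norm_num)).2 ⟨rt_pow_ten h, fun m hm hm0 hm1 => ?_⟩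
  have := (tr_mul_rt_pow_eq_iff h (a := 0) (b := 0) (m := m) (n := 0)).1 (by rw [hm1, pow_zero])
  have h2 := (ZMod.natCast_eq_natCast_iff' _ _ _).1 this.2
  omega

theorem natCard : Nat.card (TwistedGroup h) = 10 * Nat.card A := by
  rw [SemidirectProduct.card, mul_comm]
  congr 1
  exact Nat.card_zmod 10

instance [Finite A] : Finite (TwistedGroup h) :=
  Finite.of_equiv _ SemidirectProduct.equivProd.symm

/-- The involution that, together with `rt`, generates the group. -/
def inv : TwistedGroup h := tr h 1 * rt h ^ 5

theorem inv_mul_inv : inv h * inv h = 1 := by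
  unfold inv
  rw [mul_rt_pow_mul, neg_pow_five_of_rel h, rt_pow_ten, mul_one, ← tr_zero]
  congr 1; ring

theorem inv_ne_one : inv h ≠ 1 := by
  intro h1
  have := (tr_mul_rt_pow_eq_iff h (a := 1) (b := 0) (m := 5) (n := 0)).1
    (by rw [pow_zero, tr_zero, mul_one]; exact h1)
  exact absurd this.2 (by decide)

theorem orderOf_rt_inv_mul_inv : orderOf ((rt h)⁻¹ * inv h) = 5 := by
  have h1 : (rt h)⁻¹ * inv h = tr h (-x ^ 4) * rt h ^ 4 := by
    rw [inv_mul_eq_iff_eq_mul, ← mul_assoc]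
    have := mul_rt_pow_mul h 0 (-x ^ 4) 1 4
    rw [tr_zero, one_mul, pow_one] at this
    rw [mul_assoc, this]
    unfold inv
    congr 2
    linear_combination -pow_five_of_rel h
  rw [h1]
  have : Fact (Nat.Prime 5) := ⟨by norm_num⟩
  refine orderOf_eq_prime ?_ fun h2 => ?_
  · rw [tr_mul_rt_pow_pow, show rt h ^ (4 * 5) = (rt h ^ 10) ^ 2 by rw [← pow_mul], rt_pow_ten,
      one_pow, mul_one, ← tr_zero]
    congr 1
    simp only [Finset.sum_range_succ, Finset.sum_range_zero]
    linear_combination (-x ^ 4) * h - x ^ 4 * (x ^ 3 + x ^ 2 * (x ^ 5 + 1) +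
      x * (x ^ 10 + x ^ 5 + 1)) * pow_five_of_rel h
  · have := (tr_mul_rt_pow_eq_iff h (a := -x ^ 4) (b := 0) (m := 4) (n := 0)).1
      (by rw [pow_zero, tr_zero, mul_one]; exact h2)
    exact absurd this.2 (by decide)

open Polynomial in
/-- A subgroup containing `rt` and a translation `tr a` contains `tr b` for every `b` in the ideal
generated by `a`. -/
theorem tr_mul_mem {S : Subgroup (TwistedGroup h)} (hgen : Function.Surjective
    (aeval x : ℤ[X] →ₐ[ℤ] A)) (hr : rt h ∈ S) {a : A} (ha : tr h a ∈ S) (b : A) :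
    tr h (b * a) ∈ S := by
  obtain ⟨f, rfl⟩ := hgen b
  have hx (c : A) (hc : tr h c ∈ S) : tr h (x * c) ∈ S := by
    have h1 := rt_pow_mul_tr h 1 c
    rw [pow_one, pow_one] at h1
    have h2 := mul_mem (mul_mem hr hc) (inv_mem hr)
    rw [h1, mul_inv_cancel_right] at h2
    have h3 := inv_mem h2
    rwa [← tr_neg, neg_mul, neg_neg] at h3
  induction f using Polynomial.induction_on with
  | C n =>
    rw [aeval_C, algebraMap_int_eq, eq_intCast]
    have h1 := zpow_mem ha n
    unfold tr at h1 ⊢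
    rwa [← zsmul_eq_mul, ofAdd_zsmul, map_zpow]
  | add f g hf hg => rw [map_add, add_mul, tr_add]; exact mul_mem hf hg
  | monomial n c hc =>
    have := hx _ hc
    convert this using 2
    simp only [map_mul, map_pow, aeval_X]
    ring

open Polynomial in
/-- The group of a quotient of `ℤ[ζ₅]` is generated by `rt` and `inv`: since `x` generates the ring,
the conjugates of `tr 1` by the powers of `rt` generate all translations. -/
theorem closure_eq_top (hgen : Function.Surjective (aeval x : ℤ[X] →ₐ[ℤ] A)) :
    Subgroup.closure {rt h, inv h} = ⊤ := by
  have hr : rt h ∈ Subgroup.closure {rt h, inv h} := Subgroup.subset_closure (by simp)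
  have hl : inv h ∈ Subgroup.closure {rt h, inv h} := Subgroup.subset_closure (by simp)
  have h1 : tr h 1 ∈ Subgroup.closure {rt h, inv h} := by
    have := mul_mem hl (inv_mem (pow_mem hr 5))
    rwa [inv, mul_inv_cancel_right] at this
  rw [eq_top_iff]
  intro w _
  obtain ⟨a, n, rfl⟩ := eq_tr_mul_rt_pow h w
  refine mul_mem ?_ (pow_mem hr n)
  have := tr_mul_mem h hgen hr h1 a
  rwa [mul_one] at this

variable {h} in
/-- The universal property of the semidirect product. -/
theorem exists_hom {H : Type*} [Group H] (φ : Multiplicative A →* H) {r : H} (hr : r ^ 10 = 1)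
    (hφ : ∀ a : A, r * φ (.ofAdd a) * r⁻¹ = φ (.ofAdd (-x * a))) :
    ∃ ψ : TwistedGroup h →* H, (∀ a, ψ (tr h a) = φ (.ofAdd a)) ∧ ψ (rt h) = r := by
  have hn (n : ℕ) (a : A) : r ^ n * φ (.ofAdd a) * (r ^ n)⁻¹ = φ (.ofAdd ((-x) ^ n * a)) := by
    induction n with
    | zero => simp
    | succ n ih =>
      rw [pow_succ', pow_succ', mul_assoc (-x), ← hφ, ← ih]
      group
  refine ⟨SemidirectProduct.lift φ (zmodPowHom 10 r hr) fun g => ?_, fun a => ?_, ?_⟩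
  · refine MonoidHom.ext fun a => ?_
    obtain ⟨n, rfl⟩ : ∃ n : ℕ, g = Multiplicative.ofAdd (n : ZMod 10) :=
      ⟨(g.toAdd : ZMod 10).val, by rw [ZMod.natCast_rightInverse _]; rfl⟩
    have h1 := mulNeg_pow_apply h n a.toAdd
    rw [ofAdd_toAdd] at h1
    simp only [MonoidHom.comp_apply, MulEquiv.coe_toMonoidHom, zmodPowHom_natCast, h1,
      MulAut.conj_apply]
    exact (hn n a.toAdd).symm
  · simp [tr]
  · have := zmodPowHom_natCast hr 1
    rw [pow_one, Nat.cast_one] at this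
    simpa [rt] using this

end TwistedGroup

/-! ### The maps of the quotients of `ℤ[ζ₅]` -/

open Polynomial

namespace CyclotomicQuotient

variable {p : ℕ}

instance [NeZero p] (X : CyclotomicQuotient p) : Finite X.carrier :=
  Nat.finite_of_card_ne_zero (by rw [X.card]; exact pow_ne_zero _ (NeZero.ne p))

/-- The kernel of the evaluation of integer polynomials at `x`; it determines the quotient up to
isomorphism. -/
noncomputable def ker (X : CyclotomicQuotient p) : Ideal ℤ[X] :=
  RingHom.ker (aeval X.x : ℤ[X] →ₐ[ℤ] X.carrier)

theorem mem_ker {X : CyclotomicQuotient p} {f : ℤ[X]} : f ∈ X.ker ↔ aeval X.x f = 0 :=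
  RingHom.mem_ker

/-- Complex conjugation: the same ring, with the generator `x⁻¹ = x⁴`. -/
noncomputable def conj (X : CyclotomicQuotient p) : CyclotomicQuotient p where
  carrier := X.carrier
  x := X.x ^ 4
  rel := by
    linear_combination X.rel + (X.x ^ 3 + X.x ^ 2 * (X.x ^ 5 + 1) +
      X.x * (X.x ^ 10 + X.x ^ 5 + 1)) * pow_five_of_rel X.rel
  gen a := by
    obtain ⟨f, rfl⟩ := X.gen a
    refine ⟨expand ℤ 4 f, ?_⟩
    rw [expand_aeval, ← pow_mul, show X.x ^ (4 * 4) = X.x by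
      linear_combination X.x * (X.x ^ 10 + X.x ^ 5 + 1) * pow_five_of_rel X.rel]
  card := X.card

theorem map_aeval_int {R S : Type*} [CommRing R] [CommRing S] (φ : R →+* S) (r : R) (f : ℤ[X]) :
    φ (aeval r f) = aeval (φ r) f :=
  (aeval_algHom_apply φ.toIntAlgHom r f).symm

theorem ker_le_of_ringHom {X Y : CyclotomicQuotient p} (f : X.carrier →+* Y.carrier)
    (hf : f X.x = Y.x) : X.ker ≤ Y.ker := by
  intro g hg
  rw [mem_ker] at hg ⊢
  rw [← hf, ← map_aeval_int, hg, map_zero]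

/-- If `X.ker ≤ Y.ker`, the identity of `ℤ[ζ₅]` induces an isomorphism of the quotients: both have
the same finite order. -/
theorem exists_ringEquiv [NeZero p] {X Y : CyclotomicQuotient p} (h : X.ker ≤ Y.ker) :
    ∃ e : X.carrier ≃+* Y.carrier, e X.x = Y.x := by
  let f : X.carrier →+* Y.carrier :=
    ((aeval X.x : ℤ[X] →ₐ[ℤ] X.carrier) : ℤ[X] →+* X.carrier).liftOfSurjective
      X.gen ⟨((aeval Y.x : ℤ[X] →ₐ[ℤ] Y.carrier) : ℤ[X] →+* Y.carrier), h⟩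
  have hf (g : ℤ[X]) : f (aeval X.x g) = aeval Y.x g :=
    RingHom.liftOfRightInverse_comp_apply _ _ (Function.rightInverse_surjInv X.gen) ⟨_, h⟩ g
  have hs : Function.Surjective f := fun y => by
    obtain ⟨g, rfl⟩ := Y.gen y
    exact ⟨_, hf g⟩
  refine ⟨RingEquiv.ofBijective f ((Nat.bijective_iff_surjective_and_card f).2
    ⟨hs, X.card.trans Y.card.symm⟩), ?_⟩
  simpa using hf Polynomial.X

theorem ker_eq_of_le [NeZero p] {X Y : CyclotomicQuotient p} (h : X.ker ≤ Y.ker) :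
    X.ker = Y.ker := by
  obtain ⟨e, he⟩ := exists_ringEquiv h
  exact h.antisymm (ker_le_of_ringHom (e.symm : Y.carrier →+* X.carrier) (by simp [← he]))

/-- The orientably-regular map of a quotient of `ℤ[ζ₅]`. -/
noncomputable def toMap [NeZero p] (X : CyclotomicQuotient p) : OrientedMap :=
  OrientedMap.ofGroup (TwistedGroup X.rel) (TwistedGroup.rt X.rel) (TwistedGroup.inv X.rel)
    (TwistedGroup.inv_mul_inv X.rel) (TwistedGroup.inv_ne_one X.rel)
    (TwistedGroup.closure_eq_top X.rel X.gen)

theorem toMap_mem [NeZero p] (X : CyclotomicQuotient p) : X.toMap ∈ OrientedMap.regularMaps p := by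
  unfold toMap
  exact OrientedMap.ofGroup_mem_regularMaps (by rw [TwistedGroup.natCard, X.card])
    (TwistedGroup.orderOf_rt X.rel) (TwistedGroup.orderOf_rt_inv_mul_inv X.rel)

theorem orderOf_rot_toMap [NeZero p] (X : CyclotomicQuotient p) : orderOf X.toMap.rot = 10 :=
  (OrientedMap.orderOf_toPermHom _).trans (TwistedGroup.orderOf_rt X.rel)

theorem nonempty_autPlus_toMap [NeZero p] (X : CyclotomicQuotient p) :
    Nonempty (X.toMap.autPlus ≃* TwistedGroup X.rel) := by
  unfold toMap
  exact OrientedMap.nonempty_autPlus_ofGroup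

/-- A group generated by `r` and `l` that receives a suitable homomorphism from `X.carrier` is the
group of `X`. -/
theorem exists_bijective_hom [NeZero p] (X : CyclotomicQuotient p) {G : Type*} [Group G]
    {r l : G} (hgen : Subgroup.closure {r, l} = ⊤) (hG : Nat.card G = 10 * p ^ 2)
    (φ : Multiplicative X.carrier →* G) (hr : r ^ 10 = 1)
    (hφ : ∀ a : X.carrier, r * φ (.ofAdd a) * r⁻¹ = φ (.ofAdd (-X.x * a)))
    (hl : φ (.ofAdd 1) * r ^ 5 = l) :
    ∃ ψ : TwistedGroup X.rel →* G, Function.Bijective ψ ∧ ψ (TwistedGroup.rt X.rel) = r ∧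
      ψ (TwistedGroup.inv X.rel) = l := by
  obtain ⟨ψ, h1, h2⟩ := TwistedGroup.exists_hom (h := X.rel) φ hr hφ
  have h3 : ψ (TwistedGroup.inv X.rel) = l := by
    rw [TwistedGroup.inv, map_mul, map_pow, h1, h2, hl]
  have : Finite G := Nat.finite_of_card_ne_zero (by
    rw [hG]; exact mul_ne_zero (by norm_num) (pow_ne_zero _ (NeZero.ne p)))
  refine ⟨ψ, (Nat.bijective_iff_surjective_and_card ψ).2 ⟨?_, ?_⟩, h2, h3⟩
  · rw [← MonoidHom.range_eq_top, eq_top_iff, ← hgen, Subgroup.closure_le]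
    rintro _ (rfl | rfl)
    exacts [⟨_, h2⟩, ⟨_, h3⟩]
  · rw [TwistedGroup.natCard, X.card, hG]

theorem toMap_isomorphic [NeZero p] {X Y : CyclotomicQuotient p} (h : X.ker ≤ Y.ker) :
    X.toMap.Isomorphic Y.toMap := by
  obtain ⟨e, he⟩ := exists_ringEquiv h
  obtain ⟨ψ, hψ, h1, h2⟩ := X.exists_bijective_hom
    (TwistedGroup.closure_eq_top Y.rel Y.gen) (by rw [TwistedGroup.natCard, Y.card])
    (SemidirectProduct.inl.comp (AddMonoidHom.toMultiplicative (e : X.carrier →+ Y.carrier)))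
    (TwistedGroup.rt_pow_ten Y.rel) (fun a => by
      have := TwistedGroup.rt_pow_mul_tr Y.rel 1 (e a)
      rw [pow_one, pow_one] at this
      rw [mul_inv_eq_iff_eq_mul]
      refine this.trans ?_
      have h1 : -Y.x * e a = e (-X.x * a) := by rw [map_mul, map_neg, he]
      rw [h1]
      rfl) (l := TwistedGroup.inv Y.rel) (by
      rw [TwistedGroup.inv, ← map_one e]
      rfl)
  exact OrientedMap.ofGroup_isomorphic_ofGroup ψ hψ.1 h1 h2

/-- The mirror image of the map of `X` is the map of the complex conjugate: inverting `rt` replaces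
multiplication by `-x` by multiplication by `-x⁻¹`. -/
theorem toMap_mirror [NeZero p] (X : CyclotomicQuotient p) :
    X.conj.toMap.Isomorphic X.toMap.mirror := by
  have hm : X.toMap.mirror.IsOrientablyRegular := by
    have h1 := X.toMap_mem.1
    have : X.toMap.mirror.autPlus = X.toMap.autPlus := by
      change Subgroup.centralizer {X.toMap.rot⁻¹, X.toMap.rev} =
        Subgroup.centralizer {X.toMap.rot, X.toMap.rev}
      ext f
      simp only [Subgroup.mem_centralizer_iff, Set.mem_insert_iff, Set.mem_singleton_iff,
        forall_eq_or_imp, forall_eq]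
      exact and_congr_left fun _ => Commute.inv_left_iff
    unfold OrientedMap.IsOrientablyRegular
    rw [this]
    exact h1
  have hr := TwistedGroup.rt_pow_ten X.rel
  have hr9 : (TwistedGroup.rt X.rel)⁻¹ = TwistedGroup.rt X.rel ^ 9 :=
    inv_eq_of_mul_eq_one_left (by rw [← pow_succ, hr])
  obtain ⟨ψ, hψ, h1, h2⟩ := X.conj.exists_bijective_hom
    (r := (TwistedGroup.rt X.rel)⁻¹) (l := TwistedGroup.inv X.rel) (by
      rw [eq_top_iff, ← TwistedGroup.closure_eq_top X.rel X.gen, Subgroup.closure_le]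
      rintro _ (rfl | rfl)
      · exact inv_mem_iff.1 (Subgroup.subset_closure (by simp))
      · exact Subgroup.subset_closure (by simp)) (by rw [TwistedGroup.natCard, X.card])
    SemidirectProduct.inl (by rw [inv_pow, hr, inv_one]) (fun a => by
      have := TwistedGroup.rt_pow_mul_tr X.rel 9 a
      rw [hr9, mul_inv_eq_iff_eq_mul]
      refine this.trans ?_
      rw [show (-X.x) ^ 9 = -X.x ^ 4 by linear_combination - X.x ^ 4 * pow_five_of_rel X.rel]
      rfl) (by
      rw [TwistedGroup.inv, hr9, ← pow_mul, show 9 * 5 = 10 * 4 + 5 by norm_num, pow_add, pow_mul,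
        hr, one_pow, one_mul]
      rfl)
  let χ : TwistedGroup X.rel →* Equiv.Perm X.toMap.mirror.Dart :=
    MulAction.toPermHom (TwistedGroup X.rel) (TwistedGroup X.rel)
  have hχ : Function.Injective χ := MulAction.toPerm_injective (α := TwistedGroup X.rel)
  exact hm.ofGroup_isomorphic (χ.comp ψ) (hχ.comp hψ.1)
    (by rw [MonoidHom.comp_apply]; exact (congrArg χ h1).trans (map_inv χ _))
    (by rw [MonoidHom.comp_apply]; exact congrArg χ h2)

/-- An isomorphism of maps gives a group isomorphism compatible with `rt` and `inv`. It preserves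
the translation by `1`, and conjugation by `rt`, hence the translation by `f(x)` for every `f`. -/
theorem ker_eq_of_isomorphic [NeZero p] {X Y : CyclotomicQuotient p}
    (h : X.toMap.Isomorphic Y.toMap) : X.ker = Y.ker := by
  obtain ⟨ψ, hψ, h1, h2⟩ := OrientedMap.exists_hom_of_ofGroup_isomorphic h
  have h3 : ψ (TwistedGroup.tr X.rel 1) = TwistedGroup.tr Y.rel 1 := by
    have : ψ (TwistedGroup.tr X.rel 1 * TwistedGroup.rt X.rel ^ 5) =
      TwistedGroup.tr Y.rel 1 * TwistedGroup.rt Y.rel ^ 5 := h2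
    rw [map_mul, map_pow, h1] at this
    exact mul_right_cancel this
  have key (f : ℤ[X]) : ψ (TwistedGroup.tr X.rel (aeval X.x f)) =
      TwistedGroup.tr Y.rel (aeval Y.x f) := by
    have hx (a : X.carrier) (b : Y.carrier) (hab : ψ (TwistedGroup.tr X.rel a) =
        TwistedGroup.tr Y.rel b) : ψ (TwistedGroup.tr X.rel (a * X.x)) =
        TwistedGroup.tr Y.rel (b * Y.x) := by
      have h4 := TwistedGroup.rt_pow_mul_tr X.rel 1 (-a)
      have h5 := TwistedGroup.rt_pow_mul_tr Y.rel 1 (-b)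
      rw [pow_one, pow_one, neg_mul_neg, mul_comm X.x] at h4
      rw [pow_one, pow_one, neg_mul_neg, mul_comm Y.x] at h5
      have h6 := congrArg ψ h4
      rw [map_mul, map_mul, h1, TwistedGroup.tr_neg, map_inv, hab, ← TwistedGroup.tr_neg, h5] at h6
      exact (mul_right_cancel h6).symm
    induction f using Polynomial.induction_on with
    | C n =>
      rw [aeval_C, aeval_C, algebraMap_int_eq, algebraMap_int_eq, eq_intCast, eq_intCast]
      have e1 : TwistedGroup.tr X.rel (n : X.carrier) = TwistedGroup.tr X.rel 1 ^ n := by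
        unfold TwistedGroup.tr; rw [← map_zpow, ← ofAdd_zsmul, zsmul_one]
      have e2 : TwistedGroup.tr Y.rel (n : Y.carrier) = TwistedGroup.tr Y.rel 1 ^ n := by
        unfold TwistedGroup.tr; rw [← map_zpow, ← ofAdd_zsmul, zsmul_one]
      rw [e1, e2, map_zpow, h3]
    | add f g hf hg => rw [map_add, map_add, TwistedGroup.tr_add, TwistedGroup.tr_add, map_mul,
        hf, hg]
    | monomial n c hc =>
      rw [pow_succ, ← mul_assoc, map_mul (aeval X.x), map_mul (aeval Y.x), aeval_X, aeval_X]
      exact hx _ _ hc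
  ext f
  rw [mem_ker, mem_ker]
  constructor
  · intro hf
    have := key f
    rw [hf, TwistedGroup.tr_zero, map_one] at this
    exact TwistedGroup.tr_injective Y.rel this.symm
  · intro hf
    have := key f
    rw [hf, TwistedGroup.tr_zero, ← map_one ψ] at this
    exact TwistedGroup.tr_injective X.rel (hψ this)

end CyclotomicQuotient

/-! ### Every map comes from a quotient of `ℤ[ζ₅]` -/

/-- Sylow's theorem: the number of Sylow `p`-subgroups divides `10` and is `1` modulo `p`. -/
theorem exists_normal_sylow {p : ℕ} [hp : Fact p.Prime] (hp11 : 11 ≤ p) {W : Type*} [Group W]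
    (hW : Nat.card W = 10 * p ^ 2) : ∃ P : Subgroup W, P.Normal ∧ Nat.card P = p ^ 2 := by
  have hcop : Nat.Coprime 10 p := (Nat.coprime_comm.1
    ((Nat.Prime.coprime_iff_not_dvd hp.out).2 fun h => absurd (Nat.le_of_dvd (by norm_num) h)
      (by omega)))
  have : Finite W := Nat.finite_of_card_ne_zero (by
    rw [hW]; exact mul_ne_zero (by norm_num) (pow_ne_zero _ hp.out.ne_zero))
  obtain ⟨P⟩ : Nonempty (Sylow p W) := inferInstance
  have hcard : Nat.card P = p ^ 2 := by
    rw [Sylow.card_eq_multiplicity, hW, Nat.factorization_mul (by norm_num)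
      (pow_ne_zero _ hp.out.ne_zero)]
    simp only [Finsupp.coe_add, Pi.add_apply, hp.out.factorization_pow, Finsupp.single_eq_same]
    rw [Nat.factorization_eq_zero_of_not_dvd, zero_add]
    intro h
    exact absurd (Nat.le_of_dvd (by norm_num) h) (by omega)
  have hindex : (P : Subgroup W).index = 10 := by
    have := (P : Subgroup W).card_mul_index
    rw [hW] at this
    have h2 : p ^ 2 * (P : Subgroup W).index = p ^ 2 * 10 := by
      rw [← hcard]
      exact this.trans (by rw [hcard, mul_comm])
    exact Nat.eq_of_mul_eq_mul_left (pow_pos hp.out.pos 2) h2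
  have hle : Nat.card (Sylow p W) ≤ 10 := Nat.le_of_dvd (by norm_num) (hindex ▸ P.card_dvd_index)
  have hone : Nat.card (Sylow p W) = 1 := by
    have := card_sylow_modEq_one p W
    unfold Nat.ModEq at this
    rwa [Nat.mod_eq_of_lt (by omega), Nat.mod_eq_of_lt (by omega)] at this
  have : Subsingleton (Sylow p W) := (Nat.card_eq_one_iff_unique.1 hone).1
  exact ⟨P, P.normal_of_subsingleton, hcard⟩

/-- Both `l` and `r⁵` map to the unique involution of the cyclic group `W / P` of order `10`. -/
theorem mul_pow_five_mem {p : ℕ} (hp : p.Coprime 10) {W : Type*} [Group W] {P : Subgroup W}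
    [P.Normal] (hP : Nat.card P = p ^ 2) (hW : Nat.card W = 10 * p ^ 2) (hp0 : p ≠ 0) {r l : W}
    (hr : orderOf r = 10) (hl : l * l = 1) (hl1 : l ≠ 1) : l * r ^ 5 ∈ P := by
  have hpow {g : W} (hg : g ∈ P) : g ^ p ^ 2 = 1 := by
    have := pow_card_eq_one' (x := (⟨g, hg⟩ : P))
    rw [hP] at this
    exact congrArg Subtype.val this
  have hQ : Nat.card (W ⧸ P) = 10 := by
    have := P.card_eq_card_quotient_mul_card_subgroup
    rw [hW, hP] at this
    exact (Nat.eq_of_mul_eq_mul_right (pow_pos (Nat.pos_of_ne_zero hp0) 2) this).symm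
  have : Finite (W ⧸ P) := Nat.finite_of_card_ne_zero (by rw [hQ]; norm_num)
  have horder : orderOf (r : W ⧸ P) = 10 := by
    refine Nat.dvd_antisymm (orderOf_dvd_of_pow_eq_one ?_) ?_
    · rw [← QuotientGroup.mk_pow, ← hr, pow_orderOf_eq_one, QuotientGroup.mk_one]
    · have h1 : r ^ orderOf (r : W ⧸ P) ∈ P := by
        rw [← QuotientGroup.eq_one_iff, QuotientGroup.mk_pow, pow_orderOf_eq_one]
      have h2 := hpow h1
      rw [← pow_mul] at h2
      have h3 := orderOf_dvd_of_pow_eq_one h2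
      rw [hr] at h3
      exact (Nat.Coprime.pow_left 2 hp).symm.dvd_of_dvd_mul_right h3
  obtain ⟨j, hj, hjl⟩ : ∃ j < 10, (r : W ⧸ P) ^ j = l := by
    have htop : (l : W ⧸ P) ∈ Subgroup.zpowers (r : W ⧸ P) := by
      rw [Subgroup.eq_top_of_card_eq _ ((Nat.card_zpowers _).trans (horder.trans hQ.symm))]
      trivial
    classical
    obtain ⟨j, hj, hjl⟩ := Finset.mem_image.1 (mem_zpowers_iff_mem_range_orderOf.1 htop)
    exact ⟨j, horder ▸ Finset.mem_range.1 hj, hjl⟩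
  have h2j : 10 ∣ 2 * j := by
    rw [← horder]
    refine orderOf_dvd_of_pow_eq_one ?_
    rw [mul_comm, pow_mul, hjl, pow_two, ← QuotientGroup.mk_mul, hl, QuotientGroup.mk_one]
  have hj0 : j ≠ 0 := by
    rintro rfl
    rw [pow_zero, eq_comm, QuotientGroup.eq_one_iff] at hjl
    have h1 := orderOf_dvd_of_pow_eq_one (hpow hjl)
    have h2 := orderOf_dvd_of_pow_eq_one ((pow_two l).trans hl)
    have h3 := Nat.dvd_gcd h1 h2
    rw [Nat.Coprime.gcd_eq_one (Nat.Coprime.pow_left 2 (Nat.Coprime.coprime_dvd_right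
      (by norm_num) hp))] at h3
    exact hl1 (orderOf_eq_one_iff.1 (Nat.dvd_one.1 h3))
  have hj5 : j = 5 := by omega
  rw [← QuotientGroup.eq_one_iff, QuotientGroup.mk_mul, ← hjl, hj5, QuotientGroup.mk_pow,
    ← pow_add, show 5 + 5 = orderOf (r : W ⧸ P) from horder.symm, pow_orderOf_eq_one]

/-- A group of order `10p²` generated by an element `r` of order `10` and an involution `l` with
`(r⁻¹ l)⁵ = 1` is a twisted group. Its normal Sylow subgroup `P` is a cyclic `ℤ[X]`-module generated
by `v = l r⁵`, where `X` acts as the negative of conjugation by `r`. The relation `(r⁻¹ l)⁵ = 1`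
says that the fifth cyclotomic polynomial annihilates `v`. -/
theorem exists_cyclotomicQuotient {p : ℕ} [hp : Fact p.Prime] (hp11 : 11 ≤ p) {W : Type} [Group W]
    (hW : Nat.card W = 10 * p ^ 2) {r l : W} (hr : orderOf r = 10) (hrl : (r⁻¹ * l) ^ 5 = 1)
    (hl : l * l = 1) (hl1 : l ≠ 1) (hgen : Subgroup.closure {r, l} = ⊤) :
    ∃ X : CyclotomicQuotient p, ∃ ψ : TwistedGroup X.rel →* W, Function.Bijective ψ ∧
      ψ (TwistedGroup.rt X.rel) = r ∧ ψ (TwistedGroup.inv X.rel) = l := by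
  obtain ⟨P, hPn, hP⟩ := exists_normal_sylow hp11 hW
  have hcop : p.Coprime 10 := (Nat.Prime.coprime_iff_not_dvd hp.out).2 fun h =>
    absurd (Nat.le_of_dvd (by norm_num) h) (by omega)
  have hvP := mul_pow_five_mem hcop hP hW hp.out.ne_zero hr hl hl1
  have hr10 : r ^ 10 = 1 := hr ▸ pow_orderOf_eq_one r
  let : CommGroup P := IsPGroup.commGroupOfCardEqPrimeSq hP
  have : Finite P := Nat.finite_of_card_ne_zero (by rw [hP]; exact pow_ne_zero _ hp.out.ne_zero)
  let v : P := ⟨l * r ^ 5, hvP⟩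
  -- the conjugates of `v`, and the action `θ` of `X`, which is `t k ↦ t (k + 6)`
  let t (k : ℕ) : Additive P := Additive.ofMul (MulAut.conjNormal (r ^ k) v)
  let T : Additive P →+ Additive P := MonoidHom.toAdditive (MulAut.conjNormal r).toMonoidHom
  let θ : Module.End ℤ (Additive P) := (-T).toIntLinearMap
  have hT (w : Additive P) : ((T w).toMul : W) = r * w.toMul * r⁻¹ := MulAut.conjNormal_apply _ _
  have hθ (w : Additive P) : θ w = -T w := rfl
  have ht (k : ℕ) : θ (t k) = t (k + 6) := by
    rw [hθ, neg_eq_iff_add_eq_zero]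
    apply Additive.toMul.injective
    apply Subtype.ext
    change ((T (t k)).toMul : W) * ((t (k + 6)).toMul : W) = 1
    rw [hT]
    simp only [t, toMul_ofMul, MulAut.conjNormal_apply]
    calc r * (r ^ k * (l * r ^ 5) * (r ^ k)⁻¹) * r⁻¹ *
          (r ^ (k + 6) * (l * r ^ 5) * (r ^ (k + 6))⁻¹)
        = r ^ (k + 1) * (l * r ^ 10 * l) * (r ^ (k + 1))⁻¹ := by group
      _ = 1 := by rw [hr10, mul_one, hl, mul_one, mul_inv_cancel]
  have hsum : t 0 + t 6 + t 12 + t 18 + t 24 = 0 := by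
    apply Additive.toMul.injective
    apply Subtype.ext
    change ((t 0).toMul : W) * ((t 6).toMul : W) * ((t 12).toMul : W) * ((t 18).toMul : W) *
      ((t 24).toMul : W) = 1
    simp only [t, toMul_ofMul, MulAut.conjNormal_apply]
    have h1 : (l * r) ^ 5 = 1 := by
      rw [← inv_inj, ← inv_pow, mul_inv_rev, inv_eq_of_mul_eq_one_left hl, hrl, inv_one]
    have hv : (v : W) = l * r ^ 5 := rfl
    rw [hv]
    calc _ = (l * r ^ 10 * r) ^ 5 * (r ^ 10)⁻¹ ^ 3 := by
          simp only [pow_succ _ 4, pow_succ _ 3, pow_succ _ 2, pow_succ _ 1, pow_one]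
          group
      _ = 1 := by rw [hr10, mul_one, h1, inv_one, one_pow, mul_one]
  -- the annihilator of `v`; the ring is `ℤ[X] ⧸ J`, embedded in `P` by `f ↦ f · v`
  let J : Ideal ℤ[X] :=
    { carrier := {f | aeval θ f (Additive.ofMul v) = 0}
      add_mem' := fun {f g} hf hg => by
        rw [Set.mem_ofPred_eq] at hf hg ⊢
        rw [map_add, LinearMap.add_apply, hf, hg, add_zero]
      zero_mem' := by simp
      smul_mem' := fun c f hf => by
        rw [Set.mem_ofPred_eq] at hf ⊢
        rw [smul_eq_mul, map_mul, Module.End.mul_apply, hf, map_zero] }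
  let φ : (ℤ[X] ⧸ J) →+ Additive P := QuotientAddGroup.lift J.toAddSubgroup
    ((LinearMap.applyₗ (Additive.ofMul v)).comp
      (aeval θ : ℤ[X] →ₐ[ℤ] _).toLinearMap).toAddMonoidHom fun f hf => hf
  have hφ (f : ℤ[X]) : φ (Ideal.Quotient.mk J f) = aeval θ f (Additive.ofMul v) := rfl
  have hφi : Function.Injective φ := by
    rw [injective_iff_map_eq_zero]
    intro a ha
    obtain ⟨f, rfl⟩ := Ideal.Quotient.mk_surjective a
    exact Ideal.Quotient.eq_zero_iff_mem.2 ha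
  let x : ℤ[X] ⧸ J := Ideal.Quotient.mk J X
  have ht0 : Additive.ofMul v = t 0 := by
    simp only [t, pow_zero, map_one]; rfl
  have hrel : 1 + x + x ^ 2 + x ^ 3 + x ^ 4 = 0 := by
    apply hφi
    have : 1 + x + x ^ 2 + x ^ 3 + x ^ 4 =
      Ideal.Quotient.mk J (1 + X + X ^ 2 + X ^ 3 + X ^ 4) := by simp [x]
    rw [this, hφ, map_zero, ht0]
    have h1 (k n : ℕ) : (θ ^ n) (t k) = t (k + 6 * n) := by
      induction n with
      | zero => rfl
      | succ n ih => rw [pow_succ', Module.End.mul_apply, ih, ht]; rfl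
    simp only [map_add, map_pow, map_one, aeval_X, LinearMap.add_apply, Module.End.one_apply, h1,
      ht, zero_add, Nat.reduceMul]
    exact hsum
  have hgenA : Function.Surjective (aeval x : ℤ[X] →ₐ[ℤ] ℤ[X] ⧸ J) := fun a => by
    obtain ⟨f, rfl⟩ := Ideal.Quotient.mk_surjective a
    exact ⟨f, (aeval_algHom_apply (Ideal.Quotient.mkₐ ℤ J) X f).trans (by simp)⟩
  let φ' : Multiplicative (ℤ[X] ⧸ J) →* W := P.subtype.comp (AddMonoidHom.toMultiplicativeLeft φ)
  have hφ' (a : ℤ[X] ⧸ J) : φ' (.ofAdd a) = ((φ a).toMul : W) := rfl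
  have hx (a : ℤ[X] ⧸ J) : φ (-x * a) = T (φ a) := by
    obtain ⟨f, rfl⟩ := Ideal.Quotient.mk_surjective a
    change φ (Ideal.Quotient.mk J (-X * f)) = _
    rw [hφ, hφ, map_mul, map_neg, aeval_X, Module.End.mul_apply, LinearMap.neg_apply, hθ, neg_neg]
  have hconj (a : ℤ[X] ⧸ J) : r * φ' (.ofAdd a) * r⁻¹ = φ' (.ofAdd (-x * a)) := by
    rw [hφ', hφ', hx, hT]
  have hl' : φ' (.ofAdd 1) * r ^ 5 = l := by
    have : φ 1 = Additive.ofMul v := by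
      rw [← map_one (Ideal.Quotient.mk J), hφ, map_one, Module.End.one_apply]
    rw [hφ', this]
    change l * r ^ 5 * r ^ 5 = l
    rw [mul_assoc, ← pow_add, hr10, mul_one]
  have hfin : Finite (ℤ[X] ⧸ J) := Finite.of_injective φ hφi
  -- `ℤ[X] ⧸ J` embeds in `P`, and its twisted group maps onto `W`
  have hcard : Nat.card (ℤ[X] ⧸ J) = p ^ 2 := by
    refine le_antisymm (hP ▸ Nat.card_le_card_of_injective φ hφi) ?_
    obtain ⟨ψ, h1, h2⟩ := TwistedGroup.exists_hom (h := hrel) φ' hr10 hconj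
    have hs : Function.Surjective ψ := by
      rw [← MonoidHom.range_eq_top, eq_top_iff, ← hgen, Subgroup.closure_le]
      rintro _ (rfl | rfl)
      · exact ⟨_, h2⟩
      · exact ⟨TwistedGroup.inv hrel, by rw [TwistedGroup.inv, map_mul, map_pow, h1, h2, hl']⟩
    have := Nat.card_le_card_of_surjective ψ hs
    rw [hW, TwistedGroup.natCard] at this
    omega
  have : NeZero p := ⟨hp.out.ne_zero⟩
  exact ⟨⟨ℤ[X] ⧸ J, x, hrel, hgenA, hcard⟩,
    CyclotomicQuotient.exists_bijective_hom ⟨ℤ[X] ⧸ J, x, hrel, hgenA, hcard⟩ hgen hW φ' hr10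
      hconj hl'⟩

namespace OrientedMap

theorem exists_toMap_isomorphic {p : ℕ} [hp : Fact p.Prime] (hp11 : 11 ≤ p) {M : OrientedMap}
    (h : M ∈ regularMaps p) (hr : orderOf M.rot = 10) :
    ∃ X : CyclotomicQuotient p, X.toMap.Isomorphic M := by
  have hf : orderOf M.faceRot = 5 := by
    have := orderOf_rot_faceRot_of_mem_regularMaps hp.out (by omega) h
    omega
  let r : M.mon := ⟨M.rot, M.rot_mem_mon⟩
  let l : M.mon := ⟨M.rev, M.rev_mem_mon⟩
  obtain ⟨X, ψ, hψ, h1, h2⟩ := exists_cyclotomicQuotient (W := M.mon) (r := r) (l := l) hp11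
    (by rw [h.1.card_mon, ← h.1.card_autPlus, h.2.2]) (by rw [← hr]; exact Subgroup.orderOf_mk _ _)
    (Subtype.ext (by
      change M.faceRot ^ 5 = 1
      rw [← hf, pow_orderOf_eq_one])) (Subtype.ext M.rev_mul_rev)
    (fun h1 => M.rev_ne_one (congrArg Subtype.val h1)) (by
      have h3 := Subgroup.closure_closure_coe_preimage (k := {M.rot, M.rev})
      refine Eq.trans (congrArg _ ?_) h3
      ext g
      simp only [r, l, Set.mem_insert_iff, Set.mem_singleton_iff, Subtype.ext_iff]
      rfl)
  refine ⟨X, h.1.ofGroup_isomorphic (M.mon.subtype.comp ψ)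
    (Subtype.val_injective.comp hψ.1) ?_ ?_⟩
  · rw [MonoidHom.comp_apply, h1]; rfl
  · rw [MonoidHom.comp_apply, h2]; rfl

theorem exists_toMap_isomorphic_or_dual {p : ℕ} [hp : Fact p.Prime] (hp11 : 11 ≤ p)
    {M : OrientedMap} (h : M ∈ regularMaps p) :
    ∃ X : CyclotomicQuotient p, X.toMap.Isomorphic M ∨ X.toMap.Isomorphic M.dual := by
  rcases orderOf_rot_faceRot_of_mem_regularMaps hp.out (by omega) h with h1 | h1
  · exact (exists_toMap_isomorphic hp11 h h1.1).imp fun X => Or.inl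
  · exact (exists_toMap_isomorphic hp11 (dual_mem_regularMaps h) h1.2).imp fun X => Or.inr

end OrientedMap

/-! ### The quotients of `ℤ[ζ₅]` of order `p²` -/

namespace CyclotomicQuotient

variable {p : ℕ}

/-- The cyclic quotient `ℤ/p²`, given by a root `k` of the fifth cyclotomic polynomial. -/
def cyclic (k : ZMod (p ^ 2)) (hk : 1 + k + k ^ 2 + k ^ 3 + k ^ 4 = 0) : CyclotomicQuotient p where
  carrier := ZMod (p ^ 2)
  x := k
  rel := hk
  gen a := by
    obtain ⟨n, rfl⟩ := ZMod.intCast_surjective a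
    exact ⟨C n, by simp⟩
  card := Nat.card_zmod _

/-- The split quotient `𝔽_p × 𝔽_p`, given by two different roots of the fifth cyclotomic polynomial
in `𝔽_p`. -/
def split [Fact p.Prime] (a b : ZMod p) (hab : a ≠ b) (ha : 1 + a + a ^ 2 + a ^ 3 + a ^ 4 = 0)
    (hb : 1 + b + b ^ 2 + b ^ 3 + b ^ 4 = 0) : CyclotomicQuotient p where
  carrier := ZMod p × ZMod p
  x := (a, b)
  rel := Prod.ext ha hb
  gen := by
    rintro ⟨u, v⟩
    -- the linear polynomial through `(a, u)` and `(b, v)`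
    obtain ⟨m, hm⟩ := ZMod.intCast_surjective ((u - v) / (a - b))
    obtain ⟨n, hn⟩ := ZMod.intCast_surjective (u - (u - v) / (a - b) * a)
    refine ⟨C m * X + C n, ?_⟩
    have := sub_ne_zero.2 hab
    refine Prod.ext ((map_aeval_int (RingHom.fst _ _) (a, b) _).trans ?_)
      ((map_aeval_int (RingHom.snd _ _) (a, b) _).trans ?_)
    · simp [hm, hn]
    · simp only [map_add, map_mul, aeval_C, aeval_X, RingHom.coe_snd]
      simp only [algebraMap_int_eq, eq_intCast, hm, hn]
      field_simp
      ring
  card := by rw [Nat.card_prod, Nat.card_zmod, pow_two]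

theorem monic_quadratic [Fact p.Prime] (b c : ZMod p) : (X ^ 2 + C b * X + C c).Monic := by
  monicity!

theorem natDegree_quadratic [Fact p.Prime] (b c : ZMod p) :
    (X ^ 2 + C b * X + C c).natDegree = 2 := by
  compute_degree!

theorem aeval_adjoinRoot (q : (ZMod p)[X]) (f : ℤ[X]) :
    aeval (AdjoinRoot.root q) f = AdjoinRoot.mk q (f.map (Int.castRingHom (ZMod p))) := by
  rw [← AdjoinRoot.aeval_eq, aeval_def, aeval_def, eval₂_map]
  congr 1

/-- The quotient `𝔽_p[X]/(X² - tX + 1)`, where `t² + t - 1 = 0`. It is a field if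
`p ≡ -1 mod 5`, which is not assumed in the definition. -/
noncomputable def inert [hp : Fact p.Prime] (t : ZMod p) (ht : t ^ 2 + t - 1 = 0) :
    CyclotomicQuotient p where
  carrier := AdjoinRoot (X ^ 2 + C (-t) * X + C 1)
  x := AdjoinRoot.root (X ^ 2 + C (-t) * X + C 1)
  rel := by
    have h : (1 : (ZMod p)[X]) + X + X ^ 2 + X ^ 3 + X ^ 4 =
        (X ^ 2 + C (-t) * X + C 1) * (X ^ 2 + C (1 + t) * X + C 1) := by
      have hC : (C t : (ZMod p)[X]) ^ 2 + C t - 1 = 0 := by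
        rw [← C_pow, ← C_1, ← C_add, ← C_sub, ht, C_0]
      simp only [C_neg, C_add, C_1]
      linear_combination X ^ 2 * hC
    have h2 := congrArg (AdjoinRoot.mk (X ^ 2 + C (-t) * X + C 1)) h
    rw [map_mul, AdjoinRoot.mk_self, zero_mul] at h2
    simpa using h2
  gen a := by
    obtain ⟨g, rfl⟩ := AdjoinRoot.mk_surjective a
    obtain ⟨f, rfl⟩ := map_surjective (Int.castRingHom (ZMod p)) ZMod.intCast_surjective g
    exact ⟨f, aeval_adjoinRoot _ f⟩
  card := by
    have h := monic_quadratic (-t) 1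
    have : Module.Finite (ZMod p) (AdjoinRoot (X ^ 2 + C (-t) * X + C 1)) := h.finite_adjoinRoot
    rw [Module.natCard_eq_pow_finrank (K := ZMod p), Nat.card_zmod,
      (AdjoinRoot.powerBasis h.ne_zero).finrank, AdjoinRoot.powerBasis_dim, natDegree_quadratic]

theorem prime_sq_eq_zero [NeZero p] (X : CyclotomicQuotient p) : (p : X.carrier) ^ 2 = 0 := by
  have := Fintype.ofFinite X.carrier
  rw [← Nat.cast_pow, ← X.card, Nat.card_eq_fintype_card, Nat.cast_card_eq_zero]

/-- A quotient of order `p²` whose characteristic is not `p` has characteristic `p²`. -/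
theorem exists_cyclic [hp : Fact p.Prime] (X : CyclotomicQuotient p) (h : (p : X.carrier) ≠ 0) :
    ∃ (k : ZMod (p ^ 2)) (hk : _), (cyclic k hk).ker = X.ker := by
  have : NeZero p := ⟨hp.out.ne_zero⟩
  have := Fintype.ofFinite X.carrier
  have hchar : CharP X.carrier (p ^ 2) := by
    have h1 : ringChar X.carrier ∣ p ^ 2 :=
      ringChar.dvd (by rw [Nat.cast_pow]; exact X.prime_sq_eq_zero)
    obtain ⟨i, hi, hi2⟩ := (Nat.dvd_prime_pow hp.out).1 h1
    have : i = 2 := by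
      by_contra hne
      have h3 : ringChar X.carrier ∣ p := by
        rw [hi2]
        exact pow_dvd_pow p (show i ≤ 1 by omega) |>.trans (by rw [pow_one])
      exact h ((ringChar.spec _ _).2 h3)
    rw [← this, ← hi2]
    infer_instance
  let e := ZMod.ringEquiv X.carrier (n := p ^ 2) (by rw [← Nat.card_eq_fintype_card, X.card])
  refine ⟨e.symm X.x, ?_, ?_⟩
  · have := congrArg e.symm X.rel
    simpa using this
  · exact ker_eq_of_le (ker_le_of_ringHom (e : ZMod (p ^ 2) →+* X.carrier)
      (e.apply_symm_apply X.x))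

/-- A quotient of characteristic `p` is `𝔽_p[X]/(q)` for a quadratic factor `q` of the fifth
cyclotomic polynomial, namely the minimal polynomial of `x`. -/
theorem exists_quadratic [hp : Fact p.Prime] (Y : CyclotomicQuotient p) (h : (p : Y.carrier) = 0) :
    ∃ b c : ZMod p, X ^ 2 + C b * X + C c ∣ (1 + X + X ^ 2 + X ^ 3 + X ^ 4 : (ZMod p)[X]) ∧
      ∀ f : ℤ[X], f ∈ Y.ker → X ^ 2 + C b * X + C c ∣ f.map (Int.castRingHom (ZMod p)) := by
  have : NeZero p := ⟨hp.out.ne_zero⟩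
  have : Nontrivial Y.carrier := by
    rw [← Finite.one_lt_card_iff_nontrivial, Y.card]
    exact Nat.one_lt_pow two_ne_zero hp.out.one_lt
  have : CharP Y.carrier p := (CharP.charP_iff_prime_eq_zero hp.out).2 h
  let : Algebra (ZMod p) Y.carrier := ZMod.algebra _ p
  have hmap (f : ℤ[X]) : aeval Y.x (f.map (Int.castRingHom (ZMod p))) = aeval Y.x f := by
    rw [aeval_def, aeval_def, eval₂_map]
    congr 1
    exact RingHom.ext_int _ _
  have hs : Function.Surjective (aeval Y.x : (ZMod p)[X] →ₐ[ZMod p] Y.carrier) := fun a => by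
    obtain ⟨f, rfl⟩ := Y.gen a
    exact ⟨_, hmap f⟩
  have hint : IsIntegral (ZMod p) Y.x := IsIntegral.of_finite _ _
  have hmonic := minpoly.monic hint
  have hdeg : (minpoly (ZMod p) Y.x).natDegree = 2 := by
    let e : AdjoinRoot (minpoly (ZMod p) Y.x) ≃ₐ[ZMod p] Y.carrier :=
      (Ideal.quotientEquivAlgOfEq (ZMod p) (minpoly.ker_aeval_eq_span_minpoly _ _).symm).trans
        (Ideal.quotientKerAlgEquivOfSurjective hs)
    have h1 : Module.finrank (ZMod p) Y.carrier = (minpoly (ZMod p) Y.x).natDegree := by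
      rw [← e.toLinearEquiv.finrank_eq, (AdjoinRoot.powerBasis hmonic.ne_zero).finrank,
        AdjoinRoot.powerBasis_dim]
    have h2 := Module.natCard_eq_pow_finrank (K := ZMod p) (V := Y.carrier)
    rw [Y.card, Nat.card_zmod, h1] at h2
    exact (Nat.pow_right_injective hp.out.two_le h2).symm
  have hq : minpoly (ZMod p) Y.x = X ^ 2 + C ((minpoly (ZMod p) Y.x).coeff 1) * X +
      C ((minpoly (ZMod p) Y.x).coeff 0) := by
    conv_lhs => rw [hmonic.as_sum, hdeg]
    simp [Finset.sum_range_succ]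
    ring
  refine ⟨_, _, hq ▸ minpoly.dvd _ _ ?_, fun f hf => hq ▸ minpoly.dvd _ _ ?_⟩
  · simpa using Y.rel
  · rw [hmap, mem_ker.1 hf]

/-- A quadratic factor of the fifth cyclotomic polynomial over a field in which that polynomial has
no root is `X² - tX + 1` with `t² + t - 1 = 0`. -/
theorem exists_inert [hp : Fact p.Prime] (Y : CyclotomicQuotient p)
    (hroot : ∀ c : ZMod p, 1 + c + c ^ 2 + c ^ 3 + c ^ 4 ≠ 0) :
    ∃ (t : ZMod p) (ht : _), (inert t ht).ker = Y.ker := by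
  have : NeZero p := ⟨hp.out.ne_zero⟩
  have h : (p : Y.carrier) = 0 := by
    by_contra h
    obtain ⟨k, hk, -⟩ := Y.exists_cyclic h
    apply hroot (ZMod.castHom (dvd_pow_self p two_ne_zero) (ZMod p) k)
    have := congrArg (ZMod.castHom (dvd_pow_self p two_ne_zero) (ZMod p)) hk
    simpa only [map_add, map_pow, map_one, map_zero] using this
  obtain ⟨b, c, hdvd, hker⟩ := Y.exists_quadratic h
  -- the remainder of the division of `1 + X + X² + X³ + X⁴` by the quadratic factor
  have hrem : X ^ 2 + C b * X + C c ∣ C (-b ^ 3 + 2 * b * c + b ^ 2 - c - b + 1) * X +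
      C (-b ^ 2 * c + c ^ 2 + b * c - c + 1) := by
    have h1 := dvd_sub hdvd (dvd_mul_right (X ^ 2 + C b * X + C c)
      (X ^ 2 + C (1 - b) * X + C (b ^ 2 - b + 1 - c)))
    convert h1 using 1
    simp only [map_add, map_sub, map_mul, map_neg, map_pow, map_one]
    rw [show (C (2 : ZMod p)) = 2 from rfl]
    ring
  have h0 : C (-b ^ 3 + 2 * b * c + b ^ 2 - c - b + 1) * X +
      C (-b ^ 2 * c + c ^ 2 + b * c - c + 1) = 0 :=
    eq_zero_of_dvd_of_natDegree_lt hrem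
      (lt_of_le_of_lt natDegree_linear_le (by rw [natDegree_quadratic]; norm_num))
  have h1 := congrArg (coeff · 1) h0
  have h2 := congrArg (coeff · 0) h0
  simp only [coeff_add, coeff_C_mul, coeff_X_one, coeff_X_zero, coeff_C_zero, coeff_C_of_ne_zero
    one_ne_zero, coeff_zero, mul_one, mul_zero, add_zero, zero_add] at h1 h2
  have hc : c = 1 := by
    -- otherwise the two coefficients of the remainder give `b (1 + c) = c`, and `c` is a root
    by_contra hc
    have h3 : b * (1 + c) - c = 0 := by
      refine (mul_eq_zero.1 (?_ : (1 - c) * (b * (1 + c) - c) = 0)).resolve_left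
        (sub_ne_zero.2 (Ne.symm hc))
      linear_combination (-c) * h1 + b * h2
    apply hroot c
    linear_combination (1 + c) ^ 2 * h2 + (c * (b * (1 + c) + c) - c * (1 + c)) * h3
  subst hc
  have ht : (-b) ^ 2 + -b - 1 = 0 := by linear_combination -h2
  refine ⟨-b, ht, (ker_eq_of_le (X := Y) fun f hf => ?_).symm⟩
  rw [mem_ker]
  refine (aeval_adjoinRoot _ f).trans (AdjoinRoot.mk_eq_zero.2 ?_)
  rw [neg_neg]
  exact hker f hf

theorem pow_five_sub_one_separable [hp : Fact p.Prime] (hp11 : 11 ≤ p) :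
    (X ^ 5 - 1 : (ZMod p)[X]).Separable := by
  rw [X_pow_sub_one_separable_iff]
  intro h
  have := Nat.le_of_dvd (by norm_num) ((ZMod.natCast_eq_zero_iff 5 p).1 h)
  omega

/-- If the fifth cyclotomic polynomial splits over `𝔽_p`, a quotient of characteristic `p` is given
by a product of two of its different linear factors. -/
theorem exists_split [hp : Fact p.Prime] (hp11 : 11 ≤ p) (Y : CyclotomicQuotient p)
    (h : (p : Y.carrier) = 0) {s : ZMod p} (hs : IsPrimitiveRoot s 5) :
    ∃ (a b : ZMod p) (hab : _) (ha : _) (hb : _), (split a b hab ha hb).ker = Y.ker := by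
  have : NeZero p := ⟨hp.out.ne_zero⟩
  obtain ⟨b, c, hdvd, hker⟩ := Y.exists_quadratic h
  set q := X ^ 2 + C b * X + C c with hq
  have hqm : q.Monic := monic_quadratic b c
  have hdvd5 : q ∣ X ^ 5 - 1 := hdvd.trans ⟨X - 1, by ring⟩
  have hsep := (pow_five_sub_one_separable hp11).of_dvd hdvd5
  have hsplit : q.Splits := by
    refine Splits.of_dvd ?_ (pow_five_sub_one_separable hp11).ne_zero hdvd5
    have := X_pow_sub_C_splits_of_isPrimitiveRoot hs (one_pow (M := ZMod p) 5)
    rwa [C_1] at this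
  have hprod := hsplit.eq_prod_roots_of_monic hqm
  have hcard : Multiset.card q.roots = 2 := by
    rw [← hsplit.natDegree_eq_card_roots, natDegree_quadratic]
  obtain ⟨u, v, huv⟩ := Multiset.card_eq_two.1 hcard
  have hne : u ≠ v := by
    have := nodup_roots hsep
    rw [huv] at this
    simpa using this
  have hroot {w : ZMod p} (hw : w ∈ q.roots) {f : (ZMod p)[X]} (hf : q ∣ f) : f.eval w = 0 :=
    eval_eq_zero_of_dvd_of_eval_eq_zero hf (isRoot_of_mem_roots hw)
  have hu : u ∈ q.roots := by simp [huv]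
  have hv : v ∈ q.roots := by simp [huv]
  refine ⟨u, v, hne, by simpa using hroot hu hdvd, by simpa using hroot hv hdvd,
    (ker_eq_of_le (X := Y) fun f hf => ?_).symm⟩
  have hev (w : ZMod p) : aeval w f = (f.map (Int.castRingHom (ZMod p))).eval w := by
    rw [eval_map, aeval_def]
    rfl
  rw [mem_ker]
  exact Prod.ext
    ((map_aeval_int (RingHom.fst _ _) (u, v) f).trans ((hev u).trans (hroot hu (hker f hf))))
    ((map_aeval_int (RingHom.snd _ _) (u, v) f).trans ((hev v).trans (hroot hv (hker f hf))))

end CyclotomicQuotient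

/-! ### Upper bounds for the orders of groups given by generators and relations -/

section CardBound

variable {G : Type*} [Group G] {a b c d : G}

/-- The subgroup generated by two commuting elements is a quotient of `ℤ/m × ℤ/n`. -/
theorem card_closure_pair_le (h : Commute a b) {m n : ℕ} [NeZero m] [NeZero n] (ha : a ^ m = 1)
    (hb : b ^ n = 1) :
    Finite (Subgroup.closure {a, b}) ∧ Nat.card (Subgroup.closure {a, b}) ≤ m * n := by
  have key {k : ℕ} [NeZero k] (g : G) (hg : g ^ k = 1) (z : Multiplicative (ZMod k)) :
      ∃ i : ℕ, zmodPowHom k g hg z = g ^ i :=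
    ⟨(z.toAdd : ZMod k).val, by
      rw [← zmodPowHom_natCast hg, ZMod.natCast_rightInverse _]
      rfl⟩
  let f : Multiplicative (ZMod m) × Multiplicative (ZMod n) →* G :=
    MonoidHom.noncommCoprod (zmodPowHom m a ha) (zmodPowHom n b hb) fun x y => by
      obtain ⟨i, hi⟩ := key a ha x
      obtain ⟨j, hj⟩ := key b hb y
      rw [hi, hj]
      exact h.pow_pow i j
  have hle : Subgroup.closure {a, b} ≤ f.range := by
    rw [Subgroup.closure_le]
    rintro _ (rfl | rfl)
    · refine ⟨(.ofAdd ((1 : ℕ) : ZMod m), 1), ?_⟩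
      simp only [f, MonoidHom.noncommCoprod_apply, map_one, mul_one, zmodPowHom_natCast, pow_one]
    · refine ⟨(1, .ofAdd ((1 : ℕ) : ZMod n)), ?_⟩
      simp only [f, MonoidHom.noncommCoprod_apply, map_one, one_mul, zmodPowHom_natCast, pow_one]
  have hfin : Finite f.range := inferInstanceAs (Finite (Set.range f))
  refine ⟨Finite.of_injective _ (Subgroup.inclusion_injective hle), ?_⟩
  refine (Subgroup.card_le_of_le hle).trans ?_
  refine (Nat.card_le_card_of_surjective _ f.rangeRestrict_surjective).trans (le_of_eq ?_)
  rw [Nat.card_prod]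
  exact congrArg₂ _ (Nat.card_zmod m) (Nat.card_zmod n)

/-- A group generated by `a`, `b`, `c`, `d`, in which `⟨a, b⟩` is abelian and normal and `c`, `d`
commute modulo `⟨a, b⟩`, has at most the order that the orders of the generators suggest. -/
theorem card_le_of_relations (hgen : Subgroup.closure {a, b, c, d} = ⊤) (hab : Commute a b)
    {m n : ℕ} [NeZero m] [NeZero n] (ha : a ^ m = 1) (hb : b ^ n = 1) (hc : c ^ 5 = 1)
    (hd : d ^ 2 = 1) (hca : c * a * c⁻¹ ∈ Subgroup.closure {a, b})
    (hcb : c * b * c⁻¹ ∈ Subgroup.closure {a, b}) (hda : d * a * d⁻¹ ∈ Subgroup.closure {a, b})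
    (hdb : d * b * d⁻¹ ∈ Subgroup.closure {a, b})
    (hdc : d * c * d⁻¹ * c⁻¹ ∈ Subgroup.closure {a, b}) :
    Finite G ∧ Nat.card G ≤ 10 * (m * n) := by
  obtain ⟨hfin, hcard⟩ := card_closure_pair_le hab ha hb
  set N := Subgroup.closure {a, b} with hN
  have hnorm (g : G) (hga : g * a * g⁻¹ ∈ N) (hgb : g * b * g⁻¹ ∈ N) :
      g ∈ Subgroup.normalizer (N : Set G) := by
    have : Finite (N : Set G) := hfin
    refine Subgroup.mem_normalizer_fintype fun z hz => ?_
    have hle : N ≤ N.comap (MulAut.conj g).toMonoidHom := by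
      conv_lhs => rw [hN]
      rw [Subgroup.closure_le]
      rintro _ (rfl | rfl)
      exacts [hga, hgb]
    exact hle hz
  have haN : a ∈ N := Subgroup.subset_closure (by simp)
  have hbN : b ∈ N := Subgroup.subset_closure (by simp)
  have hnormal : N.Normal := by
    rw [← Subgroup.normalizer_eq_top_iff, eq_top_iff, ← hgen, Subgroup.closure_le]
    rintro _ (rfl | rfl | rfl | rfl)
    exacts [Subgroup.le_normalizer haN, Subgroup.le_normalizer hbN, hnorm _ hca hcb,
      hnorm _ hda hdb]
  have hcomm : Commute (d : G ⧸ N) (c : G ⧸ N) := by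
    have := (QuotientGroup.eq_one_iff _).2 hdc
    rw [QuotientGroup.mk_mul, QuotientGroup.mk_mul, QuotientGroup.mk_mul, QuotientGroup.mk_inv,
      QuotientGroup.mk_inv, mul_inv_eq_one, mul_inv_eq_iff_eq_mul] at this
    exact this
  obtain ⟨hfinQ, hcardQ⟩ := card_closure_pair_le (m := 5) (n := 2) hcomm.symm
    (by rw [← QuotientGroup.mk_pow, hc, QuotientGroup.mk_one])
    (by rw [← QuotientGroup.mk_pow, hd, QuotientGroup.mk_one])
  have htop : Subgroup.closure {(c : G ⧸ N), (d : G ⧸ N)} = ⊤ := by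
    rw [eq_top_iff, ← Subgroup.map_top_of_surjective (QuotientGroup.mk' N)
      (QuotientGroup.mk'_surjective N), ← hgen, MonoidHom.map_closure, Subgroup.closure_le]
    rintro _ ⟨_, (rfl | rfl | rfl | rfl), rfl⟩
    · rw [QuotientGroup.mk'_apply, (QuotientGroup.eq_one_iff _).2 haN]; exact one_mem _
    · rw [QuotientGroup.mk'_apply, (QuotientGroup.eq_one_iff _).2 hbN]; exact one_mem _
    · exact Subgroup.subset_closure (by simp)
    · exact Subgroup.subset_closure (by simp)
  rw [htop, Subgroup.card_top] at hcardQ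
  have hfinQ' : Finite (G ⧸ N) := by
    rw [htop] at hfinQ
    exact Finite.of_equiv _ Subgroup.topEquiv.toEquiv
  have heq := N.card_eq_card_quotient_mul_card_subgroup
  exact ⟨Nat.finite_of_card_ne_zero (heq ▸ mul_ne_zero Nat.card_pos.ne' Nat.card_pos.ne'),
    heq ▸ Nat.mul_le_mul hcardQ hcard⟩

theorem conj_eq_inv_of_mul_sq (hd : d ^ 2 = 1) (hda : (d * a) ^ 2 = 1) : d * a * d⁻¹ = a⁻¹ := by
  have hd' : d⁻¹ = d := inv_eq_of_mul_eq_one_left (by rw [← pow_two, hd])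
  rw [hd', eq_inv_iff_mul_eq_one, mul_assoc (d * a), ← pow_two, hda]

/-- The bound for a presentation in which `d` inverts `a` and `b`. -/
theorem card_le_of_inverting_relations (hgen : Subgroup.closure {a, b, c, d} = ⊤)
    {m n : ℕ} [NeZero m] [NeZero n] (ha : a ^ m = 1) (hb : b ^ n = 1) (hc : c ^ 5 = 1)
    (hd : d ^ 2 = 1) (hab : a * b * a⁻¹ * b⁻¹ = 1) (hda : (d * a) ^ 2 = 1) (hdb : (d * b) ^ 2 = 1)
    (hca : c * a * c⁻¹ ∈ Subgroup.closure {a, b}) (hcb : c * b * c⁻¹ ∈ Subgroup.closure {a, b})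
    (hdc : d * c * d * c⁻¹ ∈ Subgroup.closure {a, b}) :
    Finite G ∧ Nat.card G ≤ 10 * (m * n) := by
  have hd' : d⁻¹ = d := inv_eq_of_mul_eq_one_left (by rw [← pow_two, hd])
  refine card_le_of_relations hgen ?_ ha hb hc hd hca hcb ?_ ?_ (by rwa [hd'])
  · rwa [mul_inv_eq_one, mul_inv_eq_iff_eq_mul] at hab
  · rw [conj_eq_inv_of_mul_sq hd hda]; exact inv_mem (Subgroup.subset_closure (by simp))
  · rw [conj_eq_inv_of_mul_sq hd hdb]; exact inv_mem (Subgroup.subset_closure (by simp))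

end CardBound

/-! ### The presented groups as twisted groups -/

namespace TwistedGroup

variable {A : Type*} [CommRing A] {x : A} (h : 1 + x + x ^ 2 + x ^ 3 + x ^ 4 = 0)

theorem rt_pow_conj_tr (m : ℕ) (e : A) :
    rt h ^ (6 * m) * tr h e * (rt h ^ (6 * m))⁻¹ = tr h (x ^ m * e) := by
  rw [rt_pow_mul_tr, mul_inv_cancel_right, pow_mul, show (-x) ^ 6 = x by
    linear_combination x * pow_five_of_rel h]

theorem tr_mul_rt_pow_five_sq (w : A) : (tr h w * rt h ^ 5) ^ 2 = 1 := by
  rw [pow_two, mul_rt_pow_mul, neg_pow_five_of_rel h, rt_pow_ten, mul_one, ← tr_zero]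
  congr 1; ring

theorem tr_mul_rt_pow_five_mul_tr (w e : A) :
    tr h w * rt h ^ 5 * tr h e = tr h (w - e) * rt h ^ 5 := by
  rw [mul_assoc, rt_pow_mul_tr, ← mul_assoc, ← tr_add, neg_pow_five_of_rel h, sub_eq_add_neg,
    neg_one_mul]

theorem tr_mul_rt_pow_five_conj (w : A) (m : ℕ) :
    (tr h w * rt h ^ 5) * rt h ^ (6 * m) * (tr h w * rt h ^ 5) =
      tr h (w - x ^ m * w) * rt h ^ (6 * m) := by
  rw [mul_assoc (tr h w), ← pow_add, mul_rt_pow_mul, tr_mul_rt_pow_eq_iff]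
  constructor
  · rw [pow_add, pow_mul, neg_pow_five_of_rel h, show (-x) ^ 6 = x by
      linear_combination x * pow_five_of_rel h]
    ring
  · push_cast
    rw [show ((5 : ZMod 10) + 6 * m + 5) = 10 + 6 * m by ring]
    rw [show (10 : ZMod 10) = 0 from rfl, zero_add]

theorem rt_pow_pow_five (m : ℕ) : (rt h ^ (6 * m)) ^ 5 = 1 := by
  rw [← pow_mul, show 6 * m * 5 = 10 * (3 * m) by ring, pow_mul, rt_pow_ten, one_pow]

/-- A criterion for a subgroup containing the images of the generators of one of the presented
groups to be everything. The power `rt ^ (6m)` acts as multiplication by `x ^ m`; for `m` prime to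
`5` it generates the subgroup of order `5` of the cyclic group. -/
theorem eq_top_of_mem (hgen : Function.Surjective (aeval x : ℤ[X] →ₐ[ℤ] A))
    {S : Subgroup (TwistedGroup h)} {m m' : ℕ} (hm : m * m' % 5 = 1)
    (h1 : rt h ^ (6 * m) ∈ S) {w : A} (h2 : tr h w * rt h ^ 5 ∈ S) (h3 : tr h w ∈ S)
    (h4 : tr h 1 ∈ S) : S = ⊤ := by
  have h5 : rt h ^ 5 ∈ S := by
    have := mul_mem (inv_mem h3) h2
    rwa [inv_mul_cancel_left] at this
  have h6 : rt h ∈ S := by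
    have := mul_mem (pow_mem h1 m') h5
    rw [← pow_mul, ← pow_add] at this
    have h7 : 6 * m * m' + 5 = 10 * (3 * (m * m' / 5) + 1) + 1 := by
      have h8 := Nat.div_add_mod (m * m') 5
      rw [mul_assoc]
      omega
    rwa [h7, pow_add, pow_mul, rt_pow_ten, one_pow, one_mul, pow_one] at this
  rw [eq_top_iff, ← closure_eq_top h hgen, Subgroup.closure_le]
  rintro _ (rfl | rfl)
  · exact h6
  · exact mul_mem h4 h5

end TwistedGroup

namespace CyclotomicQuotient

variable {p : ℕ}

theorem nonempty_mulEquiv_of_surjective [NeZero p] (X : CyclotomicQuotient p) {G : Type*} [Group G]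
    (hG : Finite G ∧ Nat.card G ≤ 10 * p ^ 2) {f : G →* TwistedGroup X.rel}
    (hf : f.range = ⊤) : Nonempty (TwistedGroup X.rel ≃* G) := by
  have := hG.1
  have hs := MonoidHom.range_eq_top.1 hf
  exact ⟨(MulEquiv.ofBijective f (hs.bijective_of_nat_card_le
    (by rw [TwistedGroup.natCard, X.card]; exact hG.2))).symm⟩

theorem closure_mk_of_eq_top (rels : Set (FreeGroup (Fin 4))) :
    Subgroup.closure {PresentedGroup.mk rels (.of 0), PresentedGroup.mk rels (.of 1),
      PresentedGroup.mk rels (.of 2), PresentedGroup.mk rels (.of 3)} = ⊤ := by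
  rw [← PresentedGroup.closure_range_of rels]
  congr 1
  ext z
  simp [Fin.exists_fin_succ, PresentedGroup.of, eq_comm]

theorem card_GHat_le [NeZero p] (u v : ZMod p) :
    Finite (GHat p u v) ∧ Nat.card (GHat p u v) ≤ 10 * p ^ 2 := by
  have rel {y z : FreeGroup (Fin 4)} (hz : y * z⁻¹ ∈ gHatRels p u v) :=
    PresentedGroup.mk_eq_mk_of_mul_inv_mem hz
  have rel1 {z : FreeGroup (Fin 4)} (hz : z ∈ gHatRels p u v) := PresentedGroup.one_of_mem hz
  have hda := rel1 (z := (.of 3 * .of 0) ^ 2) (by simp [gHatRels])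
  have hdb := rel1 (z := (.of 3 * .of 1) ^ 2) (by simp [gHatRels])
  have hab := rel1 (z := .of 0 * .of 1 * (.of 0)⁻¹ * (.of 1)⁻¹) (by simp [gHatRels])
  have hca := rel (y := .of 2 * .of 0 * (.of 2)⁻¹) (z := .of 0 ^ u.val) (by simp [gHatRels])
  have hcb := rel (y := .of 2 * .of 1 * (.of 2)⁻¹) (z := .of 1 ^ v.val) (by simp [gHatRels])
  have hdc := rel (y := .of 3 * .of 2 * .of 3)
    (z := .of 0 ^ (1 - u).val * .of 1 ^ (1 - v).val * .of 2) (by simp [gHatRels])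
  simp only [map_mul, map_pow, map_inv] at hda hdb hab hca hcb hdc
  rw [pow_two p]
  refine card_le_of_inverting_relations (closure_mk_of_eq_top _)
    (rel1 (z := .of 0 ^ p) (by simp [gHatRels])) (rel1 (z := .of 1 ^ p) (by simp [gHatRels]))
    (rel1 (z := .of 2 ^ 5) (by simp [gHatRels])) (rel1 (z := .of 3 ^ 2) (by simp [gHatRels]))
    hab hda hdb ?_ ?_ ?_
  · rw [hca]; exact pow_mem (Subgroup.subset_closure (by simp)) _
  · rw [hcb]; exact pow_mem (Subgroup.subset_closure (by simp)) _
  · rw [hdc, mul_inv_cancel_right]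
    exact mul_mem (pow_mem (Subgroup.subset_closure (by simp)) _)
      (pow_mem (Subgroup.subset_closure (by simp)) _)

theorem card_GZeroHat_le [NeZero p] (t₁ t₂ : ZMod p) :
    Finite (GZeroHat p t₁ t₂) ∧ Nat.card (GZeroHat p t₁ t₂) ≤ 10 * p ^ 2 := by
  have rel {y z : FreeGroup (Fin 4)} (hz : y * z⁻¹ ∈ gZeroHatRels p t₁ t₂) :=
    PresentedGroup.mk_eq_mk_of_mul_inv_mem hz
  have rel1 {z : FreeGroup (Fin 4)} (hz : z ∈ gZeroHatRels p t₁ t₂) :=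
    PresentedGroup.one_of_mem hz
  have hda := rel1 (z := (.of 3 * .of 0) ^ 2) (by simp [gZeroHatRels])
  have hdb := rel1 (z := (.of 3 * .of 1) ^ 2) (by simp [gZeroHatRels])
  have hab := rel1 (z := .of 0 * .of 1 * (.of 0)⁻¹ * (.of 1)⁻¹) (by simp [gZeroHatRels])
  have hca := rel (y := .of 2 * .of 0 * (.of 2)⁻¹) (z := .of 1 ^ t₂.val) (by simp [gZeroHatRels])
  have hcb := rel (y := .of 2 * .of 1 * (.of 2)⁻¹) (z := (.of 0 * .of 1) ^ t₁.val)
    (by simp [gZeroHatRels])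
  have hdc := rel (y := .of 3 * .of 2 * .of 3)
    (z := .of 0 ^ (t₁ ^ 2).val * .of 1 ^ 2 * .of 2) (by simp [gZeroHatRels])
  simp only [map_mul, map_pow, map_inv] at hda hdb hab hca hcb hdc
  rw [pow_two p]
  refine card_le_of_inverting_relations (closure_mk_of_eq_top _)
    (rel1 (z := .of 0 ^ p) (by simp [gZeroHatRels]))
    (rel1 (z := .of 1 ^ p) (by simp [gZeroHatRels]))
    (rel1 (z := .of 2 ^ 5) (by simp [gZeroHatRels]))
    (rel1 (z := .of 3 ^ 2) (by simp [gZeroHatRels])) hab hda hdb ?_ ?_ ?_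
  · rw [hca]; exact pow_mem (Subgroup.subset_closure (by simp)) _
  · rw [hcb]
    exact pow_mem (mul_mem (Subgroup.subset_closure (by simp))
      (Subgroup.subset_closure (by simp))) _
  · rw [hdc, mul_inv_cancel_right]
    exact mul_mem (pow_mem (Subgroup.subset_closure (by simp)) _)
      (pow_mem (Subgroup.subset_closure (by simp)) _)

theorem card_GOneHat_le [NeZero p] (k : ZMod (p ^ 2)) :
    Finite (GOneHat p k) ∧ Nat.card (GOneHat p k) ≤ 10 * p ^ 2 := by
  have rel {y z : FreeGroup (Fin 3)} (hz : y * z⁻¹ ∈ gOneHatRels p k) :=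
    PresentedGroup.mk_eq_mk_of_mul_inv_mem hz
  have rel1 {z : FreeGroup (Fin 3)} (hz : z ∈ gOneHatRels p k) := PresentedGroup.one_of_mem hz
  have hca := rel1 (z := (.of 2 * .of 0) ^ 2) (by simp [gOneHatRels])
  have hcb := rel1 (z := .of 2 * .of 1 * (.of 2)⁻¹ * (.of 1)⁻¹) (by simp [gOneHatRels])
  have hc := rel1 (z := .of 2 ^ 2) (by simp [gOneHatRels])
  have hba := rel (y := .of 1 * .of 0 * (.of 1)⁻¹) (z := .of 0 ^ k.val) (by simp [gOneHatRels])
  simp only [map_mul, map_pow, map_inv] at hca hcb hc hba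
  -- the abelian normal subgroup is generated by `a` alone
  rw [← mul_one (p ^ 2)]
  refine card_le_of_relations (a := PresentedGroup.mk (gOneHatRels p k) (.of 0)) (b := 1)
    (c := PresentedGroup.mk (gOneHatRels p k) (.of 1))
    (d := PresentedGroup.mk (gOneHatRels p k) (.of 2)) ?_ (Commute.one_right _)
    (rel1 (z := .of 0 ^ p ^ 2) (by simp [gOneHatRels])) (one_pow 1)
    (rel1 (z := .of 1 ^ 5) (by simp [gOneHatRels])) hc ?_ ?_ ?_ ?_ ?_
  · rw [eq_top_iff, ← PresentedGroup.closure_range_of (gOneHatRels p k)]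
    refine Subgroup.closure_mono ?_
    rintro _ ⟨i, rfl⟩
    fin_cases i <;> simp [PresentedGroup.of]
  · rw [hba]; exact pow_mem (Subgroup.subset_closure (by simp)) _
  · rw [mul_one, mul_inv_cancel]; exact one_mem _
  · rw [conj_eq_inv_of_mul_sq hc hca]; exact inv_mem (Subgroup.subset_closure (by simp))
  · rw [mul_one, mul_inv_cancel]; exact one_mem _
  · rw [hcb]; exact one_mem _

/-- The generators `a`, `b` of the presented group are the translations by the idempotents of
`𝔽_p × 𝔽_p`, `c` is the power of `rt` acting as `x ^ m`, and `d` is `inv`. -/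
theorem nonempty_GHat [Fact p.Prime] {a b : ZMod p} (hab : a ≠ b)
    (ha : 1 + a + a ^ 2 + a ^ 3 + a ^ 4 = 0) (hb : 1 + b + b ^ 2 + b ^ 3 + b ^ 4 = 0)
    {m m' : ℕ} (hm : m * m' % 5 = 1) :
    Nonempty (TwistedGroup (split a b hab ha hb).rel ≃* GHat p (a ^ m) (b ^ m)) := by
  have : NeZero p := ⟨(Fact.out : p.Prime).ne_zero⟩
  set X := split a b hab ha hb with hX
  let e₁ : X.carrier := ((1, 0) : ZMod p × ZMod p)
  let e₂ : X.carrier := ((0, 1) : ZMod p × ZMod p)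
  have hone : (1 : X.carrier) = e₁ + e₂ := Prod.ext (add_zero 1).symm (zero_add 1).symm
  have hcast (n : ℕ) : (n : X.carrier) = ((n : ZMod p), (n : ZMod p)) := rfl
  have hm₁ (u : ZMod p) : (u.val : X.carrier) * e₁ = ((u, 0) : ZMod p × ZMod p) := by
    rw [hcast, ZMod.natCast_zmod_val]
    exact Prod.ext (mul_one u) (mul_zero u)
  have hm₂ (u : ZMod p) : (u.val : X.carrier) * e₂ = ((0, u) : ZMod p × ZMod p) := by
    rw [hcast, ZMod.natCast_zmod_val]
    exact Prod.ext (mul_zero u) (mul_one u)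
  have hx₁ : X.x ^ m * e₁ = ((a ^ m, 0) : ZMod p × ZMod p) :=
    Prod.ext (mul_one (a ^ m)) (mul_zero (b ^ m))
  have hx₂ : X.x ^ m * e₂ = ((0, b ^ m) : ZMod p × ZMod p) :=
    Prod.ext (mul_zero (a ^ m)) (mul_one (b ^ m))
  have hp : (p : X.carrier) = 0 := by
    rw [hcast, ZMod.natCast_self]; rfl
  have hrel : ∀ z ∈ gHatRels p (a ^ m) (b ^ m), FreeGroup.lift ![TwistedGroup.tr X.rel e₁,
      TwistedGroup.tr X.rel e₂, TwistedGroup.rt X.rel ^ (6 * m),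
      TwistedGroup.tr X.rel 1 * TwistedGroup.rt X.rel ^ 5] z = 1 := by
    rintro z (rfl | rfl | rfl | rfl | rfl | rfl | rfl | rfl | rfl | rfl) <;>
      simp only [map_mul, map_pow, map_inv, FreeGroup.lift_apply_of, Matrix.cons_val]
    · rw [TwistedGroup.tr_pow, hp, zero_mul, TwistedGroup.tr_zero]
    · rw [TwistedGroup.tr_pow, hp, zero_mul, TwistedGroup.tr_zero]
    · exact TwistedGroup.rt_pow_pow_five _ _
    · exact TwistedGroup.tr_mul_rt_pow_five_sq _ _
    · rw [← TwistedGroup.tr_add, mul_inv_eq_one, mul_inv_eq_iff_eq_mul, ← TwistedGroup.tr_add,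
        add_comm]
    · rw [TwistedGroup.tr_mul_rt_pow_five_mul_tr, TwistedGroup.tr_mul_rt_pow_five_sq]
    · rw [TwistedGroup.tr_mul_rt_pow_five_mul_tr, TwistedGroup.tr_mul_rt_pow_five_sq]
    · rw [TwistedGroup.rt_pow_conj_tr, TwistedGroup.tr_pow, mul_inv_eq_one, hm₁, hx₁]
    · rw [TwistedGroup.rt_pow_conj_tr, TwistedGroup.tr_pow, mul_inv_eq_one, hm₂, hx₂]
    · rw [TwistedGroup.tr_mul_rt_pow_five_conj, TwistedGroup.tr_pow, TwistedGroup.tr_pow,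
        mul_inv_eq_one, ← TwistedGroup.tr_add, hm₁, hm₂]
      congr 2
      exact Prod.ext (by change 1 - a ^ m * 1 = 1 - a ^ m + 0; ring)
        (by change 1 - b ^ m * 1 = 0 + (1 - b ^ m); ring)
  refine X.nonempty_mulEquiv_of_surjective (card_GHat_le _ _) (f := PresentedGroup.toGroup hrel) ?_
  have hmem (i : Fin 4) := (PresentedGroup.toGroup hrel).mem_range.2 ⟨PresentedGroup.of i, rfl⟩
  simp only [PresentedGroup.toGroup.of] at hmem
  generalize (PresentedGroup.toGroup hrel).range = S at hmem ⊢
  have h1 : TwistedGroup.tr X.rel 1 ∈ S := by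
    rw [hone, TwistedGroup.tr_add]
    exact mul_mem (hmem 0) (hmem 1)
  exact TwistedGroup.eq_top_of_mem X.rel X.gen hm (hmem 2) (hmem 3) h1 h1

/-- The generator `a` of the presented group is the translation by `1`, `b` is the power of `rt`
acting as `x ^ m`, and `c` is `rt ^ 5`, which acts as `-1`. -/
theorem nonempty_GOneHat [Fact p.Prime] {k : ZMod (p ^ 2)} (hk : 1 + k + k ^ 2 + k ^ 3 + k ^ 4 = 0)
    {m m' : ℕ} (hm : m * m' % 5 = 1) :
    Nonempty (TwistedGroup (cyclic k hk).rel ≃* GOneHat p (k ^ m)) := by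
  have : NeZero p := ⟨(Fact.out : p.Prime).ne_zero⟩
  set X := cyclic k hk with hX
  have hp : ((p ^ 2 : ℕ) : X.carrier) = 0 := ZMod.natCast_self (p ^ 2)
  have hv (u : ZMod (p ^ 2)) : ((u.val : ℕ) : X.carrier) = u := ZMod.natCast_zmod_val u
  have h0 := TwistedGroup.tr_zero X.rel
  have hrel : ∀ z ∈ gOneHatRels p (k ^ m), FreeGroup.lift ![TwistedGroup.tr X.rel 1,
      TwistedGroup.rt X.rel ^ (6 * m),
      TwistedGroup.tr X.rel 0 * TwistedGroup.rt X.rel ^ 5] z = 1 := by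
    rintro z (rfl | rfl | rfl | rfl | rfl | rfl) <;>
      simp only [map_mul, map_pow, map_inv, FreeGroup.lift_apply_of, Matrix.cons_val]
    · rw [TwistedGroup.tr_pow, hp, zero_mul, TwistedGroup.tr_zero]
    · exact TwistedGroup.rt_pow_pow_five _ _
    · exact TwistedGroup.tr_mul_rt_pow_five_sq _ _
    · rw [TwistedGroup.tr_mul_rt_pow_five_mul_tr, TwistedGroup.tr_mul_rt_pow_five_sq]
    · rw [h0, one_mul, mul_inv_eq_one, mul_inv_eq_iff_eq_mul, ← pow_add, ← pow_add, add_comm]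
    · rw [TwistedGroup.rt_pow_conj_tr, TwistedGroup.tr_pow, mul_inv_eq_one, hv]
      rfl
  refine X.nonempty_mulEquiv_of_surjective (card_GOneHat_le _)
    (f := PresentedGroup.toGroup hrel) ?_
  have hmem (i : Fin 3) := (PresentedGroup.toGroup hrel).mem_range.2 ⟨PresentedGroup.of i, rfl⟩
  simp only [PresentedGroup.toGroup.of] at hmem
  generalize (PresentedGroup.toGroup hrel).range = S at hmem ⊢
  exact TwistedGroup.eq_top_of_mem X.rel X.gen hm (hmem 1) (hmem 2)
    (by rw [h0]; exact one_mem _) (hmem 0)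

/-- The power `z = x ^ m` is a root of `X² - t₁X + 1`. The generators `a`, `b` of the presented
group are the translations by `-t₂ z - 1` and `1`, `c` is the power of `rt` acting as `z`, and
`d` is `tr w * rt ^ 5`, where `w = (1 + t₁) z` solves `(1 - z) w = t₁² a + 2 b`. -/
theorem nonempty_GZeroHat [Fact p.Prime] (Y : CyclotomicQuotient p) (i : ZMod p →+* Y.carrier)
    {t₁ t₂ : ZMod p} (h₁ : t₁ ^ 2 + t₁ - 1 = 0) (h₂ : t₁ + t₂ = -1) {m m' : ℕ}
    (hm : m * m' % 5 = 1) (hz : Y.x ^ m * Y.x ^ m - i t₁ * Y.x ^ m + 1 = 0) :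
    Nonempty (TwistedGroup Y.rel ≃* GZeroHat p t₁ t₂) := by
  have : NeZero p := ⟨(Fact.out : p.Prime).ne_zero⟩
  have hi (u : ZMod p) : ((u.val : ℕ) : Y.carrier) = i u := by
    rw [← map_natCast i, ZMod.natCast_zmod_val]
  have hp : (p : Y.carrier) = 0 := by
    rw [← map_natCast i, ZMod.natCast_self, map_zero]
  have hi₁ : i t₁ ^ 2 + i t₁ - 1 = 0 := by
    rw [← map_pow, ← map_add, ← map_one i, ← map_sub, h₁, map_zero]
  have hi₂ : i t₁ + i t₂ = -1 := by rw [← map_add, h₂, map_neg, map_one]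
  generalize hzz : Y.x ^ m = z at hz
  let a : Y.carrier := -i t₂ * z - 1
  have hw : (1 + i t₁) * z = (((1 + t₁) * t₁).val : Y.carrier) * (a + 1) := by
    rw [hi, map_mul, map_add, map_one]
    simp only [a]
    linear_combination ((1 + i t₁) * z) * (i t₁ * hi₂ - hi₁)
  have hrel : ∀ z' ∈ gZeroHatRels p t₁ t₂, FreeGroup.lift ![TwistedGroup.tr Y.rel a,
      TwistedGroup.tr Y.rel 1, TwistedGroup.rt Y.rel ^ (6 * m),
      TwistedGroup.tr Y.rel ((1 + i t₁) * z) * TwistedGroup.rt Y.rel ^ 5] z' = 1 := by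
    rintro z' (rfl | rfl | rfl | rfl | rfl | rfl | rfl | rfl | rfl | rfl) <;>
      simp only [map_mul, map_pow, map_inv, FreeGroup.lift_apply_of, Matrix.cons_val]
    · rw [TwistedGroup.tr_pow, hp, zero_mul, TwistedGroup.tr_zero]
    · rw [TwistedGroup.tr_pow, hp, zero_mul, TwistedGroup.tr_zero]
    · exact TwistedGroup.rt_pow_pow_five _ _
    · exact TwistedGroup.tr_mul_rt_pow_five_sq _ _
    · rw [← TwistedGroup.tr_add, mul_inv_eq_one, mul_inv_eq_iff_eq_mul, ← TwistedGroup.tr_add,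
        add_comm]
    · rw [TwistedGroup.tr_mul_rt_pow_five_mul_tr, TwistedGroup.tr_mul_rt_pow_five_sq]
    · rw [TwistedGroup.tr_mul_rt_pow_five_mul_tr, TwistedGroup.tr_mul_rt_pow_five_sq]
    · rw [TwistedGroup.rt_pow_conj_tr, TwistedGroup.tr_pow, mul_inv_eq_one, hi, hzz]
      congr 1
      simp only [a]
      linear_combination -i t₂ * hz - z * (i t₁ * hi₂ - hi₁)
    · rw [TwistedGroup.rt_pow_conj_tr, ← TwistedGroup.tr_add, TwistedGroup.tr_pow, mul_inv_eq_one,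
        hi, hzz]
      congr 1
      simp only [a]
      linear_combination z * (i t₁ * hi₂ - hi₁)
    · rw [TwistedGroup.tr_mul_rt_pow_five_conj, TwistedGroup.tr_pow, TwistedGroup.tr_pow,
        mul_inv_eq_one, ← TwistedGroup.tr_add, hi, hzz, map_pow]
      congr 2
      simp only [a, Nat.cast_ofNat]
      linear_combination -(1 + i t₁) * hz + hi₁ + z * (-hi₁ + i t₁ * (i t₁ * hi₂ - hi₁))
  refine Y.nonempty_mulEquiv_of_surjective (card_GZeroHat_le _ _)
    (f := PresentedGroup.toGroup hrel) ?_
  have hmem (j : Fin 4) := (PresentedGroup.toGroup hrel).mem_range.2 ⟨PresentedGroup.of j, rfl⟩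
  simp only [PresentedGroup.toGroup.of] at hmem
  generalize (PresentedGroup.toGroup hrel).range = S at hmem ⊢
  refine TwistedGroup.eq_top_of_mem Y.rel Y.gen hm (hmem 2) (hmem 3) ?_ (hmem 1)
  rw [hw, ← TwistedGroup.tr_pow, TwistedGroup.tr_add]
  exact pow_mem (mul_mem (hmem 0) (hmem 1)) _

end CyclotomicQuotient

/-! ### Counting classes of maps and chiral pairs -/

namespace OrientedMap

variable {M N : OrientedMap}

theorem EquivUpToDuality.mirror (h : M.EquivUpToDuality N) :
    M.mirror.EquivUpToDuality N.mirror :=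
  h.imp Isomorphic.mirror fun h => (Isomorphic.mirror h).trans N.mirror_dual_isomorphic

theorem EquivUpToDuality.isReflexive_iff (h : M.EquivUpToDuality N) :
    M.IsReflexive ↔ N.IsReflexive := by
  rcases h with h | h
  · exact ⟨h.isReflexive, h.symm.isReflexive⟩
  · exact ⟨fun hM => isReflexive_dual_iff.1 (h.isReflexive hM),
      fun hN => h.symm.isReflexive hN.dual⟩

theorem EquivUpToDuality.nonempty_autPlus (h : M.EquivUpToDuality N) :
    Nonempty (N.autPlus ≃* M.autPlus) := by
  rcases h with h | h
  · exact h.symm.nonempty_autPlus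
  · obtain ⟨e⟩ := h.symm.nonempty_autPlus
    obtain ⟨f⟩ := N.nonempty_autPlus_dual
    exact ⟨f.trans e⟩

end OrientedMap

namespace CyclotomicQuotient

open OrientedMap

variable {p : ℕ} [hp : Fact p.Prime]

instance : NeZero p := ⟨hp.out.ne_zero⟩

/-- Two of the standard maps are equivalent up to duality only if they are isomorphic, since the
vertex degree is `10` and the face degree `5`. -/
theorem ker_eq_of_equivUpToDuality (hp2 : p ≠ 2) {X Y : CyclotomicQuotient p}
    (h : X.toMap.EquivUpToDuality Y.toMap) : X.ker = Y.ker := by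
  rcases h with h | h
  · exact ker_eq_of_isomorphic h
  · have h1 := h.orderOf_faceRot
    rw [orderOf_faceRot_dual, Y.orderOf_rot_toMap] at h1
    have h2 := orderOf_rot_faceRot_of_mem_regularMaps hp.out hp2 X.toMap_mem
    rw [X.orderOf_rot_toMap] at h2
    omega

theorem nonempty_mulEquiv_of_ker {X Y : CyclotomicQuotient p} (h : X.ker ≤ Y.ker) :
    Nonempty (TwistedGroup X.rel ≃* TwistedGroup Y.rel) := by
  obtain ⟨e⟩ := (toMap_isomorphic h).nonempty_autPlus
  obtain ⟨f⟩ := X.nonempty_autPlus_toMap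
  obtain ⟨g⟩ := Y.nonempty_autPlus_toMap
  exact ⟨f.symm.trans (e.trans g)⟩

/-- The group detects whether the quotient has characteristic `p`: if so, it has no element of
order `p²`. -/
theorem natCast_eq_zero_of_mulEquiv (hp11 : 11 ≤ p) {X Y : CyclotomicQuotient p}
    (e : TwistedGroup X.rel ≃* TwistedGroup Y.rel) (hY : (p : Y.carrier) = 0) :
    (p : X.carrier) = 0 := by
  have h1 : TwistedGroup.tr X.rel 1 ^ p ^ 2 = 1 := by
    rw [TwistedGroup.tr_pow, Nat.cast_pow, X.prime_sq_eq_zero, zero_mul, TwistedGroup.tr_zero]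
  have h2 : e (TwistedGroup.tr X.rel 1) ^ p ^ 2 = 1 := by rw [← map_pow, h1, map_one]
  obtain ⟨a, n, han⟩ := TwistedGroup.eq_tr_mul_rt_pow Y.rel (e (TwistedGroup.tr X.rel 1))
  rw [han, TwistedGroup.tr_mul_rt_pow_pow] at h2
  have h3 := ((TwistedGroup.tr_mul_rt_pow_eq_iff Y.rel (b := 0) (n := 0)).1
    (by rw [h2, TwistedGroup.tr_zero, pow_zero, mul_one])).2
  rw [Nat.cast_zero, ZMod.natCast_eq_zero_iff] at h3
  have hcop : Nat.Coprime 10 (p ^ 2) := Nat.Coprime.pow_right 2 (Nat.coprime_comm.1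
    ((Nat.Prime.coprime_iff_not_dvd hp.out).2 fun h => absurd (Nat.le_of_dvd (by norm_num) h)
      (by omega)))
  obtain ⟨j, rfl⟩ := hcop.dvd_of_dvd_mul_right h3
  rw [pow_mul, TwistedGroup.rt_pow_ten, one_pow, mul_one] at han
  have h4 : e (TwistedGroup.tr X.rel 1 ^ p) = 1 := by
    rw [map_pow, han, TwistedGroup.tr_pow, hY, zero_mul, TwistedGroup.tr_zero]
  rw [map_eq_one_iff e e.injective, TwistedGroup.tr_pow, mul_one,
    ← TwistedGroup.tr_zero X.rel] at h4
  exact TwistedGroup.tr_injective _ h4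

/-! A family `F` containing every quotient of `ℤ[ζ₅]` of order `p²` exactly once, up to isomorphism,
on whose index set complex conjugation acts as `σ`. -/

section Enumeration

variable {ι : Type*} {F : ι → CyclotomicQuotient p} {σ : ι → ι}

/-- The map of a quotient is reflexive exactly if complex conjugation fixes the quotient. -/
theorem isReflexive_toMap_iff (hinj : ∀ i j, (F i).ker = (F j).ker → i = j)
    (hσ : ∀ i, (F i).conj.ker = (F (σ i)).ker) (i : ι) :
    (F i).toMap.IsReflexive ↔ σ i = i := by
  have h1 : (F (σ i)).toMap.Isomorphic (F i).toMap.mirror :=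
    (toMap_isomorphic (hσ i).ge).trans (F i).toMap_mirror
  refine ⟨fun h => (hinj _ _ (ker_eq_of_isomorphic (h.trans h1.symm))).symm, fun h => ?_⟩
  rw [h] at h1
  exact h1

theorem exists_index_equivUpToDuality (hp11 : 11 ≤ p)
    (hex : ∀ X : CyclotomicQuotient p, ∃ i, (F i).ker = X.ker) {M : OrientedMap}
    (hM : M ∈ regularMaps p) : ∃ i, (F i).toMap.EquivUpToDuality M := by
  obtain ⟨X, hX⟩ := exists_toMap_isomorphic_or_dual hp11 hM
  obtain ⟨i, hi⟩ := hex X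
  exact ⟨i, dualitySetoid.trans (Or.inl (toMap_isomorphic hi.le)) hX⟩

theorem toClass_injective (hp2 : p ≠ 2) (hinj : ∀ i j, (F i).ker = (F j).ker → i = j) :
    Function.Injective fun i => toClass (F i).toMap := fun i j h =>
  hinj i j (ker_eq_of_equivUpToDuality hp2 (Quotient.exact h))

/-- Classes of maps are counted by an index set for the quotients of `ℤ[ζ₅]` of order `p²`. -/
theorem ncard_classes (hp11 : 11 ≤ p) (hinj : ∀ i j, (F i).ker = (F j).ker → i = j)
    (hex : ∀ X : CyclotomicQuotient p, ∃ i, (F i).ker = X.ker) {S : Set OrientedMap}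
    (hS : S ⊆ regularMaps p) {Q : ι → Prop}
    (hSQ : ∀ M ∈ regularMaps p, ∀ i, (F i).toMap.EquivUpToDuality M → (M ∈ S ↔ Q i)) :
    (classes S).ncard = {i | Q i}.ncard := by
  have : classes S = (fun i => toClass (F i).toMap) '' {i | Q i} := by
    ext c
    constructor
    · rintro ⟨M, hM, rfl⟩
      obtain ⟨i, hiM⟩ := exists_index_equivUpToDuality hp11 hex (hS hM)
      exact ⟨i, (hSQ M (hS hM) i hiM).1 hM, Quotient.sound hiM⟩
    · rintro ⟨i, hi, rfl⟩
      exact ⟨_, (hSQ _ (F i).toMap_mem i (dualitySetoid.refl _)).2 hi, rfl⟩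
  rw [this, Set.ncard_image_of_injective _ (toClass_injective (by omega) hinj)]

/-- Chiral pairs are counted by the pairs `{i, σ i}` with `σ i ≠ i`. -/
theorem ncard_chiralPairs (hp11 : 11 ≤ p) (hinj : ∀ i j, (F i).ker = (F j).ker → i = j)
    (hex : ∀ X : CyclotomicQuotient p, ∃ i, (F i).ker = X.ker)
    (hσ : ∀ i, (F i).conj.ker = (F (σ i)).ker) {S : Set OrientedMap}
    (hS : S ⊆ regularMaps p) {Q : ι → Prop}
    (hSQ : ∀ M ∈ regularMaps p, ∀ i, σ i ≠ i → (F i).toMap.EquivUpToDuality M → (M ∈ S ↔ Q i)) :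
    (chiralPairs S).ncard = ((fun i => s(i, σ i)) '' {i | Q i ∧ σ i ≠ i}).ncard := by
  have hm (i : ι) : toClass (F i).toMap.mirror = toClass (F (σ i)).toMap :=
    (Quotient.sound (Or.inl ((toMap_isomorphic (hσ i).ge).trans (F i).toMap_mirror))).symm
  have : chiralPairs S = Sym2.map (fun i => toClass (F i).toMap) ''
      ((fun i => s(i, σ i)) '' {i | Q i ∧ σ i ≠ i}) := by
    ext c
    constructor
    · rintro ⟨M, ⟨hM, hc⟩, rfl⟩
      obtain ⟨i, hiM⟩ := exists_index_equivUpToDuality hp11 hex (hS hM)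
      have hne : σ i ≠ i := fun h =>
        hc (hiM.isReflexive_iff.1 ((isReflexive_toMap_iff hinj hσ i).2 h))
      refine ⟨_, ⟨i, ⟨(hSQ M (hS hM) i hne hiM).1 hM, hne⟩, rfl⟩, ?_⟩
      have h1 : toClass (F i).toMap = toClass M := Quotient.sound hiM
      have h2 : toClass (F i).toMap.mirror = toClass M.mirror := Quotient.sound hiM.mirror
      rw [Sym2.map_mk, ← hm, h1, h2]
    · rintro ⟨_, ⟨i, ⟨hi, hne⟩, rfl⟩, rfl⟩
      refine ⟨(F i).toMap, ⟨(hSQ _ (F i).toMap_mem i hne (dualitySetoid.refl _)).2 hi, ?_⟩, ?_⟩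
      · exact fun h => hne ((isReflexive_toMap_iff hinj hσ i).1 h)
      · simp only [Sym2.map_mk, hm]
  rw [this, Set.ncard_image_of_injective _ (Sym2.map.injective (toClass_injective (by omega) hinj))]

end Enumeration

end CyclotomicQuotient

/-! ### Fifth roots of unity modulo `p` and `p²` -/

section Roots

theorem exists_pow_eq_of_isCyclic {R : Type*} [CommRing R] [Finite R] [IsCyclic Rˣ] {k : R}
    (hk : IsPrimitiveRoot k 5) {r : R} (hr : r ^ 5 = 1) : ∃ i < 5, k ^ i = r := by
  classical
  have := Fintype.ofFinite Rˣ
  lift k to Rˣ using hk.isUnit (by norm_num)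
  lift r to Rˣ using IsUnit.of_pow_eq_one hr (by norm_num)
  rw [IsPrimitiveRoot.coe_units_iff] at hk
  replace hr : r ^ 5 = 1 := Units.ext hr
  have h1 : (Finset.range 5).image (k ^ ·) ⊆ Finset.univ.filter fun a : Rˣ => a ^ 5 = 1 := by
    intro a ha
    obtain ⟨i, -, rfl⟩ := Finset.mem_image.1 ha
    rw [Finset.mem_filter_univ, ← pow_mul, mul_comm, pow_mul, hk.pow_eq_one, one_pow]
  have h2 : ((Finset.range 5).image (k ^ ·)).card = 5 := by
    rw [Finset.card_image_of_injOn, Finset.card_range]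
    intro i hi j hj hij
    exact hk.pow_inj (Finset.mem_range.1 hi) (Finset.mem_range.1 hj) hij
  have h3 := Finset.eq_of_subset_of_card_le h1
    ((IsCyclic.card_pow_eq_one_le (by norm_num)).trans h2.ge)
  have h4 : r ∈ (Finset.range 5).image (k ^ ·) := by rw [h3]; simpa using hr
  obtain ⟨i, hi, hir⟩ := Finset.mem_image.1 h4
  exact ⟨i, Finset.mem_range.1 hi, by rw [← hir, Units.val_pow_eq_pow_val]⟩

theorem exists_pow_succ_eq {R : Type*} [CommRing R] [Finite R] [IsCyclic Rˣ] (h5 : (5 : R) ≠ 0)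
    {k : R} (hk : IsPrimitiveRoot k 5) {r : R} (hr : 1 + r + r ^ 2 + r ^ 3 + r ^ 4 = 0) :
    ∃ i : Fin 4, k ^ (i.val + 1) = r := by
  obtain ⟨i, hi, rfl⟩ := exists_pow_eq_of_isCyclic hk (pow_five_of_rel hr)
  have h0 : i ≠ 0 := by
    rintro rfl
    apply h5
    rw [← hr]; norm_num
  exact ⟨⟨i - 1, by omega⟩, by simp only; congr 1; omega⟩

theorem pow_succ_injective {R : Type*} [CommRing R] {k : R} (hk : IsPrimitiveRoot k 5)
    {i j : Fin 4} (h : k ^ (i.val + 1) = k ^ (j.val + 1)) : i = j := by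
  have := hk.pow_inj (by omega) (by omega) h
  omega

theorem isPrimitiveRoot_pow_succ {R : Type*} [CommRing R] {k : R} (hk : IsPrimitiveRoot k 5)
    (i : Fin 4) : IsPrimitiveRoot (k ^ (i.val + 1)) 5 :=
  hk.pow_of_coprime _ (by fin_cases i <;> decide)

variable {p : ℕ} [hp : Fact p.Prime]

omit hp in
theorem not_dvd_five (hp11 : 11 ≤ p) : ¬ p ∣ 5 := fun h =>
  absurd (Nat.le_of_dvd (by norm_num) h) (by omega)

theorem five_ne_zero_zmod (hp11 : 11 ≤ p) : (5 : ZMod p) ≠ 0 := fun h =>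
  not_dvd_five hp11 ((ZMod.natCast_eq_zero_iff 5 p).1 h)

theorem isUnit_five (hp11 : 11 ≤ p) : IsUnit (5 : ZMod (p ^ 2)) :=
  (ZMod.isUnit_iff_coprime 5 (p ^ 2)).2 (Nat.Coprime.pow_right 2 (Nat.coprime_comm.1
    ((Nat.Prime.coprime_iff_not_dvd hp.out).2 (not_dvd_five hp11))))

theorem five_ne_zero_zmod_sq (hp11 : 11 ≤ p) : (5 : ZMod (p ^ 2)) ≠ 0 := by
  have : Fact (1 < p ^ 2) := ⟨Nat.one_lt_pow two_ne_zero hp.out.one_lt⟩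
  exact (isUnit_five hp11).ne_zero

theorem rel_of_isPrimitiveRoot {s : ZMod p} (hs : IsPrimitiveRoot s 5) :
    1 + s + s ^ 2 + s ^ 3 + s ^ 4 = 0 := by
  have h1 : (s - 1) * (1 + s + s ^ 2 + s ^ 3 + s ^ 4) = 0 := by
    linear_combination hs.pow_eq_one
  exact (mul_eq_zero.1 h1).resolve_left (sub_ne_zero.2 (hs.ne_one (by norm_num)))

/-- Modulo `p²`, an element of order `5` differs from `1` by a unit: otherwise its fifth power is
`1 + 5 (k - 1)`. -/
theorem rel_of_isPrimitiveRoot_sq (hp11 : 11 ≤ p) {k : ZMod (p ^ 2)} (hk : IsPrimitiveRoot k 5) :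
    1 + k + k ^ 2 + k ^ 3 + k ^ 4 = 0 := by
  have h1 : (k - 1) * (1 + k + k ^ 2 + k ^ 3 + k ^ 4) = 0 := by
    linear_combination hk.pow_eq_one
  have : NeZero (p ^ 2) := ⟨pow_ne_zero _ hp.out.ne_zero⟩
  obtain ⟨n, hn⟩ := ZMod.natCast_zmod_surjective (k - 1)
  have hu : IsUnit (k - 1) := by
    rw [← hn, ZMod.isUnit_iff_coprime]
    refine Nat.Coprime.pow_right 2 (Nat.coprime_comm.1
      ((Nat.Prime.coprime_iff_not_dvd hp.out).2 ?_))
    rintro ⟨m, rfl⟩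
    have h2 : (k - 1) ^ 2 = 0 := by
      rw [← hn, Nat.cast_mul, mul_pow, ← Nat.cast_pow, ZMod.natCast_self, zero_mul]
    have h3 : 5 * (k - 1) = 0 := by
      linear_combination hk.pow_eq_one - (k ^ 3 + 2 * k ^ 2 + 3 * k + 4) * h2
    exact hk.ne_one (by norm_num) (sub_eq_zero.1 ((isUnit_five hp11).mul_right_eq_zero.1 h3))
  exact hu.mul_right_eq_zero.1 h1

theorem exists_isPrimitiveRoot_of_dvd {n : ℕ} [NeZero n] (h : 5 ∣ n.totient) :
    ∃ k : ZMod n, IsPrimitiveRoot k 5 := by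
  have : Fact (Nat.Prime 5) := ⟨by norm_num⟩
  obtain ⟨u, hu⟩ := exists_prime_orderOf_dvd_card' (G := (ZMod n)ˣ) 5
    (by rwa [Nat.card_eq_fintype_card, ZMod.card_units_eq_totient])
  exact ⟨u, IsPrimitiveRoot.coe_units_iff.2 (hu ▸ IsPrimitiveRoot.orderOf u)⟩

theorem rel_ne_zero_of_modEq_neg_one (hp11 : 11 ≤ p) (hmod : (p : ℤ) ≡ -1 [ZMOD 5]) (c : ZMod p) :
    1 + c + c ^ 2 + c ^ 3 + c ^ 4 ≠ 0 := by
  intro hc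
  have h5 := pow_five_of_rel hc
  have : Fact (Nat.Prime 5) := ⟨by norm_num⟩
  have hord : orderOf c = 5 := by
    refine orderOf_eq_prime h5 ?_
    rintro rfl
    exact five_ne_zero_zmod hp11 (by rw [← hc]; norm_num)
  have hc0 : c ≠ 0 := by
    rintro rfl
    norm_num at h5
  have h1 : 5 ∣ p - 1 := hord ▸ orderOf_dvd_of_pow_eq_one (ZMod.pow_card_sub_one_eq_one hc0)
  unfold Int.ModEq at hmod
  omega

theorem exists_sq_eq_five (hp11 : 11 ≤ p) (hmod : (p : ℤ) ≡ -1 [ZMOD 5]) :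
    ∃ w : ZMod p, w ^ 2 = 5 := by
  have h1 : IsSquare ((p : ℕ) : ZMod 5) := by
    have : ((p : ℤ) : ZMod 5) = ((-1 : ℤ) : ZMod 5) := (ZMod.intCast_eq_intCast_iff _ _ 5).2 hmod
    rw [Int.cast_natCast] at this
    rw [this]
    exact ⟨2, by decide⟩
  have : Fact (Nat.Prime 5) := ⟨by norm_num⟩
  obtain ⟨w, hw⟩ := (ZMod.exists_sq_eq_prime_iff_of_mod_four_eq_one (p := 5) (q := p) (by norm_num)
    (by omega)).1 h1
  exact ⟨w, by rw [pow_two, ← hw]; norm_num⟩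

theorem two_ne_zero_zmod (hp11 : 11 ≤ p) : (2 : ZMod p) ≠ 0 := fun h =>
  absurd (Nat.le_of_dvd (by norm_num) ((ZMod.natCast_eq_zero_iff 2 p).1 h)) (by omega)

theorem exists_quadratic_roots (hp11 : 11 ≤ p) (hmod : (p : ℤ) ≡ -1 [ZMOD 5]) :
    ∃ t₁ t₂ : ZMod p, t₁ ≠ t₂ ∧ ∀ y : ZMod p, y ^ 2 + y - 1 = 0 ↔ y = t₁ ∨ y = t₂ := by
  obtain ⟨w, hw⟩ := exists_sq_eq_five hp11 hmod
  have h2 := two_ne_zero_zmod hp11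
  refine ⟨(-1 + w) / 2, (-1 - w) / 2, fun h => ?_, fun y => ?_⟩
  · have h3 : w = 0 := by
      field_simp at h
      have : 2 * w = 0 := by linear_combination h
      exact (mul_eq_zero.1 this).resolve_left h2
    rw [h3] at hw
    exact five_ne_zero_zmod hp11 (by rw [← hw]; norm_num)
  · have h4 : (2 : ZMod p) * 2 ≠ 0 := mul_ne_zero h2 h2
    rw [eq_div_iff h2, eq_div_iff h2, ← sub_eq_zero (a := y * 2), ← sub_eq_zero (b := -1 - w),
      ← mul_eq_zero, ← mul_right_inj' h4, mul_zero]
    refine Eq.congr ?_ rfl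
    linear_combination hw

theorem add_eq_neg_one_of_roots (hp11 : 11 ≤ p) {t₁ t₂ : ZMod p}
    (h : ∀ y : ZMod p, y ^ 2 + y - 1 = 0 ↔ y = t₁ ∨ y = t₂) : t₁ + t₂ = -1 := by
  have h1 := (h t₁).2 (Or.inl rfl)
  rcases (h (-1 - t₁)).1 (by linear_combination h1) with h2 | h2
  · -- a double root would make the discriminant `5` vanish
    exact absurd (by linear_combination (2 * t₁ + 1) * (-h2) - 4 * h1) (five_ne_zero_zmod hp11)
  · rw [← h2]; ring

end Roots

/-! ### The quotients for `p ≡ -1 mod 5` -/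

open OrientedMap

namespace CyclotomicQuotient

variable {p : ℕ} [hp : Fact p.Prime]

section Inert

/-- The structure homomorphism of an inert quotient. -/
noncomputable def inertOf (t : ZMod p) (ht : t ^ 2 + t - 1 = 0) :
    ZMod p →+* (inert t ht).carrier :=
  AdjoinRoot.of (X ^ 2 + C (-t) * X + C 1)

theorem inertOf_injective (t : ZMod p) (ht : t ^ 2 + t - 1 = 0) :
    Function.Injective (inertOf t ht) := by
  have : Nontrivial (inert t ht).carrier := by
    rw [← Finite.one_lt_card_iff_nontrivial, (inert t ht).card]
    exact Nat.one_lt_pow two_ne_zero hp.out.one_lt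
  exact (inertOf t ht).injective

theorem inert_sq {t : ZMod p} (ht : t ^ 2 + t - 1 = 0) :
    (inert t ht).x ^ 2 - inertOf t ht t * (inert t ht).x + 1 = 0 := by
  have h : eval₂ (inertOf t ht) (inert t ht).x (X ^ 2 + C (-t) * X + C 1) = 0 :=
    AdjoinRoot.eval₂_root (X ^ 2 + C (-t) * X + C 1)
  simp only [eval₂_add, eval₂_mul, eval₂_pow, eval₂_X, eval₂_C] at h
  rw [map_neg, map_one, neg_mul, ← sub_eq_add_neg] at h
  exact h

/-- The parameter `t` is recovered from the kernel, which contains `X² - tX + 1`. -/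
theorem eq_of_ker_inert {t t' : ZMod p} {ht : t ^ 2 + t - 1 = 0} {ht' : t' ^ 2 + t' - 1 = 0}
    (h : (inert t ht).ker = (inert t' ht').ker) : t = t' := by
  have hcast {u : ZMod p} (hu : u ^ 2 + u - 1 = 0) (v : ZMod p) :
      ((v.val : ℕ) : (inert u hu).carrier) = inertOf u hu v := by
    rw [← map_natCast (inertOf u hu), ZMod.natCast_zmod_val]
  have hf {u : ZMod p} (hu : u ^ 2 + u - 1 = 0) :
      aeval (inert u hu).x (X ^ 2 - (t.val : ℤ[X]) * X + 1) =
        (inert u hu).x ^ 2 - inertOf u hu t * (inert u hu).x + 1 := by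
    rw [map_add, map_sub, map_pow, map_mul, aeval_X, map_natCast, map_one, hcast]
  have h1 : (X ^ 2 - (t.val : ℤ[X]) * X + 1) ∈ (inert t' ht').ker := by
    rw [← h, mem_ker, hf, inert_sq]
  rw [mem_ker, hf] at h1
  have h2 := inert_sq ht'
  have h5 := pow_five_of_rel (inert t' ht').rel
  apply inertOf_injective t' ht'
  linear_combination (inert t' ht').x ^ 4 * (h2 - h1) - (inertOf t' ht' t - inertOf t' ht' t') * h5

/-- The polynomial `X² - tX + 1` is self-reciprocal, so its roots are inverse to each other. -/
theorem ker_conj_inert (t : ZMod p) (ht : t ^ 2 + t - 1 = 0) :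
    (inert t ht).conj.ker = (inert t ht).ker := by
  have h1 := inert_sq ht
  have h5 := pow_five_of_rel (inert t ht).rel
  have h2 : eval₂ (inertOf t ht) ((inert t ht).x ^ 4) (X ^ 2 + C (-t) * X + C 1) = 0 := by
    simp only [eval₂_add, eval₂_mul, eval₂_pow, eval₂_X, eval₂_C]
    rw [map_neg, map_one]
    linear_combination (inert t ht).x ^ 8 * h1 -
      ((inert t ht).x ^ 5 + 1 - inertOf t ht t * (inert t ht).x ^ 4) * h5
  let f : (inert t ht).carrier →+* (inert t ht).carrier :=
    AdjoinRoot.lift (inertOf t ht) ((inert t ht).x ^ 4) h2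
  exact (ker_eq_of_le (ker_le_of_ringHom (X := inert t ht) (Y := (inert t ht).conj) f
    (AdjoinRoot.lift_root h2))).symm

/-- Both inert quotients have the same group: replacing `x` by `x²` exchanges the two traces. -/
theorem nonempty_GZeroHat_inert {t t₁ t₂ : ZMod p} (ht : t ^ 2 + t - 1 = 0)
    (h₁ : t₁ ^ 2 + t₁ - 1 = 0) (h₂ : t₁ + t₂ = -1) (h : t = t₁ ∨ t = t₂) :
    Nonempty (TwistedGroup (inert t ht).rel ≃* GZeroHat p t₁ t₂) := by
  have hx := inert_sq ht
  rcases h with rfl | rfl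
  · refine nonempty_GZeroHat _ (inertOf t ht) h₁ h₂ (m := 1) (m' := 1) rfl ?_
    linear_combination hx
  · -- the square of a root of `X² - tX + 1` has trace `t² - 2 = -1 - t`
    refine nonempty_GZeroHat _ (inertOf t ht) h₁ h₂ (m := 2) (m' := 3) rfl ?_
    have h3 : inertOf t ht t₁ = inertOf t ht t ^ 2 - 2 := by
      rw [← map_pow, ← map_ofNat (inertOf t ht) 2, ← map_sub]
      congr 1
      linear_combination h₂ - ht
    rw [h3]
    linear_combination ((inert t ht).x ^ 2 + inertOf t ht t * (inert t ht).x + 1) * hx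

end Inert

/-! ### The quotients for `p ≡ 1 mod 5` -/

section Split

/-- The indices of the ten quotients of `ℤ[ζ₅]` of order `p²` for `p ≡ 1 mod 5`: the index `i`
stands for the prime ideal over `p` containing `ζ₅ - sⁱ⁺¹`, a quotient corresponds to the product of
two of the four prime ideals, and the squares come first. -/
abbrev PairIndex : Type := Fin 4 ⊕ {x : Fin 4 × Fin 4 // x.1 < x.2}

/-- The action of complex conjugation on the indices. -/
def PairIndex.conj : PairIndex → PairIndex
  | .inl i => .inl i.rev
  | .inr x => .inr ⟨(x.1.2.rev, x.1.1.rev), Fin.rev_lt_rev.2 x.2⟩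

/-- The quotient with a given index. -/
def ofIndex (hp11 : 11 ≤ p) {k : ZMod (p ^ 2)} {s : ZMod p} (hk : IsPrimitiveRoot k 5)
    (hs : IsPrimitiveRoot s 5) : PairIndex → CyclotomicQuotient p
  | .inl i => cyclic (k ^ (i.val + 1))
      (rel_of_isPrimitiveRoot_sq hp11 (isPrimitiveRoot_pow_succ hk i))
  | .inr x => split (s ^ (x.1.1.val + 1)) (s ^ (x.1.2.val + 1))
      (fun h => x.2.ne (pow_succ_injective hs h))
      (rel_of_isPrimitiveRoot (isPrimitiveRoot_pow_succ hs x.1.1))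
      (rel_of_isPrimitiveRoot (isPrimitiveRoot_pow_succ hs x.1.2))

theorem natCast_split {a b : ZMod p} (hab : a ≠ b) (ha : 1 + a + a ^ 2 + a ^ 3 + a ^ 4 = 0)
    (hb : 1 + b + b ^ 2 + b ^ 3 + b ^ 4 = 0) : (p : (split a b hab ha hb).carrier) = 0 :=
  Prod.ext (ZMod.natCast_self p) (ZMod.natCast_self p)

theorem natCast_cyclic {k : ZMod (p ^ 2)} (hk : 1 + k + k ^ 2 + k ^ 3 + k ^ 4 = 0) :
    (p : (cyclic k hk).carrier) ≠ 0 := fun h => by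
  have h1 : ((p : ℕ) : ZMod (p ^ 2)) = 0 := h
  rw [ZMod.natCast_eq_zero_iff] at h1
  have h2 := Nat.le_of_dvd hp.out.pos h1
  nlinarith [hp.out.two_le]

omit hp in
theorem natCast_eq_zero_of_ker {X Y : CyclotomicQuotient p} (h : X.ker ≤ Y.ker)
    (hX : (p : X.carrier) = 0) : (p : Y.carrier) = 0 := by
  have h1 : (p : ℤ[X]) ∈ X.ker := by rw [mem_ker, map_natCast, hX]
  have h2 := mem_ker.1 (h h1)
  rwa [map_natCast] at h2

/-- An isomorphism between two cyclic quotients is the identity of `ℤ/p²`. -/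
theorem eq_of_ker_cyclic {k k' : ZMod (p ^ 2)} {hk : 1 + k + k ^ 2 + k ^ 3 + k ^ 4 = 0}
    {hk' : 1 + k' + k' ^ 2 + k' ^ 3 + k' ^ 4 = 0} (h : (cyclic k hk).ker = (cyclic k' hk').ker) :
    k = k' := by
  obtain ⟨e, he⟩ := exists_ringEquiv h.le
  let e' : ZMod (p ^ 2) →+* ZMod (p ^ 2) := (e : (cyclic k hk).carrier →+* (cyclic k' hk').carrier)
  have h1 : e' = RingHom.id _ := Subsingleton.elim _ _
  have h2 : e' k = k' := he
  rwa [h1] at h2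

/-- The roots `a` and `b` are recovered from the kernel: `(X - a)(X - b)` lies in it. -/
theorem eq_or_eq_of_ker_split {a b c d : ZMod p} {hab : a ≠ b}
    {ha : 1 + a + a ^ 2 + a ^ 3 + a ^ 4 = 0} {hb : 1 + b + b ^ 2 + b ^ 3 + b ^ 4 = 0} {hcd : c ≠ d}
    {hc : 1 + c + c ^ 2 + c ^ 3 + c ^ 4 = 0} {hd : 1 + d + d ^ 2 + d ^ 3 + d ^ 4 = 0}
    (h : (split a b hab ha hb).ker ≤ (split c d hcd hc hd).ker) :
    (c = a ∨ c = b) ∧ (d = a ∨ d = b) := by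
  have hcast (n : ℕ) (u v : ZMod p) (huv : u ≠ v) (hu hv) :
      (n : (split u v huv hu hv).carrier) = ((n : ZMod p), (n : ZMod p)) := rfl
  have hf (u v : ZMod p) (huv : u ≠ v) (hu hv) :
      aeval (split u v huv hu hv).x ((X - (a.val : ℤ[X])) * (X - (b.val : ℤ[X]))) =
        (((u - a) * (u - b), (v - a) * (v - b)) : ZMod p × ZMod p) := by
    rw [map_mul, map_sub, map_sub, aeval_X, map_natCast, map_natCast, hcast, hcast,
      ZMod.natCast_zmod_val, ZMod.natCast_zmod_val]
    rfl
  have h1 : (X - (a.val : ℤ[X])) * (X - (b.val : ℤ[X])) ∈ (split c d hcd hc hd).ker := by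
    refine h ?_
    rw [mem_ker, hf]
    refine Prod.ext ?_ ?_
    · change (a - a) * (a - b) = 0
      ring
    · change (b - a) * (b - b) = 0
      ring
  rw [mem_ker, hf] at h1
  have h2 : (c - a) * (c - b) = 0 := congrArg Prod.fst h1
  have h3 : (d - a) * (d - b) = 0 := congrArg Prod.snd h1
  simpa only [mul_eq_zero, sub_eq_zero] using And.intro h2 h3

theorem ker_split_comm {a b : ZMod p} (hab : a ≠ b) (ha : 1 + a + a ^ 2 + a ^ 3 + a ^ 4 = 0)
    (hb : 1 + b + b ^ 2 + b ^ 3 + b ^ 4 = 0) :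
    (split a b hab ha hb).ker = (split b a hab.symm hb ha).ker :=
  ker_eq_of_le (ker_le_of_ringHom (X := split a b hab ha hb) (Y := split b a hab.symm hb ha)
    (RingEquiv.prodComm : ZMod p × ZMod p ≃+* ZMod p × ZMod p).toRingHom rfl)

variable (hp11 : 11 ≤ p) {k : ZMod (p ^ 2)} {s : ZMod p} (hk : IsPrimitiveRoot k 5)
  (hs : IsPrimitiveRoot s 5)

theorem ofIndex_injective (i j : PairIndex)
    (h : (ofIndex hp11 hk hs i).ker = (ofIndex hp11 hk hs j).ker) : i = j := by
  rcases i with i | x <;> rcases j with j | y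
  · rw [pow_succ_injective hk (eq_of_ker_cyclic h)]
  · exact absurd (natCast_eq_zero_of_ker h.ge (natCast_split
      (fun h => y.2.ne (pow_succ_injective hs h))
      (rel_of_isPrimitiveRoot (isPrimitiveRoot_pow_succ hs y.1.1))
      (rel_of_isPrimitiveRoot (isPrimitiveRoot_pow_succ hs y.1.2)))) (natCast_cyclic _)
  · exact absurd (natCast_eq_zero_of_ker h.le (natCast_split
      (fun h => x.2.ne (pow_succ_injective hs h))
      (rel_of_isPrimitiveRoot (isPrimitiveRoot_pow_succ hs x.1.1))
      (rel_of_isPrimitiveRoot (isPrimitiveRoot_pow_succ hs x.1.2)))) (natCast_cyclic _)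
  · obtain ⟨h1, h2⟩ := eq_or_eq_of_ker_split
      (hab := fun h => x.2.ne (pow_succ_injective hs h))
      (ha := rel_of_isPrimitiveRoot (isPrimitiveRoot_pow_succ hs x.1.1))
      (hb := rel_of_isPrimitiveRoot (isPrimitiveRoot_pow_succ hs x.1.2))
      (hcd := fun h => y.2.ne (pow_succ_injective hs h))
      (hc := rel_of_isPrimitiveRoot (isPrimitiveRoot_pow_succ hs y.1.1))
      (hd := rel_of_isPrimitiveRoot (isPrimitiveRoot_pow_succ hs y.1.2)) h.le
    have hx := x.2
    have hy := y.2
    have h3 := h1.imp (pow_succ_injective hs) (pow_succ_injective hs)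
    have h4 := h2.imp (pow_succ_injective hs) (pow_succ_injective hs)
    congr 1
    refine Subtype.ext (Prod.ext ?_ ?_) <;> omega

theorem exists_ofIndex (Y : CyclotomicQuotient p) : ∃ i, (ofIndex hp11 hk hs i).ker = Y.ker := by
  by_cases h : (p : Y.carrier) = 0
  · obtain ⟨a, b, hab, ha, hb, hY⟩ := exists_split hp11 Y h hs
    have : IsCyclic (ZMod p)ˣ := inferInstance
    obtain ⟨i, rfl⟩ := exists_pow_succ_eq (five_ne_zero_zmod hp11) hs ha
    obtain ⟨j, rfl⟩ := exists_pow_succ_eq (five_ne_zero_zmod hp11) hs hb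
    have hij : i ≠ j := fun h => hab (by rw [h])
    rcases lt_or_gt_of_ne hij with h1 | h1
    · exact ⟨.inr ⟨(i, j), h1⟩, hY⟩
    · exact ⟨.inr ⟨(j, i), h1⟩, (ker_split_comm hab.symm hb ha).trans hY⟩
  · obtain ⟨r, hr, hY⟩ := exists_cyclic Y h
    have : IsCyclic (ZMod (p ^ 2))ˣ := ZMod.isCyclic_units_of_prime_pow p hp.out (by omega) 2
    have : NeZero (p ^ 2) := ⟨pow_ne_zero _ hp.out.ne_zero⟩
    obtain ⟨i, rfl⟩ := exists_pow_succ_eq (five_ne_zero_zmod_sq hp11) hk hr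
    exact ⟨.inl i, hY⟩

theorem ker_conj_ofIndex (i : PairIndex) :
    (ofIndex hp11 hk hs i).conj.ker = (ofIndex hp11 hk hs i.conj).ker := by
  have hpow {R : Type} [CommRing R] {r : R} (hr : r ^ 5 = 1) (i : Fin 4) :
      (r ^ (i.val + 1)) ^ 4 = r ^ (i.rev.val + 1) := by
    rw [← pow_mul, Fin.val_rev, show (i.val + 1) * 4 = 5 * i.val + (4 - (i.val + 1) + 1) by omega,
      pow_add, pow_mul, hr, one_pow, one_mul]
  rcases i with i | x
  · exact ker_eq_of_le (ker_le_of_ringHom (X := (ofIndex hp11 hk hs (.inl i)).conj)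
      (Y := ofIndex hp11 hk hs (.inl i.rev)) (RingHom.id (ZMod (p ^ 2))) (hpow hk.pow_eq_one i))
  · exact ker_eq_of_le (ker_le_of_ringHom (X := (ofIndex hp11 hk hs (.inr x)).conj)
      (Y := ofIndex hp11 hk hs (PairIndex.conj (.inr x)))
      (RingEquiv.prodComm : ZMod p × ZMod p ≃+* ZMod p × ZMod p).toRingHom
      (Prod.ext (hpow hs.pow_eq_one x.1.2) (hpow hs.pow_eq_one x.1.1)))

/-- Replacing `x` by a power of it turns any primitive fifth root of unity into `k`. -/
theorem nonempty_GOneHat_ofIndex (i : Fin 4) :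
    Nonempty (TwistedGroup (ofIndex hp11 hk hs (.inl i)).rel ≃* GOneHat p k) := by
  obtain ⟨m, hm⟩ : ∃ m : ℕ, m * (i.val + 1) % 5 = 1 := by
    fin_cases i
    exacts [⟨1, rfl⟩, ⟨3, rfl⟩, ⟨2, rfl⟩, ⟨4, rfl⟩]
  have h1 := nonempty_GOneHat (rel_of_isPrimitiveRoot_sq hp11 (isPrimitiveRoot_pow_succ hk i)) hm
  have h2 : (k ^ (i.val + 1)) ^ m = k := by
    rw [← pow_mul, mul_comm, ← Nat.div_add_mod (m * (i.val + 1)) 5, hm, pow_add, pow_mul,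
      hk.pow_eq_one, one_pow, one_mul, pow_one]
  rwa [h2] at h1

theorem nonempty_GHat_of_pow {i j : Fin 4} (hij : i ≠ j) {m m' u v : ℕ} (hm : m * m' % 5 = 1)
    (hu : (i.val + 1) * m % 5 = u) (hv : (j.val + 1) * m % 5 = v) :
    Nonempty (TwistedGroup (split (s ^ (i.val + 1)) (s ^ (j.val + 1))
      (fun h => hij (pow_succ_injective hs h))
      (rel_of_isPrimitiveRoot (isPrimitiveRoot_pow_succ hs i))
      (rel_of_isPrimitiveRoot (isPrimitiveRoot_pow_succ hs j))).rel ≃*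
      GHat p (s ^ u) (s ^ v)) := by
  have h1 := nonempty_GHat (fun h => hij (pow_succ_injective hs h))
    (rel_of_isPrimitiveRoot (isPrimitiveRoot_pow_succ hs i))
    (rel_of_isPrimitiveRoot (isPrimitiveRoot_pow_succ hs j)) hm
  have h2 (n : ℕ) : s ^ n = s ^ (n % 5) := by
    conv_lhs => rw [← Nat.div_add_mod n 5, pow_add, pow_mul, hs.pow_eq_one, one_pow, one_mul]
  rwa [← pow_mul, ← pow_mul, h2 ((i.val + 1) * m), h2 ((j.val + 1) * m), hu, hv] at h1

theorem nonempty_GHat_of_pow_swap {i j : Fin 4} (hij : i ≠ j) {m m' u v : ℕ}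
    (hm : m * m' % 5 = 1) (hu : (j.val + 1) * m % 5 = u) (hv : (i.val + 1) * m % 5 = v) :
    Nonempty (TwistedGroup (split (s ^ (i.val + 1)) (s ^ (j.val + 1))
      (fun h => hij (pow_succ_injective hs h))
      (rel_of_isPrimitiveRoot (isPrimitiveRoot_pow_succ hs i))
      (rel_of_isPrimitiveRoot (isPrimitiveRoot_pow_succ hs j))).rel ≃*
      GHat p (s ^ u) (s ^ v)) := by
  obtain ⟨e⟩ := nonempty_GHat_of_pow hs hij.symm hm hu hv
  obtain ⟨f⟩ := nonempty_mulEquiv_of_ker (ker_split_comm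
    (fun h => hij (pow_succ_injective hs h))
    (rel_of_isPrimitiveRoot (isPrimitiveRoot_pow_succ hs i))
    (rel_of_isPrimitiveRoot (isPrimitiveRoot_pow_succ hs j))).le
  exact ⟨f.trans e⟩

/-- Replacing `x` by a power of it brings its two coordinates to `s`, `s²` or to `s`, `s⁴`. -/
theorem nonempty_GHat_ofIndex (x : {x : Fin 4 × Fin 4 // x.1 < x.2}) :
    (PairIndex.conj (.inr x) ≠ .inr x →
      Nonempty (TwistedGroup (ofIndex hp11 hk hs (.inr x)).rel ≃* GHat p s (s ^ 2))) ∧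
    (PairIndex.conj (.inr x) = .inr x →
      Nonempty (TwistedGroup (ofIndex hp11 hk hs (.inr x)).rel ≃* GHat p s (s ^ 4))) := by
  refine ⟨fun hc => ?_, fun hc => ?_⟩
  · have hx : x.1 = (0, 1) ∨ x.1 = (0, 2) ∨ x.1 = (1, 3) ∨ x.1 = (2, 3) := by
      revert x
      decide
    obtain ⟨y, hy⟩ := x
    rcases hx with rfl | rfl | rfl | rfl
    · have h := nonempty_GHat_of_pow hs hy.ne (m := 1) (m' := 1) (u := 1) (v := 2) rfl rfl rfl
      rwa [pow_one] at h
    · have h := nonempty_GHat_of_pow_swap hs hy.ne (m := 2) (m' := 3) (u := 1) (v := 2) rfl rfl rfl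
      rwa [pow_one] at h
    · have h := nonempty_GHat_of_pow hs hy.ne (m := 3) (m' := 2) (u := 1) (v := 2) rfl rfl rfl
      rwa [pow_one] at h
    · have h := nonempty_GHat_of_pow_swap hs hy.ne (m := 4) (m' := 4) (u := 1) (v := 2) rfl rfl rfl
      rwa [pow_one] at h
  · have hx : x.1 = (0, 3) ∨ x.1 = (1, 2) := by
      revert x
      decide
    obtain ⟨y, hy⟩ := x
    rcases hx with rfl | rfl
    · have h := nonempty_GHat_of_pow hs hy.ne (m := 1) (m' := 1) (u := 1) (v := 4) rfl rfl rfl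
      rwa [pow_one] at h
    · have h := nonempty_GHat_of_pow hs hy.ne (m := 3) (m' := 2) (u := 1) (v := 4) rfl rfl rfl
      rwa [pow_one] at h

end Split

/-! ### The classification -/

/-- The automorphism group of a map is the twisted group of the quotient the map comes from. -/
theorem nonempty_autPlus_of_equivUpToDuality {X : CyclotomicQuotient p} {M : OrientedMap}
    (h : X.toMap.EquivUpToDuality M) : Nonempty (M.autPlus ≃* TwistedGroup X.rel) := by
  obtain ⟨e⟩ := h.nonempty_autPlus
  obtain ⟨f⟩ := X.nonempty_autPlus_toMap
  exact ⟨e.trans f⟩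

theorem nonempty_autPlus_mulEquiv_iff {X : CyclotomicQuotient p} {M : OrientedMap}
    (h : X.toMap.EquivUpToDuality M) {G : Type*} [Group G] :
    Nonempty (M.autPlus ≃* G) ↔ Nonempty (TwistedGroup X.rel ≃* G) := by
  obtain ⟨e⟩ := nonempty_autPlus_of_equivUpToDuality h
  exact ⟨fun ⟨f⟩ => ⟨e.symm.trans f⟩, fun ⟨f⟩ => ⟨e.trans f⟩⟩

section Split

variable (hp11 : 11 ≤ p) {k : ZMod (p ^ 2)} {s : ZMod p} (hk : IsPrimitiveRoot k 5)
  (hs : IsPrimitiveRoot s 5)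

theorem isReflexive_ofIndex_iff {i : PairIndex} {M : OrientedMap}
    (h : (ofIndex hp11 hk hs i).toMap.EquivUpToDuality M) : M.IsReflexive ↔ i.conj = i :=
  h.isReflexive_iff.symm.trans
    (isReflexive_toMap_iff (ofIndex_injective hp11 hk hs) (ker_conj_ofIndex hp11 hk hs) i)

/-- The group `GOneHat p k` is the one with elements of order `p²`; it belongs to the quotients
`ℤ/p²`. -/
theorem nonempty_GOneHat_ofIndex_iff (i : PairIndex) :
    Nonempty (TwistedGroup (ofIndex hp11 hk hs i).rel ≃* GOneHat p k) ↔ i.isLeft := by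
  rcases i with i | x
  · exact iff_of_true (nonempty_GOneHat_ofIndex hp11 hk hs i) rfl
  · refine iff_of_false (fun ⟨e⟩ => ?_) Bool.false_ne_true
    obtain ⟨f⟩ := nonempty_GOneHat_ofIndex hp11 hk hs 0
    exact natCast_cyclic _ (natCast_eq_zero_of_mulEquiv hp11 (f.trans e.symm)
      (natCast_split (fun h => x.2.ne (pow_succ_injective hs h))
        (rel_of_isPrimitiveRoot (isPrimitiveRoot_pow_succ hs x.1.1))
        (rel_of_isPrimitiveRoot (isPrimitiveRoot_pow_succ hs x.1.2))))

theorem nonempty_GHat_ofIndex_iff (i : PairIndex) (hi : i.conj ≠ i) :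
    Nonempty (TwistedGroup (ofIndex hp11 hk hs i).rel ≃* GHat p s (s ^ 2)) ↔ i.isRight := by
  rcases i with i | x
  · refine iff_of_false (fun ⟨e⟩ => ?_) Bool.false_ne_true
    let x : {x : Fin 4 × Fin 4 // x.1 < x.2} := ⟨(0, 1), by decide⟩
    obtain ⟨f⟩ := (nonempty_GHat_ofIndex hp11 hk hs x).1 (by decide)
    exact natCast_cyclic _ (natCast_eq_zero_of_mulEquiv hp11 (e.trans f.symm)
      (natCast_split (fun h => x.2.ne (pow_succ_injective hs h))
        (rel_of_isPrimitiveRoot (isPrimitiveRoot_pow_succ hs x.1.1))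
        (rel_of_isPrimitiveRoot (isPrimitiveRoot_pow_succ hs x.1.2))))
  · exact iff_of_true ((nonempty_GHat_ofIndex hp11 hk hs x).1 hi) rfl

theorem PairIndex.conj_inl_ne (i : Fin 4) : PairIndex.conj (.inl i) ≠ .inl i := by
  revert i
  decide

/-- The classification for `p ≡ 1 mod 5`. -/
theorem classification_of_isPrimitiveRoot (hp11 : 11 ≤ p) {k : ZMod (p ^ 2)} {s : ZMod p}
    (hk : IsPrimitiveRoot k 5) (hs : IsPrimitiveRoot s 5) :
    (classes (regularMaps p)).ncard = 10 ∧
    (classes {M ∈ regularMaps p | M.IsReflexive}).ncard = 2 ∧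
    (classes {M ∈ regularMaps p | M.IsChiral}).ncard = 8 ∧
    (chiralPairs (regularMaps p)).ncard = 4 ∧
    (chiralPairs {M ∈ regularMaps p | Nonempty (M.autPlus ≃* GOneHat p k)}).ncard = 2 ∧
    (chiralPairs {M ∈ regularMaps p | Nonempty (M.autPlus ≃* GHat p s (s ^ 2))}).ncard = 2 ∧
    (∀ M ∈ regularMaps p, M.IsChiral →
      Nonempty (M.autPlus ≃* GOneHat p k) ∨ Nonempty (M.autPlus ≃* GHat p s (s ^ 2))) ∧
    (∀ M ∈ regularMaps p, M.IsReflexive → Nonempty (M.autPlus ≃* GHat p s (s ^ 4))) := by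
  have hinj := ofIndex_injective hp11 hk hs
  have hex := exists_ofIndex hp11 hk hs
  have hσ := ker_conj_ofIndex hp11 hk hs
  refine ⟨?_, ?_, ?_, ?_, ?_, ?_, ?_, ?_⟩
  · rw [ncard_classes hp11 hinj hex subset_rfl (Q := fun _ => True) fun M hM _ _ =>
      iff_of_true hM trivial, Set.ncard_eq_toFinset_card']
    rfl
  · rw [ncard_classes hp11 hinj hex (Set.sep_subset _ _) (Q := fun i => i.conj = i)
      fun M hM i hi => (and_iff_right hM).trans (isReflexive_ofIndex_iff hp11 hk hs hi),
      Set.ncard_eq_toFinset_card']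
    rfl
  · rw [ncard_classes hp11 hinj hex (S := {M ∈ regularMaps p | M.IsChiral})
      (Set.sep_subset _ _) (Q := fun i => i.conj ≠ i) fun M hM i hi =>
      (and_iff_right hM).trans (isReflexive_ofIndex_iff hp11 hk hs hi).not,
      Set.ncard_eq_toFinset_card']
    rfl
  · rw [ncard_chiralPairs hp11 hinj hex hσ subset_rfl (Q := fun _ => True) fun M hM _ _ _ =>
      iff_of_true hM trivial, Set.ncard_eq_toFinset_card']
    rfl
  · rw [ncard_chiralPairs hp11 hinj hex hσ (Set.sep_subset _ _) (Q := fun i => i.isLeft)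
      fun M hM i _ hi => (and_iff_right hM).trans ((nonempty_autPlus_mulEquiv_iff hi).trans
        (nonempty_GOneHat_ofIndex_iff hp11 hk hs i)), Set.ncard_eq_toFinset_card']
    rfl
  · rw [ncard_chiralPairs hp11 hinj hex hσ (Set.sep_subset _ _) (Q := fun i => i.isRight)
      fun M hM i hne hi => (and_iff_right hM).trans ((nonempty_autPlus_mulEquiv_iff hi).trans
        (nonempty_GHat_ofIndex_iff hp11 hk hs i hne)), Set.ncard_eq_toFinset_card']
    rfl
  · intro M hM hc
    obtain ⟨i, hi⟩ := exists_index_equivUpToDuality hp11 hex hM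
    rw [nonempty_autPlus_mulEquiv_iff hi, nonempty_autPlus_mulEquiv_iff hi]
    have hne := (isReflexive_ofIndex_iff hp11 hk hs hi).not.1 hc
    rw [nonempty_GOneHat_ofIndex_iff, nonempty_GHat_ofIndex_iff hp11 hk hs i hne]
    cases i
    · exact Or.inl rfl
    · exact Or.inr rfl
  · intro M hM hr
    obtain ⟨i, hi⟩ := exists_index_equivUpToDuality hp11 hex hM
    rw [nonempty_autPlus_mulEquiv_iff hi]
    have hfix := (isReflexive_ofIndex_iff hp11 hk hs hi).1 hr
    rcases i with i | x
    · exact absurd hfix (PairIndex.conj_inl_ne i)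
    · exact (nonempty_GHat_ofIndex hp11 hk hs x).2 hfix

end Split

/-- The classification for `p ≡ -1 mod 5`. -/
theorem classification_of_modEq_neg_one (hp11 : 11 ≤ p) (hmod : (p : ℤ) ≡ -1 [ZMOD 5]) :
    (classes (regularMaps p)).ncard = 2 ∧ (∀ M ∈ regularMaps p, M.IsReflexive) ∧
    ∀ t₁ t₂ : ZMod p, (∀ y : ZMod p, y ^ 2 + y - 1 = 0 ↔ y = t₁ ∨ y = t₂) →
      ∀ M ∈ regularMaps p, Nonempty (M.autPlus ≃* GZeroHat p t₁ t₂) := by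
  let F : {t : ZMod p // t ^ 2 + t - 1 = 0} → CyclotomicQuotient p := fun t => inert t.1 t.2
  have hinj (i j) (h : (F i).ker = (F j).ker) : i = j := Subtype.ext (eq_of_ker_inert h)
  have hex (X : CyclotomicQuotient p) : ∃ i, (F i).ker = X.ker := by
    obtain ⟨t, ht, h⟩ := exists_inert X (rel_ne_zero_of_modEq_neg_one hp11 hmod)
    exact ⟨⟨t, ht⟩, h⟩
  have hσ (i) : (F i).conj.ker = (F (id i)).ker := ker_conj_inert i.1 i.2
  refine ⟨?_, fun M hM => ?_, fun t₁ t₂ h M hM => ?_⟩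
  · obtain ⟨t₁, t₂, hne, h⟩ := exists_quadratic_roots hp11 hmod
    have hset : {t : ZMod p | t ^ 2 + t - 1 = 0} = {t₁, t₂} := Set.ext h
    rw [ncard_classes hp11 hinj hex subset_rfl (Q := fun _ => True) fun M hM _ _ =>
      iff_of_true hM trivial, Set.ofPred_true, Set.ncard_univ]
    change {t : ZMod p | t ^ 2 + t - 1 = 0}.ncard = 2
    rw [hset, Set.ncard_pair hne]
  · obtain ⟨i, hi⟩ := exists_index_equivUpToDuality hp11 hex hM
    exact hi.isReflexive_iff.1 ((isReflexive_toMap_iff hinj hσ i).2 rfl)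
  · obtain ⟨i, hi⟩ := exists_index_equivUpToDuality hp11 hex hM
    rw [nonempty_autPlus_mulEquiv_iff hi]
    exact nonempty_GZeroHat_inert i.2 ((h t₁).2 (Or.inl rfl)) (add_eq_neg_one_of_roots hp11 h)
      ((h i.1).1 i.2)

end CyclotomicQuotient

theorem mainTheorem1 (p : ℕ) (hp : p.Prime) (hp11 : 11 ≤ p) :
    ((p : ℤ) ≡ -1 [ZMOD 5] →
      (OrientedMap.classes (OrientedMap.regularMaps p)).ncard = 2 ∧
      (∀ M ∈ OrientedMap.regularMaps p, M.IsReflexive) ∧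
      (∃ t₁ t₂ : ZMod p, t₁ ≠ t₂ ∧ ∀ y : ZMod p, y ^ 2 + y - 1 = 0 ↔ y = t₁ ∨ y = t₂) ∧
      (∀ t₁ t₂ : ZMod p, (∀ y : ZMod p, y ^ 2 + y - 1 = 0 ↔ y = t₁ ∨ y = t₂) →
        ∀ M ∈ OrientedMap.regularMaps p, Nonempty (M.autPlus ≃* GZeroHat p t₁ t₂))) ∧
    ((p : ℤ) ≡ 1 [ZMOD 5] →
      (OrientedMap.classes (OrientedMap.regularMaps p)).ncard = 10 ∧
      (OrientedMap.classes {M ∈ OrientedMap.regularMaps p | M.IsReflexive}).ncard = 2 ∧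
      (OrientedMap.classes {M ∈ OrientedMap.regularMaps p | M.IsChiral}).ncard = 8 ∧
      (OrientedMap.chiralPairs (OrientedMap.regularMaps p)).ncard = 4 ∧
      (∃ k : ZMod (p ^ 2), IsPrimitiveRoot k 5) ∧
      (∃ s : ZMod p, IsPrimitiveRoot s 5) ∧
      ∀ (k : ZMod (p ^ 2)) (s : ZMod p), IsPrimitiveRoot k 5 → IsPrimitiveRoot s 5 →
        (OrientedMap.chiralPairs {M ∈ OrientedMap.regularMaps p |
          Nonempty (M.autPlus ≃* GOneHat p k)}).ncard = 2 ∧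
        (OrientedMap.chiralPairs {M ∈ OrientedMap.regularMaps p |
          Nonempty (M.autPlus ≃* GHat p s (s ^ 2))}).ncard = 2 ∧
        (∀ M ∈ OrientedMap.regularMaps p, M.IsChiral →
          Nonempty (M.autPlus ≃* GOneHat p k) ∨ Nonempty (M.autPlus ≃* GHat p s (s ^ 2))) ∧
        (∀ M ∈ OrientedMap.regularMaps p, M.IsReflexive →
          Nonempty (M.autPlus ≃* GHat p s (s ^ 4)))) := by
  have : Fact p.Prime := ⟨hp⟩
  refine ⟨fun hmod => ?_, fun hmod => ?_⟩
  · obtain ⟨h1, h2, h3⟩ := CyclotomicQuotient.classification_of_modEq_neg_one hp11 hmod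
    exact ⟨h1, h2, exists_quadratic_roots hp11 hmod, h3⟩
  · have h5 : 5 ∣ p - 1 := by
      have := hmod.dvd
      omega
    have hk : ∃ k : ZMod (p ^ 2), IsPrimitiveRoot k 5 := by
      have : NeZero (p ^ 2) := ⟨pow_ne_zero _ hp.ne_zero⟩
      have : IsCyclic (ZMod (p ^ 2))ˣ := ZMod.isCyclic_units_of_prime_pow p hp (by omega) 2
      refine exists_isPrimitiveRoot_of_dvd ?_
      rw [Nat.totient_prime_pow hp two_pos]
      exact h5.mul_left _
    have hs : ∃ s : ZMod p, IsPrimitiveRoot s 5 :=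
      exists_isPrimitiveRoot_of_dvd (by rwa [Nat.totient_prime hp])
    obtain ⟨k, hk'⟩ := hk
    obtain ⟨s, hs'⟩ := hs
    obtain ⟨h1, h2, h3, h4, -⟩ :=
      CyclotomicQuotient.classification_of_isPrimitiveRoot hp11 hk' hs'
    refine ⟨h1, h2, h3, h4, ⟨k, hk'⟩, ⟨s, hs'⟩, fun k s hk hs => ?_⟩
    obtain ⟨-, -, -, -, h⟩ := CyclotomicQuotient.classification_of_isPrimitiveRoot hp11 hk hs
    exact h
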